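/- **Conventions.** A *CRT-module* $M=\{M^O_*,M^U_*,M^T_*\}$ consists of three $\mathbb Z$-graded abelian groups which are graded modules over, respectively, $$K_*(\mathbb R)=\mathbb Z[\eta_O,\xi,\beta_O^{\pm1}]/(2\eta_O,\eta_O^3,\eta_O\xi,\xi^2-4\beta_O),\qquad K_*(\mathbb C)=\mathbb Z[\beta_U^{\pm1}],\qquad K_*(T)=\mathbb Z[\eta_T,\omega,\beta_T^{\pm1}]/(2\eta_T,\eta_T^2,\eta_T\omega,\omega^2)$$ (with $|\eta_O|=1$, $|\xi|=4$, $|\beta_O|=8$, $|\beta_U|=2$, $|\eta_T|=1$, $|\omega|=3$, $|\beta_T|=4$), together with additive operations $c\colon M^O_n\to M^U_n$, $r\colon M^U_n\to M^O_n$, $\varepsilon\colon M^O_n\to M^T_n$, $\zeta\colon M^T_n\to M^U_n$, $\psi_U\colon M^U_n\to M^U_n$, $\psi_T\colon M^T_n\to M^T_n$, $\gamma\colon M^U_n\to M^T_{n-1}$, $\tau\colon M^T_n\to M^O_{n+1}$ satisfying $$\begin{aligned} &rc=2,\quad cr=1+\psi_U,\quad r=\tau\gamma,\quad c=\zeta\varepsilon,\quad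 \psi_U^2=1,\quad \psi_T^2=1,\quad \psi_T\varepsilon=\varepsilon,\quad \zeta\gamma=0,\quad \zeta=\psi_U\zeta,\\ &\psi_U\beta_U=-\beta_U\psi_U,\quad \psi_T\beta_T=\beta_T\psi_T,\quad \varepsilon\beta_O=\beta_T^2\varepsilon,\quad \zeta\beta_T=\beta_U^2\zeta,\quad \gamma\beta_U^2=\beta_T\gamma,\quad \tau\beta_T^2=\beta_O\tau,\quad \gamma=\gamma\psi_U,\\ &\eta_O=\tau\varepsilon,\quad \eta_T=\gamma\beta_U\zeta,\quad \xi=r\beta_U^2c,\quad \omega=\beta_T\gamma\zeta,\quad \beta_T\varepsilon\tau=\varepsilon\tau\beta_T+\eta_T\beta_T,\quad \varepsilon r\zeta=1+\psi_T,\\ &\gamma c\tau=1-\psi_T,\quad \tau=-\tau\psi_T,\quad \tau\beta_T\varepsilon=0,\quad \varepsilon\xi=2\beta_T\varepsilon,\quad \xi\tau=2\tau\beta_T . \end{aligned}$$ Homomorphisms (of degree $0$) are families of additive maps $M^X_i\to N^X_i$ commuting with all the ring actions and operations; they form an abelian group $[M,N]_0$. A *free* CRT-module is one that is freely generated by a family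 of elements (each of some part $X\in\{O,U,T\}$ and some degree $i\in\mathbb Z$); $F(b,i,X)$ denotes the free CRT-module on a single generator $b\in F(b,i,X)^X_i$. The tensor product $L\otimes_{CRT}M$ is the target of the universal CRT-pairing. That is, it is the CRT-module generated by symbols $l\otimes m$ of part $X$ and degree $i+j$ (for $l\in L^X_i$, $m\in M^X_j$, $X\in\{O,U,T\}$) subject to biadditivity, graded bilinearity $a(l\otimes m)=(al)\otimes m=(-1)^{|a||l|}\,l\otimes am$ over the coefficient ring of each part, and the relations (in which the part of each element is indicated by its subscript) $$\begin{aligned} &c(l_O\otimes m_O)=cl_O\otimes cm_O,\qquad r(cl_O\otimes m_U)=l_O\otimes rm_U,\qquad r(l_U\otimes cm_O)=rl_U\otimes m_O,\\ &\varepsilon(l_O\otimes m_O)=\varepsilon l_O\otimes\varepsilon m_O,\qquad \zeta(l_T\otimes m_T)=\zeta l_T\otimes\zeta m_T,\\ &\psi_U(l_U\otimes m_U)=\psi_Ul_U\otimes\psi_Um_U,\qquad \psi_T(l_T\otimes m_T)=\psi_Tl_T\otimes\psi_Tm_T,\\ &\gamma(l_U\otimes\zeta m_T)=\gamma l_U\otimes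 m_T,\qquad \gamma(\zeta l_T\otimes m_U)=(-1)^{|l_T|}l_T\otimes\gamma m_U,\\ &\tau(l_T\otimes\varepsilon m_O)=\tau l_T\otimes m_O,\qquad \tau(\varepsilon l_O\otimes m_T)=(-1)^{|l_O|}l_O\otimes\tau m_T,\\ &\varepsilon\tau(l_T\otimes m_T)=\varepsilon\tau l_T\otimes m_T+(-1)^{|l_T|}l_T\otimes\varepsilon\tau m_T+\eta_T(l_T\otimes m_T). \end{aligned}$$ The CRT-module $\mathrm{Hom}_{CRT}(M,N)$ is defined by $\mathrm{Hom}_{CRT}(M,N)^X_i=[F(b,i,X)\otimes_{CRT}M,N]_0$, where an operation $\theta$ from part $X$, degree $i$ to part $Y$, degree $j$ acts by $\theta(\alpha)=\alpha\circ(\mu_\theta\otimes1)$, with $\mu_\theta\colon F(c,j,Y)\to F(b,i,X)$ the homomorphism carrying the generator $c$ to $\theta(b)$. A CRT-module $M$ is *acyclic* if the following sequences are exact for all $n$: $$\cdots\to M^O_n\xrightarrow{\eta_O}M^O_{n+1}\xrightarrow{c}M^U_{n+1}\xrightarrow{r\beta_U^{-1}}M^O_{n-1}\xrightarrow{\eta_O}M^O_n\to\cdots$$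 $$\cdots\to M^O_n\xrightarrow{\eta_O^2}M^O_{n+2}\xrightarrow{\varepsilon}M^T_{n+2}\xrightarrow{\tau\beta_T^{-1}}M^O_{n-1}\xrightarrow{\eta_O^2}M^O_{n+1}\to\cdots$$ $$\cdots\to M^U_{n+1}\xrightarrow{\gamma}M^T_n\xrightarrow{\zeta}M^U_n\xrightarrow{1-\psi_U}M^U_n\xrightarrow{\gamma}M^T_{n-1}\to\cdots$$ **Proposition.** Let $M$ be a free CRT-module and let $N$ be an acyclic CRT-module. Then $\mathrm{Hom}_{CRT}(M,N)$ is acyclic. -/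

import Mathlib

universe u v w

namespace CRT

/-! ### Operations -/

/-- The three parts of a CRT-module: real (`O`), complex (`U`), self-conjugate (`T`). -/
inductive Part : Type
  | O | U | T

/-- Generators of the coefficient rings `K_*(ℝ)`, `K_*(ℂ)` and `K_*(T)`, by part.
`betaOinv`, `betaUinv`, `betaTinv` are the inverses of the Bott elements. -/
inductive Scalar : Part → Type
  | etaO : Scalar .O
  | xi : Scalar .O
  | betaO : Scalar .O
  | betaOinv : Scalar .O
  | betaU : Scalar .U
  | betaUinv : Scalar .U
  | etaT : Scalar .T
  | omega : Scalar .T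
  | betaT : Scalar .T
  | betaTinv : Scalar .T

/-- Degrees of the ring generators. -/
@[reducible] def Scalar.deg : {X : Part} → Scalar X → ℤ
  | _, .etaO => 1
  | _, .xi => 4
  | _, .betaO => 8
  | _, .betaOinv => -8
  | _, .betaU => 2
  | _, .betaUinv => -2
  | _, .etaT => 1
  | _, .omega => 3
  | _, .betaT => 4
  | _, .betaTinv => -4

/-- The generating CRT-operations: the actions of the ring generators, and
`c, r, ε, ζ, ψ_U, ψ_T, γ, τ`. -/
inductive Op : Part → Part → Type
  | sc {X : Part} (a : Scalar X) : Op X X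
  | c : Op .O .U
  | r : Op .U .O
  | eps : Op .O .T
  | zeta : Op .T .U
  | psiU : Op .U .U
  | psiT : Op .T .T
  | gamma : Op .U .T
  | tau : Op .T .O

/-- Degrees of the operations. -/
@[reducible] def Op.deg : {X Y : Part} → Op X Y → ℤ
  | _, _, .sc a => a.deg
  | _, _, .gamma => -1
  | _, _, .tau => 1
  | _, _, .c => 0
  | _, _, .r => 0
  | _, _, .eps => 0
  | _, _, .zeta => 0
  | _, _, .psiU => 0
  | _, _, .psiT => 0

namespace Op

abbrev etaO : Op .O .O := .sc .etaO
abbrev xi : Op .O .O := .sc .xi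
abbrev betaO : Op .O .O := .sc .betaO
abbrev betaU : Op .U .U := .sc .betaU
abbrev betaUinv : Op .U .U := .sc .betaUinv
abbrev etaT : Op .T .T := .sc .etaT
abbrev omega : Op .T .T := .sc .omega
abbrev betaT : Op .T .T := .sc .betaT
abbrev betaTinv : Op .T .T := .sc .betaTinv

end Op

/-! ### Formal expressions -/

/-- Formal additive expressions in the CRT-operations on a family of generators `G X i`
(of part `X` and degree `i`). -/
inductive Term (G : Part → ℤ → Type u) : Part → ℤ → Type u
  | gen {X : Part} {i : ℤ} (g : G X i) : Term G X i
  | zero {X : Part} {i : ℤ} : Term G X i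
  | add {X : Part} {i : ℤ} (s t : Term G X i) : Term G X i
  | neg {X : Part} {i : ℤ} (t : Term G X i) : Term G X i
  | op {X Y : Part} {i j : ℤ} (o : Op X Y) (h : i + o.deg = j) (t : Term G X i) : Term G Y j

namespace Term

variable {G : Part → ℤ → Type u} {X : Part} {i : ℤ}

instance : Zero (Term G X i) := ⟨.zero⟩
instance : Add (Term G X i) := ⟨.add⟩
instance : Neg (Term G X i) := ⟨.neg⟩

/-- The Koszul sign: `koszul k t` is `(-1)^k t`. -/
def koszul (k : ℤ) (t : Term G X i) : Term G X i := if Even k then t else -t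

/-- Substitution of expressions for the generators. -/
def subst {H : Part → ℤ → Type v} (f : ∀ {X : Part} {i : ℤ}, G X i → Term H X i) :
    ∀ {X : Part} {i : ℤ}, Term G X i → Term H X i
  | _, _, .gen g => f g
  | _, _, .zero => .zero
  | _, _, .add s t => .add (subst f s) (subst f t)
  | _, _, .neg t => .neg (subst f t)
  | _, _, .op o h t => .op o h (subst f t)

end Term

/-- A generator family with exactly one generator, of part `X` and degree `i`. -/
inductive Single (X : Part) (i : ℤ) : Part → ℤ → Type
  | b : Single X i X i

/-- Formal operations from part `X`, degree `i` to part `Y`, degree `j`. -/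
abbrev Word (X : Part) (i : ℤ) (Y : Part) (j : ℤ) : Type := Term (Single X i) Y j

/-- The identity operation: the variable of a word. -/
abbrev Term.var {X : Part} {i : ℤ} : Word X i X i := .gen .b

open Term in
/-- The relations between the operations.  The first block says that the three parts are graded
modules over the coefficient rings
`K_*(ℝ) = ℤ[η_O, ξ, β_O^{±1}] / (2η_O, η_O³, η_O ξ, ξ² - 4β_O)`,
`K_*(ℂ) = ℤ[β_U^{±1}]`,
`K_*(T) = ℤ[η_T, ω, β_T^{±1}] / (2η_T, η_T², η_T ω, ω²)`;
the second block consists of the CRT-relations. -/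
inductive Relation : ∀ {X : Part} {i : ℤ} {Y : Part} {j : ℤ}, Word X i Y j → Word X i Y j → Prop
  -- coefficient rings
  | scalar_comm {X : Part} {i j k l : ℤ} (a b : Scalar X) (h₁ : i + b.deg = j) (h₂ : j + a.deg = l)
      (h₃ : i + a.deg = k) (h₄ : k + b.deg = l) :
      Relation (op (.sc a) h₂ (op (.sc b) h₁ var)) (op (.sc b) h₄ (op (.sc a) h₃ var))
  | betaO_inv {i j : ℤ} (h₁ : i + -8 = j) (h₂ : j + 8 = i) :
      Relation (op (.sc .betaO) h₂ (op (.sc .betaOinv) h₁ var)) var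
  | betaU_inv {i j : ℤ} (h₁ : i + -2 = j) (h₂ : j + 2 = i) :
      Relation (op (.sc .betaU) h₂ (op (.sc .betaUinv) h₁ var)) var
  | betaT_inv {i j : ℤ} (h₁ : i + -4 = j) (h₂ : j + 4 = i) :
      Relation (op (.sc .betaT) h₂ (op (.sc .betaTinv) h₁ var)) var
  | two_etaO {i j : ℤ} (h : i + 1 = j) :
      Relation (op .etaO h var + op .etaO h var) 0
  | etaO_cube {i j k l : ℤ} (h₁ : i + 1 = j) (h₂ : j + 1 = k) (h₃ : k + 1 = l) :
      Relation (op .etaO h₃ (op .etaO h₂ (op .etaO h₁ var))) 0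
  | etaO_xi {i j k : ℤ} (h₁ : i + 4 = j) (h₂ : j + 1 = k) :
      Relation (op .etaO h₂ (op .xi h₁ var)) 0
  | xi_sq {i j k : ℤ} (h₁ : i + 4 = j) (h₂ : j + 4 = k) (h : i + 8 = k) :
      Relation (op .xi h₂ (op .xi h₁ var))
        (op .betaO h var + op .betaO h var + op .betaO h var + op .betaO h var)
  | two_etaT {i j : ℤ} (h : i + 1 = j) :
      Relation (op .etaT h var + op .etaT h var) 0
  | etaT_sq {i j k : ℤ} (h₁ : i + 1 = j) (h₂ : j + 1 = k) :
      Relation (op .etaT h₂ (op .etaT h₁ var)) 0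
  | etaT_omega {i j k : ℤ} (h₁ : i + 3 = j) (h₂ : j + 1 = k) :
      Relation (op .etaT h₂ (op .omega h₁ var)) 0
  | omega_sq {i j k : ℤ} (h₁ : i + 3 = j) (h₂ : j + 3 = k) :
      Relation (op .omega h₂ (op .omega h₁ var)) 0
  -- `r c = 2`
  | r_c {i : ℤ} (h : i + 0 = i) :
      Relation (op .r h (op .c h var)) (var + var)
  -- `c r = 1 + ψ_U`
  | c_r {i : ℤ} (h : i + 0 = i) :
      Relation (op .c h (op .r h var)) (var + op .psiU h var)
  -- `r = τ γ`
  | r_eq {i j : ℤ} (h : i + 0 = i) (h₁ : i + -1 = j) (h₂ : j + 1 = i) :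
      Relation (op .r h var) (op .tau h₂ (op .gamma h₁ var))
  -- `c = ζ ε`
  | c_eq {i : ℤ} (h : i + 0 = i) :
      Relation (op .c h var) (op .zeta h (op .eps h var))
  -- `ψ_U² = 1`
  | psiU_sq {i : ℤ} (h : i + 0 = i) :
      Relation (op .psiU h (op .psiU h var)) var
  -- `ψ_T² = 1`
  | psiT_sq {i : ℤ} (h : i + 0 = i) :
      Relation (op .psiT h (op .psiT h var)) var
  -- `ψ_T ε = ε`
  | psiT_eps {i : ℤ} (h : i + 0 = i) :
      Relation (op .psiT h (op .eps h var)) (op .eps h var)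
  -- `ζ γ = 0`
  | zeta_gamma {i j : ℤ} (h₁ : i + -1 = j) (h : j + 0 = j) :
      Relation (op .zeta h (op .gamma h₁ var)) 0
  -- `ζ = ψ_U ζ`
  | psiU_zeta {i : ℤ} (h : i + 0 = i) :
      Relation (op .zeta h var) (op .psiU h (op .zeta h var))
  -- `ψ_U β_U = -β_U ψ_U`
  | psiU_betaU {i j : ℤ} (h₁ : i + 2 = j) (hi : i + 0 = i) (hj : j + 0 = j) :
      Relation (op .psiU hj (op .betaU h₁ var)) (-op .betaU h₁ (op .psiU hi var))
  -- `ψ_T β_T = β_T ψ_T`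
  | psiT_betaT {i j : ℤ} (h₁ : i + 4 = j) (hi : i + 0 = i) (hj : j + 0 = j) :
      Relation (op .psiT hj (op .betaT h₁ var)) (op .betaT h₁ (op .psiT hi var))
  -- `ε β_O = β_T² ε`
  | eps_betaO {i j k : ℤ} (h : i + 8 = k) (h₁ : i + 4 = j) (h₂ : j + 4 = k)
      (hi : i + 0 = i) (hk : k + 0 = k) :
      Relation (op .eps hk (op .betaO h var)) (op .betaT h₂ (op .betaT h₁ (op .eps hi var)))
  -- `ζ β_T = β_U² ζ`
  | zeta_betaT {i j k : ℤ} (h : i + 4 = k) (h₁ : i + 2 = j) (h₂ : j + 2 = k)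
      (hi : i + 0 = i) (hk : k + 0 = k) :
      Relation (op .zeta hk (op .betaT h var)) (op .betaU h₂ (op .betaU h₁ (op .zeta hi var)))
  -- `γ β_U² = β_T γ`
  | gamma_betaU_sq {i j k l m : ℤ} (h₁ : i + 2 = j) (h₂ : j + 2 = k) (h₃ : k + -1 = l)
      (h₄ : i + -1 = m) (h₅ : m + 4 = l) :
      Relation (op .gamma h₃ (op .betaU h₂ (op .betaU h₁ var))) (op .betaT h₅ (op .gamma h₄ var))
  -- `τ β_T² = β_O τ`
  | tau_betaT_sq {i j k l m : ℤ} (h₁ : i + 4 = j) (h₂ : j + 4 = k) (h₃ : k + 1 = l)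
      (h₄ : i + 1 = m) (h₅ : m + 8 = l) :
      Relation (op .tau h₃ (op .betaT h₂ (op .betaT h₁ var))) (op .betaO h₅ (op .tau h₄ var))
  -- `γ = γ ψ_U`
  | gamma_psiU {i j : ℤ} (h : i + -1 = j) (hi : i + 0 = i) :
      Relation (op .gamma h var) (op .gamma h (op .psiU hi var))
  -- `η_O = τ ε`
  | etaO_eq {i j : ℤ} (h : i + 1 = j) (hi : i + 0 = i) :
      Relation (op .etaO h var) (op .tau h (op .eps hi var))
  -- `η_T = γ β_U ζ`
  | etaT_eq {i j k : ℤ} (h : i + 1 = k) (hi : i + 0 = i) (h₁ : i + 2 = j) (h₂ : j + -1 = k) :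
      Relation (op .etaT h var) (op .gamma h₂ (op .betaU h₁ (op .zeta hi var)))
  -- `ξ = r β_U² c`
  | xi_eq {i j k : ℤ} (h : i + 4 = k) (hi : i + 0 = i) (h₁ : i + 2 = j) (h₂ : j + 2 = k)
      (hk : k + 0 = k) :
      Relation (op .xi h var) (op .r hk (op .betaU h₂ (op .betaU h₁ (op .c hi var))))
  -- `ω = β_T γ ζ`
  | omega_eq {i j k : ℤ} (h : i + 3 = k) (hi : i + 0 = i) (h₁ : i + -1 = j) (h₂ : j + 4 = k) :
      Relation (op .omega h var) (op .betaT h₂ (op .gamma h₁ (op .zeta hi var)))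
  -- `β_T ε τ = ε τ β_T + η_T β_T`
  | betaT_eps_tau {i j k l : ℤ} (h₁ : i + 1 = j) (hj : j + 0 = j) (h₂ : j + 4 = k)
      (h₃ : i + 4 = l) (h₄ : l + 1 = k) (hk : k + 0 = k) :
      Relation (op .betaT h₂ (op .eps hj (op .tau h₁ var)))
        (op .eps hk (op .tau h₄ (op .betaT h₃ var)) + op .etaT h₄ (op .betaT h₃ var))
  -- `ε r ζ = 1 + ψ_T`
  | eps_r_zeta {i : ℤ} (h : i + 0 = i) :
      Relation (op .eps h (op .r h (op .zeta h var))) (var + op .psiT h var)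
  -- `γ c τ = 1 - ψ_T`
  | gamma_c_tau {i j : ℤ} (h : i + 0 = i) (h₁ : i + 1 = j) (hj : j + 0 = j) (h₂ : j + -1 = i) :
      Relation (op .gamma h₂ (op .c hj (op .tau h₁ var))) (var + -op .psiT h var)
  -- `τ = -τ ψ_T`
  | tau_psiT {i j : ℤ} (h : i + 1 = j) (hi : i + 0 = i) :
      Relation (op .tau h var) (-op .tau h (op .psiT hi var))
  -- `τ β_T ε = 0`
  | tau_betaT_eps {i j k : ℤ} (hi : i + 0 = i) (h₁ : i + 4 = j) (h₂ : j + 1 = k) :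
      Relation (op .tau h₂ (op .betaT h₁ (op .eps hi var))) 0
  -- `ε ξ = 2 β_T ε`
  | eps_xi {i j : ℤ} (hi : i + 0 = i) (h : i + 4 = j) (hj : j + 0 = j) :
      Relation (op .eps hj (op .xi h var))
        (op .betaT h (op .eps hi var) + op .betaT h (op .eps hi var))
  -- `ξ τ = 2 τ β_T`
  | xi_tau {i j k l : ℤ} (h₁ : i + 1 = j) (h₂ : j + 4 = k) (h₃ : i + 4 = l) (h₄ : l + 1 = k) :
      Relation (op .xi h₂ (op .tau h₁ var))
        (op .tau h₄ (op .betaT h₃ var) + op .tau h₄ (op .betaT h₃ var))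

end CRT

open CRT

/-! ### CRT-modules and their homomorphisms -/

/-- Three `ℤ`-graded abelian groups with additive operations of the prescribed degrees
(no relations imposed). -/
structure CRTData where
  carrier : Part → ℤ → Type u
  [grp : ∀ X i, AddCommGroup (carrier X i)]
  op : ∀ {X Y : Part} (o : Op X Y) {i j : ℤ}, i + o.deg = j → carrier X i →+ carrier Y j

attribute [instance] CRTData.grp

/-- Value of a formal expression, given values of the generators. -/
def CRTData.eval (M : CRTData.{u}) {G : Part → ℤ → Type v}
    (f : ∀ {X : Part} {i : ℤ}, G X i → M.carrier X i) :
    ∀ {X : Part} {i : ℤ}, Term G X i → M.carrier X i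
  | _, _, .gen g => f g
  | _, _, .zero => 0
  | _, _, .add s t => M.eval f s + M.eval f t
  | _, _, .neg t => -M.eval f t
  | _, _, .op o h t => M.op o h (M.eval f t)

/-- The map out of a one-generator family picking out the element `x`. -/
def CRT.Single.pick (M : CRTData.{u}) {X : Part} {i : ℤ} (x : M.carrier X i) :
    ∀ {Y : Part} {j : ℤ}, Single X i Y j → M.carrier Y j
  | _, _, .b => x

/-- A CRT-module: the operations satisfy the ring relations and the CRT-relations. -/
structure CRTModule extends CRTData.{u} where
  rel : ∀ {X Y : Part} {i j : ℤ} {s t : Word X i Y j}, Relation s t →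
    ∀ x : carrier X i, toCRTData.eval (Single.pick toCRTData x) s =
      toCRTData.eval (Single.pick toCRTData x) t

namespace CRTModule

/-- Homomorphisms of CRT-modules of degree 0: the group `[M, N]_0`. -/
@[ext]
structure Hom (M : CRTModule.{u}) (N : CRTModule.{v}) where
  toFun : ∀ (X : Part) (i : ℤ), M.carrier X i →+ N.carrier X i
  map_op : ∀ {X Y : Part} (o : Op X Y) {i j : ℤ} (h : i + o.deg = j) (x : M.carrier X i),
    toFun Y j (M.op o h x) = N.op o h (toFun X i x)

namespace Hom

variable {L : CRTModule.{u}} {M : CRTModule.{v}} {N : CRTModule.{w}}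

/-- The identity homomorphism. -/
def id (M : CRTModule.{u}) : Hom M M where
  toFun _ _ := AddMonoidHom.id _
  map_op _ _ _ _ _ := rfl

/-- Composition (`f` after `g`). -/
def comp (f : Hom M N) (g : Hom L M) : Hom L N where
  toFun X i := (f.toFun X i).comp (g.toFun X i)
  map_op o _ _ h x := by simp [g.map_op, f.map_op]

instance : Zero (Hom M N) := ⟨⟨fun _ _ => 0, by simp⟩⟩
instance : Add (Hom M N) :=
  ⟨fun f g => ⟨fun X i => f.toFun X i + g.toFun X i, by simp [f.map_op, g.map_op]⟩⟩
instance : Neg (Hom M N) := ⟨fun f => ⟨fun X i => -f.toFun X i, by simp [f.map_op]⟩⟩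

instance : AddCommGroup (Hom M N) where
  add_assoc f g h := by
    apply Hom.ext; funext X i; exact add_assoc (f.toFun X i) (g.toFun X i) (h.toFun X i)
  zero_add f := by apply Hom.ext; funext X i; exact zero_add (f.toFun X i)
  add_zero f := by apply Hom.ext; funext X i; exact add_zero (f.toFun X i)
  add_comm f g := by apply Hom.ext; funext X i; exact add_comm (f.toFun X i) (g.toFun X i)
  neg_add_cancel f := by apply Hom.ext; funext X i; exact neg_add_cancel (f.toFun X i)
  nsmul := nsmulRec
  zsmul := zsmulRec

/-- Homomorphisms commute with the evaluation of expressions. -/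
theorem map_eval (f : Hom M N) {G : Part → ℤ → Type u}
    (g : ∀ {X : Part} {i : ℤ}, G X i → M.carrier X i) {X : Part} {i : ℤ} (t : Term G X i) :
    f.toFun X i (M.eval g t) = N.eval (fun {X i} a => f.toFun X i (g a)) t := by
  induction t with
  | gen a => rfl
  | zero => exact map_zero _
  | add s t hs ht => simp only [CRTData.eval, map_add, hs, ht]
  | neg t ht => simp only [CRTData.eval, map_neg, ht]
  | op o h t ht => simp only [CRTData.eval, f.map_op, ht]

end Hom

/-- `M` and `N` are isomorphic CRT-modules. -/
def IsIso (M : CRTModule.{u}) (N : CRTModule.{v}) : Prop :=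
  ∃ (f : Hom M N) (g : Hom N M), g.comp f = Hom.id M ∧ f.comp g = Hom.id N

/-! ### CRT-modules given by generators and relations -/

section Presented

variable (G : Part → ℤ → Type u)
  (R : ∀ {X : Part} {i : ℤ}, Term G X i → Term G X i → Prop)

/-- The smallest congruence on formal expressions containing `R`, the abelian group axioms,
additivity of the operations, and the relations of a CRT-module. -/
inductive Congr : ∀ {X : Part} {i : ℤ}, Term G X i → Term G X i → Prop
  | refl {X : Part} {i : ℤ} (t : Term G X i) : Congr t t
  | symm {X : Part} {i : ℤ} {s t : Term G X i} : Congr s t → Congr t s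
  | trans {X : Part} {i : ℤ} {s t p : Term G X i} : Congr s t → Congr t p → Congr s p
  | add {X : Part} {i : ℤ} {s s' t t' : Term G X i} :
      Congr s s' → Congr t t' → Congr (s + t) (s' + t')
  | neg {X : Part} {i : ℤ} {s t : Term G X i} : Congr s t → Congr (-s) (-t)
  | op {X Y : Part} {i j : ℤ} (o : Op X Y) (h : i + o.deg = j) {s t : Term G X i} :
      Congr s t → Congr (.op o h s) (.op o h t)
  | add_assoc {X : Part} {i : ℤ} (s t p : Term G X i) : Congr (s + t + p) (s + (t + p))
  | add_comm {X : Part} {i : ℤ} (s t : Term G X i) : Congr (s + t) (t + s)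
  | zero_add {X : Part} {i : ℤ} (t : Term G X i) : Congr (0 + t) t
  | neg_add_cancel {X : Part} {i : ℤ} (t : Term G X i) : Congr (-t + t) 0
  | op_add {X Y : Part} {i j : ℤ} (o : Op X Y) (h : i + o.deg = j) (s t : Term G X i) :
      Congr (.op o h (s + t)) (.op o h s + .op o h t)
  | crt {X Y : Part} {i j : ℤ} {s t : Word X i Y j} (hst : Relation s t) (x : Term G X i) :
      Congr (s.subst (fun {_ _} a => match a with | .b => x))
        (t.subst (fun {_ _} a => match a with | .b => x))
  | of {X : Part} {i : ℤ} {s t : Term G X i} : R s t → Congr s t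

/-- Congruence as a setoid. -/
def congrSetoid (X : Part) (i : ℤ) : Setoid (Term G X i) :=
  ⟨Congr G R, .refl, .symm, .trans⟩

instance (X : Part) (i : ℤ) : Zero (Quotient (congrSetoid G R X i)) := ⟨Quotient.mk _ 0⟩
instance (X : Part) (i : ℤ) : Add (Quotient (congrSetoid G R X i)) :=
  ⟨Quotient.map₂ (· + ·) fun _ _ h _ _ h' => Congr.add h h'⟩
instance (X : Part) (i : ℤ) : Neg (Quotient (congrSetoid G R X i)) :=
  ⟨Quotient.map (- ·) fun _ _ h => Congr.neg h⟩

instance presentedGroup (X : Part) (i : ℤ) : AddCommGroup (Quotient (congrSetoid G R X i)) where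
  add_assoc := by
    rintro ⟨a⟩ ⟨b⟩ ⟨d⟩; exact Quotient.sound (Congr.add_assoc a b d)
  zero_add := by rintro ⟨a⟩; exact Quotient.sound (Congr.zero_add a)
  add_zero := by
    rintro ⟨a⟩; exact Quotient.sound (Congr.trans (Congr.add_comm a 0) (Congr.zero_add a))
  add_comm := by rintro ⟨a⟩ ⟨b⟩; exact Quotient.sound (Congr.add_comm a b)
  neg_add_cancel := by rintro ⟨a⟩; exact Quotient.sound (Congr.neg_add_cancel a)
  nsmul := nsmulRec
  zsmul := zsmulRec

/-- The graded groups and operations of the presented CRT-module. -/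
def presentedData : CRTData.{u} where
  carrier X i := Quotient (congrSetoid G R X i)
  op o _ _ h := AddMonoidHom.mk' (Quotient.map (Term.op o h) fun _ _ hst => Congr.op o h hst) (by
    rintro ⟨a⟩ ⟨b⟩; exact Quotient.sound (Congr.op_add o h a b))

theorem presentedData_eval {H : Part → ℤ → Type v}
    (f : ∀ {X : Part} {i : ℤ}, H X i → Term G X i)
    (g : ∀ {X : Part} {i : ℤ}, H X i → (presentedData G R).carrier X i)
    (hfg : ∀ {X : Part} {i : ℤ} (a : H X i), g a = Quotient.mk (congrSetoid G R X i) (f a))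
    {X : Part} {i : ℤ} (t : Term H X i) :
    (presentedData G R).eval g t = Quotient.mk (congrSetoid G R X i) (t.subst f) := by
  induction t with
  | gen a => exact hfg a
  | zero => rfl
  | add s t hs ht => simp only [CRTData.eval, hs, ht]; rfl
  | neg t ht => simp only [CRTData.eval, ht]; rfl
  | op o h t ht => simp only [CRTData.eval, ht]; rfl

/-- The CRT-module with generators `G` and relations `R`. -/
def presented : CRTModule.{u} where
  toCRTData := presentedData G R
  rel {X Y i j s t} hst x := by
    obtain ⟨x, rfl⟩ := Quotient.exists_rep x
    rw [presentedData_eval G R (fun {_ _} a => match a with | .b => x) _ (by rintro _ _ ⟨⟩; rfl),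
      presentedData_eval G R (fun {_ _} a => match a with | .b => x) _ (by rintro _ _ ⟨⟩; rfl)]
    exact Quotient.sound (Congr.crt hst x)

variable {G R}

/-- The class of a generator. -/
def presented.of {X : Part} {i : ℤ} (g : G X i) : (presented G R).carrier X i :=
  Quotient.mk (congrSetoid G R X i) (.gen g)

theorem presented.eval_of {X : Part} {i : ℤ} (t : Term G X i) :
    (presented G R).eval (fun {X i} (g : G X i) => (presented.of g : (presented G R).carrier X i)) t
      = Quotient.mk (congrSetoid G R X i) t := by
  induction t with
  | gen a => rfl
  | zero => rfl
  | add s t hs ht => simp only [CRTData.eval, hs, ht]; rfl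
  | neg t ht => simp only [CRTData.eval, ht]; rfl
  | op o h t ht => simp only [CRTData.eval, ht]; rfl

theorem eval_subst (M : CRTModule.{w}) {H : Part → ℤ → Type v}
    (f : ∀ {X : Part} {i : ℤ}, G X i → M.carrier X i)
    (s : ∀ {X : Part} {i : ℤ}, H X i → Term G X i)
    (g : ∀ {X : Part} {i : ℤ}, H X i → M.carrier X i)
    (hg : ∀ {X : Part} {i : ℤ} (a : H X i), g a = M.eval f (s a))
    {X : Part} {i : ℤ} (t : Term H X i) : M.eval f (t.subst s) = M.eval g t := by
  induction t with
  | gen a => exact (hg a).symm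
  | zero => rfl
  | add s t hs ht => simp only [Term.subst, CRTData.eval, hs, ht]
  | neg t ht => simp only [Term.subst, CRTData.eval, ht]
  | op o h t ht => simp only [Term.subst, CRTData.eval, ht]

theorem eval_congr (M : CRTModule.{w}) (f : ∀ {X : Part} {i : ℤ}, G X i → M.carrier X i)
    (hf : ∀ {X : Part} {i : ℤ} {s t : Term G X i}, R s t → M.eval f s = M.eval f t)
    {X : Part} {i : ℤ} {s t : Term G X i} (h : Congr G R s t) : M.eval f s = M.eval f t := by
  induction h with
  | refl t => rfl
  | symm _ ih => exact ih.symm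
  | trans _ _ ih₁ ih₂ => exact ih₁.trans ih₂
  | add _ _ ih₁ ih₂ => exact congrArg₂ (· + ·) ih₁ ih₂
  | neg _ ih => exact congrArg (- ·) ih
  | op o h _ ih => exact congrArg (M.op o h) ih
  | add_assoc s t p => exact _root_.add_assoc (M.eval f s) (M.eval f t) (M.eval f p)
  | add_comm s t => exact _root_.add_comm (M.eval f s) (M.eval f t)
  | zero_add t => exact _root_.zero_add (M.eval f t)
  | neg_add_cancel t => exact _root_.neg_add_cancel (M.eval f t)
  | op_add o h s t => exact map_add (M.op o h) (M.eval f s) (M.eval f t)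
  | crt hst x =>
    rw [eval_subst M f _ (Single.pick M.toCRTData (M.eval f x)) (by rintro _ _ ⟨⟩; rfl),
      eval_subst M f _ (Single.pick M.toCRTData (M.eval f x)) (by rintro _ _ ⟨⟩; rfl)]
    exact M.rel hst _
  | of h => exact hf h

/-- The homomorphism out of a presented CRT-module with given values on the generators. -/
def presented.lift {M : CRTModule.{w}} (f : ∀ {X : Part} {i : ℤ}, G X i → M.carrier X i)
    (hf : ∀ {X : Part} {i : ℤ} {s t : Term G X i}, R s t → M.eval f s = M.eval f t) :
    Hom (presented G R) M where
  toFun X i := AddMonoidHom.mk'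
    (Quotient.lift (fun t : Term G X i => M.eval f t) fun _ _ h => eval_congr M f hf h)
    (by rintro ⟨a⟩ ⟨b⟩; rfl)
  map_op := by rintro X Y o i j h ⟨a⟩; rfl

theorem presented.hom_ext {M : CRTModule.{w}} {f g : Hom (presented G R) M}
    (h : ∀ {X : Part} {i : ℤ} (a : G X i),
      f.toFun X i (presented.of a) = g.toFun X i (presented.of a)) : f = g := by
  apply Hom.ext
  funext X i
  ext ⟨t⟩
  change f.toFun X i (Quotient.mk (congrSetoid G R X i) t) =
    g.toFun X i (Quotient.mk (congrSetoid G R X i) t)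
  rw [← presented.eval_of, Hom.map_eval, Hom.map_eval]
  congr 1
  funext X i a
  exact h a

end Presented

/-! ### Free CRT-modules -/

/-- The free CRT-module on a family of generators. -/
def free (G : Part → ℤ → Type u) : CRTModule.{u} := presented G (fun _ _ => False)

/-- A CRT-module is free if it is isomorphic to the free CRT-module on some family of
generators. -/
def IsFree (M : CRTModule.{u}) : Prop :=
  ∃ G : Part → ℤ → Type u, IsIso M (free G)

/-- `F X i` is the free CRT-module `F(b, i, X)` on one generator `b` of part `X`, degree `i`. -/
def F (X : Part) (i : ℤ) : CRTModule.{0} := free (Single X i)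

/-- The generator `b` of `F(b, i, X)`. -/
def F.b {X : Part} {i : ℤ} : (F X i).carrier X i := presented.of Single.b

/-- The homomorphism `F(b, i, X) → M` carrying `b` to `x`. -/
def F.lift {M : CRTModule.{u}} {X : Part} {i : ℤ} (x : M.carrier X i) : Hom (F X i) M :=
  presented.lift (Single.pick M.toCRTData x) (fun h => h.elim)

/-! ### The tensor product -/

/-- Symbols `l ⊗ m` with `l` and `m` in the same part. -/
inductive PureTensor (L : CRTModule.{u}) (M : CRTModule.{v}) : Part → ℤ → Type (max u v)
  | mk {X : Part} {i j n : ℤ} (h : i + j = n) (l : L.carrier X i) (m : M.carrier X j) :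
      PureTensor L M X n

/-- The symbol `l ⊗ m` as a formal expression. -/
abbrev tmulTerm {L : CRTModule.{u}} {M : CRTModule.{v}} {X : Part} {i j n : ℤ} (h : i + j = n)
    (l : L.carrier X i) (m : M.carrier X j) : Term (PureTensor L M) X n :=
  .gen (.mk h l m)

open Term in
/-- The relations of a CRT-pairing: biadditivity, graded bilinearity over the coefficient rings,
and compatibility with the operations. -/
inductive TensorRel (L : CRTModule.{u}) (M : CRTModule.{v}) :
    ∀ {X : Part} {i : ℤ}, Term (PureTensor L M) X i → Term (PureTensor L M) X i → Prop
  | add_left {X : Part} {i j n : ℤ} (h : i + j = n) (l l' : L.carrier X i) (m : M.carrier X j) :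
      TensorRel L M (tmulTerm h (l + l') m) (tmulTerm h l m + tmulTerm h l' m)
  | add_right {X : Part} {i j n : ℤ} (h : i + j = n) (l : L.carrier X i) (m m' : M.carrier X j) :
      TensorRel L M (tmulTerm h l (m + m')) (tmulTerm h l m + tmulTerm h l m')
  -- `a (l ⊗ m) = (a l) ⊗ m`
  | scalar_left {X : Part} (a : Scalar X) {i j n i' n' : ℤ} (h : i + j = n)
      (hi : i + a.deg = i') (hn : n + a.deg = n') (h' : i' + j = n')
      (l : L.carrier X i) (m : M.carrier X j) :
      TensorRel L M (op (.sc a) hn (tmulTerm h l m)) (tmulTerm h' (L.op (.sc a) hi l) m)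
  -- `a (l ⊗ m) = (-1)^(|a| |l|) l ⊗ a m`
  | scalar_right {X : Part} (a : Scalar X) {i j n j' n' : ℤ} (h : i + j = n)
      (hj : j + a.deg = j') (hn : n + a.deg = n') (h' : i + j' = n')
      (l : L.carrier X i) (m : M.carrier X j) :
      TensorRel L M (op (.sc a) hn (tmulTerm h l m))
        (koszul (a.deg * i) (tmulTerm h' l (M.op (.sc a) hj m)))
  -- `c (l ⊗ m) = c l ⊗ c m`
  | c {i j n : ℤ} (h : i + j = n) (hi : i + 0 = i) (hj : j + 0 = j) (hn : n + 0 = n)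
      (l : L.carrier .O i) (m : M.carrier .O j) :
      TensorRel L M (op .c hn (tmulTerm h l m)) (tmulTerm h (L.op .c hi l) (M.op .c hj m))
  -- `r (c l ⊗ m) = l ⊗ r m`
  | r_right {i j n : ℤ} (h : i + j = n) (hi : i + 0 = i) (hj : j + 0 = j) (hn : n + 0 = n)
      (l : L.carrier .O i) (m : M.carrier .U j) :
      TensorRel L M (op .r hn (tmulTerm h (L.op .c hi l) m)) (tmulTerm h l (M.op .r hj m))
  -- `r (l ⊗ c m) = r l ⊗ m`
  | r_left {i j n : ℤ} (h : i + j = n) (hi : i + 0 = i) (hj : j + 0 = j) (hn : n + 0 = n)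
      (l : L.carrier .U i) (m : M.carrier .O j) :
      TensorRel L M (op .r hn (tmulTerm h l (M.op .c hj m))) (tmulTerm h (L.op .r hi l) m)
  -- `ε (l ⊗ m) = ε l ⊗ ε m`
  | eps {i j n : ℤ} (h : i + j = n) (hi : i + 0 = i) (hj : j + 0 = j) (hn : n + 0 = n)
      (l : L.carrier .O i) (m : M.carrier .O j) :
      TensorRel L M (op .eps hn (tmulTerm h l m)) (tmulTerm h (L.op .eps hi l) (M.op .eps hj m))
  -- `ζ (l ⊗ m) = ζ l ⊗ ζ m`
  | zeta {i j n : ℤ} (h : i + j = n) (hi : i + 0 = i) (hj : j + 0 = j) (hn : n + 0 = n)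
      (l : L.carrier .T i) (m : M.carrier .T j) :
      TensorRel L M (op .zeta hn (tmulTerm h l m))
        (tmulTerm h (L.op .zeta hi l) (M.op .zeta hj m))
  -- `ψ_U (l ⊗ m) = ψ_U l ⊗ ψ_U m`
  | psiU {i j n : ℤ} (h : i + j = n) (hi : i + 0 = i) (hj : j + 0 = j) (hn : n + 0 = n)
      (l : L.carrier .U i) (m : M.carrier .U j) :
      TensorRel L M (op .psiU hn (tmulTerm h l m))
        (tmulTerm h (L.op .psiU hi l) (M.op .psiU hj m))
  -- `ψ_T (l ⊗ m) = ψ_T l ⊗ ψ_T m`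
  | psiT {i j n : ℤ} (h : i + j = n) (hi : i + 0 = i) (hj : j + 0 = j) (hn : n + 0 = n)
      (l : L.carrier .T i) (m : M.carrier .T j) :
      TensorRel L M (op .psiT hn (tmulTerm h l m))
        (tmulTerm h (L.op .psiT hi l) (M.op .psiT hj m))
  -- `γ (l ⊗ ζ m) = γ l ⊗ m`
  | gamma_left {i j n i' n' : ℤ} (h : i + j = n) (hj : j + 0 = j) (hi : i + -1 = i')
      (hn : n + -1 = n') (h' : i' + j = n') (l : L.carrier .U i) (m : M.carrier .T j) :
      TensorRel L M (op .gamma hn (tmulTerm h l (M.op .zeta hj m)))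
        (tmulTerm h' (L.op .gamma hi l) m)
  -- `γ (ζ l ⊗ m) = (-1)^|l| l ⊗ γ m`
  | gamma_right {i j n j' n' : ℤ} (h : i + j = n) (hi : i + 0 = i) (hj : j + -1 = j')
      (hn : n + -1 = n') (h' : i + j' = n') (l : L.carrier .T i) (m : M.carrier .U j) :
      TensorRel L M (op .gamma hn (tmulTerm h (L.op .zeta hi l) m))
        (koszul i (tmulTerm h' l (M.op .gamma hj m)))
  -- `τ (l ⊗ ε m) = τ l ⊗ m`
  | tau_left {i j n i' n' : ℤ} (h : i + j = n) (hj : j + 0 = j) (hi : i + 1 = i')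
      (hn : n + 1 = n') (h' : i' + j = n') (l : L.carrier .T i) (m : M.carrier .O j) :
      TensorRel L M (op .tau hn (tmulTerm h l (M.op .eps hj m)))
        (tmulTerm h' (L.op .tau hi l) m)
  -- `τ (ε l ⊗ m) = (-1)^|l| l ⊗ τ m`
  | tau_right {i j n j' n' : ℤ} (h : i + j = n) (hi : i + 0 = i) (hj : j + 1 = j')
      (hn : n + 1 = n') (h' : i + j' = n') (l : L.carrier .O i) (m : M.carrier .T j) :
      TensorRel L M (op .tau hn (tmulTerm h (L.op .eps hi l) m))
        (koszul i (tmulTerm h' l (M.op .tau hj m)))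
  -- `ε τ (l ⊗ m) = ε τ l ⊗ m + (-1)^|l| l ⊗ ε τ m + η_T (l ⊗ m)`
  | eps_tau {i j n i' j' n' : ℤ} (h : i + j = n) (hi : i + 1 = i') (hi' : i' + 0 = i')
      (hj : j + 1 = j') (hj' : j' + 0 = j') (hn : n + 1 = n') (hn' : n' + 0 = n')
      (h₁ : i' + j = n') (h₂ : i + j' = n') (l : L.carrier .T i) (m : M.carrier .T j) :
      TensorRel L M (op .eps hn' (op .tau hn (tmulTerm h l m)))
        (tmulTerm h₁ (L.op .eps hi' (L.op .tau hi l)) m +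
          koszul i (tmulTerm h₂ l (M.op .eps hj' (M.op .tau hj m))) +
          op .etaT hn (tmulTerm h l m))

/-- The tensor product `L ⊗_CRT M`: the CRT-module receiving the universal CRT-pairing. -/
def tensor (L : CRTModule.{u}) (M : CRTModule.{v}) : CRTModule.{max u v} :=
  presented (PureTensor L M) (TensorRel L M)

/-- The element `l ⊗ m` of `L ⊗_CRT M`. -/
def tmul {L : CRTModule.{u}} {M : CRTModule.{v}} {X : Part} {i j n : ℤ} (h : i + j = n)
    (l : L.carrier X i) (m : M.carrier X j) : (tensor L M).carrier X n :=
  presented.of (PureTensor.mk h l m)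

theorem tensor_rel {L : CRTModule.{u}} {M : CRTModule.{v}} {X : Part} {i : ℤ}
    {s t : Term (PureTensor L M) X i} (h : TensorRel L M s t) :
    (tensor L M).eval (fun {X n} (g : PureTensor L M X n) =>
        (presented.of g : (tensor L M).carrier X n)) s =
      (tensor L M).eval (fun {X n} (g : PureTensor L M X n) =>
        (presented.of g : (tensor L M).carrier X n)) t := by
  unfold tensor
  rw [presented.eval_of, presented.eval_of]
  exact Quotient.sound (Congr.of h)

theorem eval_add (M : CRTModule.{w}) {G : Part → ℤ → Type u}
    (f : ∀ {X : Part} {i : ℤ}, G X i → M.carrier X i) {X : Part} {i : ℤ} (s t : Term G X i) :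
    M.eval f (s + t) = M.eval f s + M.eval f t := rfl

theorem eval_neg (M : CRTModule.{w}) {G : Part → ℤ → Type u}
    (f : ∀ {X : Part} {i : ℤ}, G X i → M.carrier X i) {X : Part} {i : ℤ} (t : Term G X i) :
    M.eval f (-t) = -M.eval f t := rfl

/-- Images of the symbols under `f ⊗ 1`. -/
def tensorMapGen {L : CRTModule.{u}} {L' : CRTModule.{v}} (f : Hom L L') (M : CRTModule.{w}) :
    ∀ {X : Part} {n : ℤ}, PureTensor L M X n → (tensor L' M).carrier X n
  | X, _, .mk h l m => tmul h (f.toFun X _ l) m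

theorem tensorMapGen_rel {L : CRTModule.{u}} {L' : CRTModule.{v}} (f : Hom L L')
    (M : CRTModule.{w}) {X : Part} {n : ℤ} {s t : Term (PureTensor L M) X n}
    (h : TensorRel L M s t) :
    (tensor L' M).eval (tensorMapGen f M) s = (tensor L' M).eval (tensorMapGen f M) t := by
  cases h with
  | add_left h l l' m =>
    simpa [CRTData.eval, tensorMapGen, tmul, eval_add] using
      tensor_rel (TensorRel.add_left h (f.toFun _ _ l) (f.toFun _ _ l') m)
  | add_right h l m m' =>
    simpa [CRTData.eval, tensorMapGen, tmul, eval_add] using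
      tensor_rel (TensorRel.add_right h (f.toFun _ _ l) m m')
  | scalar_left a h hi hn h' l m =>
    simpa [CRTData.eval, tensorMapGen, tmul, eval_add, f.map_op] using
      tensor_rel (TensorRel.scalar_left a h hi hn h' (f.toFun _ _ l) m)
  | @scalar_right _ a i _ _ _ _ h hj hn h' l m =>
    by_cases hk : Even (a.deg * i)
    all_goals
      simpa [CRTData.eval, tensorMapGen, tmul, eval_add, f.map_op, eval_neg, Term.koszul, hk] using
        tensor_rel (TensorRel.scalar_right a h hj hn h' (f.toFun _ _ l) m)
  | c h hi hj hn l m =>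
    simpa [CRTData.eval, tensorMapGen, tmul, eval_add, f.map_op] using
      tensor_rel (TensorRel.c h hi hj hn (f.toFun _ _ l) m)
  | r_right h hi hj hn l m =>
    simpa [CRTData.eval, tensorMapGen, tmul, eval_add, f.map_op] using
      tensor_rel (TensorRel.r_right h hi hj hn (f.toFun _ _ l) m)
  | r_left h hi hj hn l m =>
    simpa [CRTData.eval, tensorMapGen, tmul, eval_add, f.map_op] using
      tensor_rel (TensorRel.r_left h hi hj hn (f.toFun _ _ l) m)
  | eps h hi hj hn l m =>
    simpa [CRTData.eval, tensorMapGen, tmul, eval_add, f.map_op] using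
      tensor_rel (TensorRel.eps h hi hj hn (f.toFun _ _ l) m)
  | zeta h hi hj hn l m =>
    simpa [CRTData.eval, tensorMapGen, tmul, eval_add, f.map_op] using
      tensor_rel (TensorRel.zeta h hi hj hn (f.toFun _ _ l) m)
  | psiU h hi hj hn l m =>
    simpa [CRTData.eval, tensorMapGen, tmul, eval_add, f.map_op] using
      tensor_rel (TensorRel.psiU h hi hj hn (f.toFun _ _ l) m)
  | psiT h hi hj hn l m =>
    simpa [CRTData.eval, tensorMapGen, tmul, eval_add, f.map_op] using
      tensor_rel (TensorRel.psiT h hi hj hn (f.toFun _ _ l) m)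
  | gamma_left h hj hi hn h' l m =>
    simpa [CRTData.eval, tensorMapGen, tmul, eval_add, f.map_op] using
      tensor_rel (TensorRel.gamma_left h hj hi hn h' (f.toFun _ _ l) m)
  | @gamma_right i _ _ _ _ h hi hj hn h' l m =>
    by_cases hk : Even (i)
    all_goals
      simpa [CRTData.eval, tensorMapGen, tmul, eval_add, f.map_op, eval_neg, Term.koszul, hk] using
        tensor_rel (TensorRel.gamma_right h hi hj hn h' (f.toFun _ _ l) m)
  | tau_left h hj hi hn h' l m =>
    simpa [CRTData.eval, tensorMapGen, tmul, eval_add, f.map_op] using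
      tensor_rel (TensorRel.tau_left h hj hi hn h' (f.toFun _ _ l) m)
  | @tau_right i _ _ _ _ h hi hj hn h' l m =>
    by_cases hk : Even (i)
    all_goals
      simpa [CRTData.eval, tensorMapGen, tmul, eval_add, f.map_op, eval_neg, Term.koszul, hk] using
        tensor_rel (TensorRel.tau_right h hi hj hn h' (f.toFun _ _ l) m)
  | @eps_tau i _ _ _ _ _ h hi hi' hj hj' hn hn' h₁ h₂ l m =>
    by_cases hk : Even (i)
    all_goals
      simpa [CRTData.eval, tensorMapGen, tmul, eval_add, f.map_op, eval_neg, Term.koszul, hk] using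
        tensor_rel (TensorRel.eps_tau h hi hi' hj hj' hn hn' h₁ h₂ (f.toFun _ _ l) m)

/-- The homomorphism `f ⊗ 1 : L ⊗ M → L' ⊗ M`. -/
def tensorMap {L : CRTModule.{u}} {L' : CRTModule.{v}} (f : Hom L L') (M : CRTModule.{w}) :
    Hom (tensor L M) (tensor L' M) :=
  presented.lift (tensorMapGen f M) (tensorMapGen_rel f M)

theorem tmul_add_left {L : CRTModule.{u}} {M : CRTModule.{v}} {X : Part} {i j n : ℤ}
    (h : i + j = n) (l l' : L.carrier X i) (m : M.carrier X j) :
    tmul h (l + l') m = tmul h l m + tmul h l' m :=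
  tensor_rel (TensorRel.add_left h l l' m)

/-- `l ↦ l ⊗ m` as an additive map. -/
def tmulLeft {L : CRTModule.{u}} {M : CRTModule.{v}} {X : Part} {i j n : ℤ}
    (h : i + j = n) (m : M.carrier X j) : L.carrier X i →+ (tensor L M).carrier X n :=
  AddMonoidHom.mk' (fun l => tmul h l m) fun l l' => tmul_add_left h l l' m

theorem tensor_hom_ext {L : CRTModule.{u}} {M : CRTModule.{v}} {N : CRTModule.{w}}
    {f g : Hom (tensor L M) N}
    (h : ∀ {X : Part} {i j n : ℤ} (hn : i + j = n) (l : L.carrier X i) (m : M.carrier X j),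
      f.toFun X n (tmul hn l m) = g.toFun X n (tmul hn l m)) : f = g := by
  refine presented.hom_ext fun a => ?_
  cases a with
  | mk hn l m => exact h hn l m

theorem tensorMap_id (L : CRTModule.{u}) (M : CRTModule.{v}) :
    tensorMap (Hom.id L) M = Hom.id (tensor L M) :=
  tensor_hom_ext fun _ _ _ => rfl

theorem tensorMap_comp {L : CRTModule.{u}} {L' L'' : CRTModule.{v}} (f : Hom L' L'')
    (g : Hom L L') (M : CRTModule.{w}) :
    tensorMap (f.comp g) M = (tensorMap f M).comp (tensorMap g M) :=
  tensor_hom_ext fun _ _ _ => rfl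

theorem tensorMap_zero (L : CRTModule.{u}) (L' : CRTModule.{v}) (M : CRTModule.{w}) :
    tensorMap (0 : Hom L L') M = 0 :=
  tensor_hom_ext fun {X i _ _} hn _ m =>
    map_zero (tmulLeft hn m : L'.carrier X i →+ (tensor L' M).carrier X _)

theorem tensorMap_neg {L : CRTModule.{u}} {L' : CRTModule.{v}} (f : Hom L L')
    (M : CRTModule.{w}) : tensorMap (-f) M = -tensorMap f M :=
  tensor_hom_ext fun {X i _ _} hn l m =>
    map_neg (tmulLeft hn m : L'.carrier X i →+ (tensor L' M).carrier X _) (f.toFun X i l)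

theorem tensorMap_add {L : CRTModule.{u}} {L' : CRTModule.{v}} (f g : Hom L L')
    (M : CRTModule.{w}) : tensorMap (f + g) M = tensorMap f M + tensorMap g M :=
  tensor_hom_ext fun hn l m => tmul_add_left hn (f.toFun _ _ l) (g.toFun _ _ l) m

theorem F.hom_ext {M : CRTModule.{u}} {X : Part} {i : ℤ} {f g : Hom (F X i) M}
    (h : f.toFun X i F.b = g.toFun X i F.b) : f = g := by
  refine presented.hom_ext fun a => ?_
  cases a
  exact h

/-! ### The CRT-module `Hom_CRT(M, N)` -/

/-- The homomorphism `μ_θ : F(c, j, Y) → F(b, i, X)` carrying `c` to `θ(b)`. -/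
def mu {X Y : Part} (o : Op X Y) {i j : ℤ} (h : i + o.deg = j) : Hom (F Y j) (F X i) :=
  F.lift ((F X i).op o h F.b)

/-- `Hom_CRT(M, N)_i^X = [F(b, i, X) ⊗_CRT M, N]_0`, with `θ(α) = α ∘ (μ_θ ⊗ 1)`. -/
def homData (M : CRTModule.{u}) (N : CRTModule.{v}) : CRTData.{max u v} where
  carrier X i := Hom (tensor (F X i) M) N
  op o _ _ h := AddMonoidHom.mk' (fun α => α.comp (tensorMap (mu o h) M)) (fun _ _ => rfl)

/-- Evaluating a formal operation `t` on `α` in `homData` is precomposition with `μ_t ⊗ 1`. -/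
theorem homData_eval (M : CRTModule.{u}) (N : CRTModule.{v}) {X Y : Part} {i j : ℤ}
    (t : Word X i Y j) (α : Hom (tensor (F X i) M) N) :
    (homData M N).eval (Single.pick (homData M N) α) t =
      α.comp (tensorMap
        (F.lift ((F X i).eval (Single.pick (F X i).toCRTData F.b) t) : Hom (F Y j) (F X i)) M) := by
  induction t with
  | gen a =>
    cases a
    have h : (F.lift F.b : Hom (F X i) (F X i)) = Hom.id _ := F.hom_ext rfl
    change α = α.comp (tensorMap (F.lift F.b) M)
    rw [h, tensorMap_id]
    rfl
  | @zero Y j =>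
    have h : (F.lift 0 : Hom (F Y j) (F X i)) = 0 := F.hom_ext rfl
    change (0 : Hom (tensor (F Y j) M) N) = α.comp (tensorMap (F.lift 0) M)
    rw [h, tensorMap_zero]
    apply Hom.ext
    funext Z k
    ext x
    exact (map_zero (α.toFun Z k)).symm
  | @add Y j s t hs ht =>
    have h (x y : (F X i).carrier Y j) :
        (F.lift (x + y) : Hom (F Y j) (F X i)) = F.lift x + F.lift y := F.hom_ext rfl
    simp only [CRTData.eval]
    rw [hs, ht, h, tensorMap_add]
    apply Hom.ext
    funext Z k
    ext x
    exact (map_add (α.toFun Z k) _ _).symm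
  | @neg Y j t ht =>
    have h (x : (F X i).carrier Y j) :
        (F.lift (-x) : Hom (F Y j) (F X i)) = -F.lift x := F.hom_ext rfl
    simp only [CRTData.eval]
    rw [ht, h, tensorMap_neg]
    apply Hom.ext
    funext Z k
    ext x
    exact (map_neg (α.toFun Z k) _).symm
  | @op Y Z j k o hd t ht =>
    have h (x : (F X i).carrier Y j) :
        (F.lift ((F X i).op o hd x) : Hom (F Z k) (F X i)) = (F.lift x).comp (mu o hd) :=
      F.hom_ext ((F.lift x).map_op o hd F.b).symm
    simp only [CRTData.eval]
    rw [ht, h, tensorMap_comp]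
    rfl

/-- The CRT-module `Hom_CRT(M, N)`. -/
def HomCRT (M : CRTModule.{u}) (N : CRTModule.{v}) : CRTModule.{max u v} where
  toCRTData := homData M N
  rel hst α := by
    have h := (F _ _).rel hst F.b
    exact (homData_eval M N _ α).trans
      ((congrArg (fun x => α.comp (tensorMap (F.lift x) M)) h).trans (homData_eval M N _ α).symm)

/-! ### Acyclicity -/

/-- A CRT-module is acyclic if the three sequences
`M^O_n → M^O_{n+1} → M^U_{n+1} → M^O_{n-1} → M^O_n` (maps `η_O`, `c`, `r β_U⁻¹`, `η_O`),
`M^O_n → M^O_{n+2} → M^T_{n+2} → M^O_{n-1} → M^O_{n+1}` (maps `η_O²`, `ε`, `τ β_T⁻¹`, `η_O²`),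
`M^U_{n+1} → M^T_n → M^U_n → M^U_n → M^T_{n-1}` (maps `γ`, `ζ`, `1 - ψ_U`, `γ`)
are exact for all `n`. -/
structure IsAcyclic (M : CRTModule.{u}) : Prop where
  exact_etaO_c (n : ℤ) : Function.Exact
    (M.op .etaO (rfl : n + 1 = n + 1)) (M.op .c (add_zero (n + 1)))
  exact_c_rbeta (n : ℤ) : Function.Exact
    (M.op .c (add_zero (n + 1)))
    ((M.op .r (add_zero (n - 1))).comp (M.op .betaUinv (by change n + 1 + -2 = n - 1; ring)))
  exact_rbeta_etaO (n : ℤ) : Function.Exact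
    ((M.op .r (add_zero (n - 1))).comp
      (M.op .betaUinv (by change n + 1 + -2 = n - 1; ring)))
    (M.op .etaO (by change n - 1 + 1 = n; ring))
  exact_etaOsq_eps (n : ℤ) : Function.Exact
    ((M.op .etaO (by change n + 1 + 1 = n + 2; ring)).comp (M.op .etaO (rfl : n + 1 = n + 1)))
    (M.op .eps (add_zero (n + 2)))
  exact_eps_taubeta (n : ℤ) : Function.Exact
    (M.op .eps (add_zero (n + 2)))
    ((M.op .tau (by change n - 2 + 1 = n - 1; ring)).comp
      (M.op .betaTinv (by change n + 2 + -4 = n - 2; ring)))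
  exact_taubeta_etaOsq (n : ℤ) : Function.Exact
    ((M.op .tau (by change n - 2 + 1 = n - 1; ring)).comp
      (M.op .betaTinv (by change n + 2 + -4 = n - 2; ring)))
    ((M.op .etaO (rfl : n + 1 = n + 1)).comp (M.op .etaO (by change n - 1 + 1 = n; ring)))
  exact_gamma_zeta (n : ℤ) : Function.Exact
    (M.op .gamma (by change n + 1 + -1 = n; ring)) (M.op .zeta (add_zero n))
  exact_zeta_psi (n : ℤ) : Function.Exact
    (M.op .zeta (add_zero n)) (AddMonoidHom.id (M.carrier .U n) - M.op .psiU (add_zero n))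
  exact_psi_gamma (n : ℤ) : Function.Exact
    (AddMonoidHom.id (M.carrier .U n) - M.op .psiU (add_zero n))
    (M.op .gamma (by change n + -1 = n - 1; ring))

end CRTModule

/-! ### Ungraded CRT-modules -/

/-! If `M` is free on generators `g` of part `Y` and degree `j`, then `Hom_CRT(M, N)` is the product
over `g` of `Hom_CRT(F(Y, j), N)`. Exact sequences are stable under products, so it is enough to
know the factors explicitly and to see that they are acyclic.

The factor is modelled by `coShift`. Heuristically `F(X) ⊗ F(Y)` is again free: on one generator if
`X` or `Y` is `O`, on `b ⊗ b'` and `ψ_U b ⊗ b'` for two `U`'s, and otherwise on two generators in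
adjacent degrees, of part `T` for two `T`'s and of part `U` in the mixed case. So part `X` of the
factor consists of one or two copies of a part of `N`, and the operations become explicit matrices
(`coUData`, `coTData`). For `Y = O` the factor is a shift of `N`; for `Y = U` its sequences are
exact for every `N`; for `Y = T` exactness follows from the `γ, ζ, 1 - ψ_U` sequence of `N` alone
(`isAcyclicOn_coU`, `isAcyclicOn_coT`).

The product decomposition is proved through coordinates of pairings, without showing that the tensor
product is free. For fixed `m` of part `Y` the coordinates of `l ⊗ m` form a homomorphism in `l`
(`coord_op_left`). After the interchange `swap` of the two factors they form, for fixed `l`, a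
homomorphism in `m` up to Koszul signs (`coordSwap_op_right`). Uniqueness follows: coordinates at
`b` and a basis of `M` spread first to all `l` by freeness of `F(X, i)`, then to all `m` by freeness
of `M` (`Basis.tensor_hom_ext`). For existence the same two extensions are performed with prescribed
values. They fit together because operations on the two factors commute up to sign (`right_op`), and
the resulting map of two variables satisfies all relations of a CRT-pairing (`Bihom.pairing`).

Degrees are kept out of the calculations by working in the direct sum `tot` of all graded pieces;
gradings return as subgroups of homogeneous elements. -/

/-- Three abelian groups with additive operations, without gradings or relations. -/
structure UngradedData where
  A : Part → Type u
  [grp : ∀ X, AddCommGroup (A X)]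
  op : ∀ {X Y : Part}, Op X Y → A X →+ A Y

attribute [instance] UngradedData.grp

/-- The value of a word at an element. -/
def UngradedData.word (B : UngradedData.{u}) {X : Part} {i : ℤ} (x : B.A X) :
    ∀ {Y : Part} {j : ℤ}, Word X i Y j → B.A Y
  | _, _, .gen .b => x
  | _, _, .zero => 0
  | _, _, .add s t => B.word x s + B.word x t
  | _, _, .neg t => -B.word x t
  | _, _, .op o _ t => B.op o (B.word x t)

namespace UngradedData

variable (B : UngradedData.{u}) {X Y : Part} {i j : ℤ} (x : B.A X)

theorem word_add (s t : Word X i Y j) : B.word x (s + t) = B.word x s + B.word x t := rfl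

theorem word_neg (t : Word X i Y j) : B.word x (-t) = -B.word x t := rfl

theorem word_zero : B.word x (0 : Word X i Y j) = 0 := rfl

/-- The value of a word as an additive map. -/
def wordHom : ∀ {Y : Part} {j : ℤ}, Word X i Y j → (B.A X →+ B.A Y)
  | _, _, t => AddMonoidHom.mk' (fun x => B.word x t) (by
    intro x y
    induction t with
    | gen a => cases a; rfl
    | zero => exact (add_zero _).symm
    | add s t hs ht => simp only [word, hs, ht]; abel
    | neg t ht => simp only [word, ht]; abel
    | op o h t ht => simp only [word, ht, map_add])

end UngradedData

/-- The relations do not depend on the degree. -/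
theorem CRT.Relation.shift {X Y : Part} {i j : ℤ} {s t : Word X i Y j} (h : Relation s t)
    (k : ℤ) :
    ∃ (l : ℤ) (s' t' : Word X k Y l), Relation s' t' ∧
      (∀ (B : UngradedData.{u}) (x : B.A X), B.word x s' = B.word x s) ∧
      ∀ (B : UngradedData.{u}) (x : B.A X), B.word x t' = B.word x t := by
  cases h with
  | scalar_comm a b _ _ _ _ =>
    refine ⟨_, _, _, .scalar_comm a b rfl rfl rfl (by omega), ?_, ?_⟩ <;> intros <;> rfl
  | betaO_inv _ _ => refine ⟨_, _, _, .betaO_inv rfl (by omega), ?_, ?_⟩ <;> intros <;> rfl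
  | betaU_inv _ _ => refine ⟨_, _, _, .betaU_inv rfl (by omega), ?_, ?_⟩ <;> intros <;> rfl
  | betaT_inv _ _ => refine ⟨_, _, _, .betaT_inv rfl (by omega), ?_, ?_⟩ <;> intros <;> rfl
  | two_etaO _ => refine ⟨_, _, _, .two_etaO rfl, ?_, ?_⟩ <;> intros <;> rfl
  | etaO_cube _ _ _ => refine ⟨_, _, _, .etaO_cube rfl rfl rfl, ?_, ?_⟩ <;> intros <;> rfl
  | etaO_xi _ _ => refine ⟨_, _, _, .etaO_xi rfl rfl, ?_, ?_⟩ <;> intros <;> rfl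
  | xi_sq _ _ _ => refine ⟨_, _, _, .xi_sq rfl rfl (by omega), ?_, ?_⟩ <;> intros <;> rfl
  | two_etaT _ => refine ⟨_, _, _, .two_etaT rfl, ?_, ?_⟩ <;> intros <;> rfl
  | etaT_sq _ _ => refine ⟨_, _, _, .etaT_sq rfl rfl, ?_, ?_⟩ <;> intros <;> rfl
  | etaT_omega _ _ => refine ⟨_, _, _, .etaT_omega rfl rfl, ?_, ?_⟩ <;> intros <;> rfl
  | omega_sq _ _ => refine ⟨_, _, _, .omega_sq rfl rfl, ?_, ?_⟩ <;> intros <;> rfl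
  | r_c _ => refine ⟨_, _, _, .r_c (add_zero _), ?_, ?_⟩ <;> intros <;> rfl
  | c_r _ => refine ⟨_, _, _, .c_r (add_zero _), ?_, ?_⟩ <;> intros <;> rfl
  | r_eq _ _ _ => refine ⟨_, _, _, .r_eq (add_zero _) rfl (by omega), ?_, ?_⟩ <;> intros <;> rfl
  | c_eq _ => refine ⟨_, _, _, .c_eq (add_zero _), ?_, ?_⟩ <;> intros <;> rfl
  | psiU_sq _ => refine ⟨_, _, _, .psiU_sq (add_zero _), ?_, ?_⟩ <;> intros <;> rfl
  | psiT_sq _ => refine ⟨_, _, _, .psiT_sq (add_zero _), ?_, ?_⟩ <;> intros <;> rfl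
  | psiT_eps _ => refine ⟨_, _, _, .psiT_eps (add_zero _), ?_, ?_⟩ <;> intros <;> rfl
  | zeta_gamma _ _ => refine ⟨_, _, _, .zeta_gamma rfl (add_zero _), ?_, ?_⟩ <;> intros <;> rfl
  | psiU_zeta _ => refine ⟨_, _, _, .psiU_zeta (add_zero _), ?_, ?_⟩ <;> intros <;> rfl
  | psiU_betaU _ _ _ =>
    refine ⟨_, _, _, .psiU_betaU rfl (add_zero _) (add_zero _), ?_, ?_⟩ <;> intros <;> rfl
  | psiT_betaT _ _ _ =>
    refine ⟨_, _, _, .psiT_betaT rfl (add_zero _) (add_zero _), ?_, ?_⟩ <;> intros <;> rfl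
  | eps_betaO _ _ _ _ _ =>
    refine ⟨_, _, _, .eps_betaO rfl rfl (by omega) (add_zero _) (add_zero _), ?_, ?_⟩ <;>
      intros <;> rfl
  | zeta_betaT _ _ _ _ _ =>
    refine ⟨_, _, _, .zeta_betaT rfl rfl (by omega) (add_zero _) (add_zero _), ?_, ?_⟩ <;>
      intros <;> rfl
  | gamma_betaU_sq _ _ _ _ _ =>
    refine ⟨_, _, _, .gamma_betaU_sq rfl rfl rfl rfl (by omega), ?_, ?_⟩ <;> intros <;> rfl
  | tau_betaT_sq _ _ _ _ _ =>
    refine ⟨_, _, _, .tau_betaT_sq rfl rfl rfl rfl (by omega), ?_, ?_⟩ <;> intros <;> rfl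
  | gamma_psiU _ _ => refine ⟨_, _, _, .gamma_psiU rfl (add_zero _), ?_, ?_⟩ <;> intros <;> rfl
  | etaO_eq _ _ => refine ⟨_, _, _, .etaO_eq rfl (add_zero _), ?_, ?_⟩ <;> intros <;> rfl
  | etaT_eq _ _ _ _ =>
    refine ⟨_, _, _, .etaT_eq rfl (add_zero _) rfl (by omega), ?_, ?_⟩ <;> intros <;> rfl
  | xi_eq _ _ _ _ _ =>
    refine ⟨_, _, _, .xi_eq rfl (add_zero _) rfl (by omega) (add_zero _), ?_, ?_⟩ <;> intros <;> rfl
  | omega_eq _ _ _ _ =>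
    refine ⟨_, _, _, .omega_eq rfl (add_zero _) rfl (by omega), ?_, ?_⟩ <;> intros <;> rfl
  | betaT_eps_tau _ _ _ _ _ _ =>
    refine ⟨_, _, _, .betaT_eps_tau rfl (add_zero _) rfl rfl (by omega) (add_zero _), ?_, ?_⟩ <;>
      intros <;> rfl
  | eps_r_zeta _ => refine ⟨_, _, _, .eps_r_zeta (add_zero _), ?_, ?_⟩ <;> intros <;> rfl
  | gamma_c_tau _ _ _ _ =>
    refine ⟨_, _, _, .gamma_c_tau (add_zero _) rfl (add_zero _) (by omega), ?_, ?_⟩ <;>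
      intros <;> rfl
  | tau_psiT _ _ => refine ⟨_, _, _, .tau_psiT rfl (add_zero _), ?_, ?_⟩ <;> intros <;> rfl
  | tau_betaT_eps _ _ _ =>
    refine ⟨_, _, _, .tau_betaT_eps (add_zero _) rfl rfl, ?_, ?_⟩ <;> intros <;> rfl
  | eps_xi _ _ _ =>
    refine ⟨_, _, _, .eps_xi (add_zero _) rfl (add_zero _), ?_, ?_⟩ <;> intros <;> rfl
  | xi_tau _ _ _ _ => refine ⟨_, _, _, .xi_tau rfl rfl rfl (by omega), ?_, ?_⟩ <;> intros <;> rfl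

/-- An ungraded CRT-module: the operations satisfy the relations of a CRT-module. -/
structure UngradedModule extends UngradedData.{u} where
  rel : ∀ {X Y : Part} {i j : ℤ} {s t : Word X i Y j}, Relation s t →
    ∀ x : A X, toUngradedData.word x s = toUngradedData.word x t

namespace UngradedModule

open UngradedData

/-! ### The CRT-relations as rewriting rules -/

section Relations

variable (N : UngradedModule.{u})

theorem op_betaO_betaOinv (x : N.A .O) : N.op .betaO (N.op (.sc .betaOinv) x) = x :=
  N.rel (Relation.betaO_inv (i := 0) rfl rfl) x

theorem op_betaU_betaUinv (x : N.A .U) : N.op .betaU (N.op .betaUinv x) = x :=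
  N.rel (Relation.betaU_inv (i := 0) rfl rfl) x

theorem op_betaT_betaTinv (x : N.A .T) : N.op .betaT (N.op .betaTinv x) = x :=
  N.rel (Relation.betaT_inv (i := 0) rfl rfl) x

theorem op_sc_comm {X : Part} (a b : Scalar X) (x : N.A X) :
    N.op (.sc a) (N.op (.sc b) x) = N.op (.sc b) (N.op (.sc a) x) :=
  N.rel (Relation.scalar_comm (i := 0) a b rfl rfl rfl (add_right_comm _ _ _)) x

theorem op_betaOinv_betaO (x : N.A .O) : N.op (.sc .betaOinv) (N.op .betaO x) = x := by
  rw [op_sc_comm, op_betaO_betaOinv]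

theorem op_betaUinv_betaU (x : N.A .U) : N.op .betaUinv (N.op .betaU x) = x := by
  rw [op_sc_comm, op_betaU_betaUinv]

theorem op_betaTinv_betaT (x : N.A .T) : N.op .betaTinv (N.op .betaT x) = x := by
  rw [op_sc_comm, op_betaT_betaTinv]

theorem op_r (x : N.A .U) : N.op .r x = N.op .tau (N.op .gamma x) :=
  N.rel (Relation.r_eq (i := 0) (add_zero _) rfl rfl) x

theorem op_c (x : N.A .O) : N.op .c x = N.op .zeta (N.op .eps x) :=
  N.rel (Relation.c_eq (i := 0) (add_zero _)) x

theorem op_etaO (x : N.A .O) : N.op .etaO x = N.op .tau (N.op .eps x) :=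
  N.rel (Relation.etaO_eq (i := 0) rfl (add_zero _)) x

theorem op_etaT (x : N.A .T) :
    N.op .etaT x = N.op .gamma (N.op .betaU (N.op .zeta x)) :=
  N.rel (Relation.etaT_eq (i := 0) rfl (add_zero _) rfl rfl) x

theorem op_xi (x : N.A .O) :
    N.op .xi x = N.op .r (N.op .betaU (N.op .betaU (N.op .c x))) :=
  N.rel (Relation.xi_eq (i := 0) rfl (add_zero _) rfl rfl (add_zero _)) x

theorem op_omega (x : N.A .T) :
    N.op .omega x = N.op .betaT (N.op .gamma (N.op .zeta x)) :=
  N.rel (Relation.omega_eq (i := 0) rfl (add_zero _) rfl rfl) x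

/-- Solving `ε r ζ = 1 + ψ_T` for `ψ_T` eliminates this operation from all words. -/
theorem op_psiT (x : N.A .T) : N.op .psiT x =
    N.op .eps (N.op .tau (N.op .gamma (N.op .zeta x))) - x := by
  have h := N.rel (Relation.eps_r_zeta (i := 0) (add_zero _)) x
  simp only [word, op_r] at h
  rw [h]; abel

theorem op_psiU_psiU (x : N.A .U) : N.op .psiU (N.op .psiU x) = x :=
  N.rel (Relation.psiU_sq (i := 0) (add_zero _)) x

theorem op_zeta_gamma (x : N.A .U) : N.op .zeta (N.op .gamma x) = 0 :=
  N.rel (Relation.zeta_gamma (i := 0) rfl (add_zero _)) x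

theorem op_psiU_zeta (x : N.A .T) : N.op .psiU (N.op .zeta x) = N.op .zeta x :=
  (N.rel (Relation.psiU_zeta (i := 0) (add_zero _)) x).symm

theorem op_gamma_psiU (x : N.A .U) : N.op .gamma (N.op .psiU x) = N.op .gamma x :=
  (N.rel (Relation.gamma_psiU (i := 0) rfl (add_zero _)) x).symm

theorem op_psiU_betaU (x : N.A .U) :
    N.op .psiU (N.op .betaU x) = -N.op .betaU (N.op .psiU x) :=
  N.rel (Relation.psiU_betaU (i := 0) rfl (add_zero _) (add_zero _)) x

theorem op_eps_betaO (x : N.A .O) :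
    N.op .eps (N.op .betaO x) = N.op .betaT (N.op .betaT (N.op .eps x)) :=
  N.rel (Relation.eps_betaO (i := 0) rfl rfl rfl (add_zero _) (add_zero _)) x

theorem op_zeta_betaT (x : N.A .T) :
    N.op .zeta (N.op .betaT x) = N.op .betaU (N.op .betaU (N.op .zeta x)) :=
  N.rel (Relation.zeta_betaT (i := 0) rfl rfl rfl (add_zero _) (add_zero _)) x

theorem op_gamma_betaU_betaU (x : N.A .U) :
    N.op .gamma (N.op .betaU (N.op .betaU x)) = N.op .betaT (N.op .gamma x) :=
  N.rel (Relation.gamma_betaU_sq (i := 0) rfl rfl rfl rfl rfl) x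

theorem op_tau_betaT_betaT (x : N.A .T) :
    N.op .tau (N.op .betaT (N.op .betaT x)) = N.op .betaO (N.op .tau x) :=
  N.rel (Relation.tau_betaT_sq (i := 0) rfl rfl rfl rfl rfl) x

theorem op_tau_betaT_eps (x : N.A .O) : N.op .tau (N.op .betaT (N.op .eps x)) = 0 :=
  N.rel (Relation.tau_betaT_eps (i := 0) (add_zero _) rfl rfl) x

theorem op_zeta_eps_tau_gamma (x : N.A .U) :
    N.op .zeta (N.op .eps (N.op .tau (N.op .gamma x))) = x + N.op .psiU x := by
  have h := N.rel (Relation.c_r (i := 0) (add_zero _)) x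
  simpa only [word, word_add, word_neg, word_zero, op_r, op_c] using h

/-- This is `γ c τ = 1 - ψ_T` with `c` and `ψ_T` eliminated. -/
theorem op_gamma_zeta_eps_tau (x : N.A .T) :
    N.op .gamma (N.op .zeta (N.op .eps (N.op .tau x))) =
      x + x - N.op .eps (N.op .tau (N.op .gamma (N.op .zeta x))) := by
  have h := N.rel (Relation.gamma_c_tau (i := 0) (add_zero _) rfl (add_zero _) rfl) x
  simp only [word, op_c, op_psiT] at h
  rw [h]; abel

theorem op_two_etaT (x : N.A .T) : N.op .gamma (N.op .betaU (N.op .zeta x)) +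
    N.op .gamma (N.op .betaU (N.op .zeta x)) = 0 := by
  have h := N.rel (Relation.two_etaT (i := 0) rfl) x
  simpa only [word, word_add, word_neg, word_zero, op_etaT] using h

theorem neg_gamma_betaU_zeta (x : N.A .T) : -N.op .gamma (N.op .betaU (N.op .zeta x)) =
    N.op .gamma (N.op .betaU (N.op .zeta x)) :=
  neg_eq_of_add_eq_zero_left (N.op_two_etaT x)

/-- The form in which `2 η_T = 0` is met after `abel_nf`: the coefficient has been collected and `←
map_zsmul` has moved it to the innermost argument. -/
theorem gamma_betaU_zeta_two_zsmul (x : N.A .T) :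
    N.op .gamma (N.op .betaU (N.op .zeta ((2 : ℤ) • x))) = 0 := by
  simp only [two_zsmul, map_add, op_two_etaT]

theorem op_eps_tau_betaT (x : N.A .T) : N.op .eps (N.op .tau (N.op .betaT x)) =
    N.op .betaT (N.op .eps (N.op .tau x)) -
      N.op .betaT (N.op .gamma (N.op .betaU (N.op .zeta x))) := by
  have h := N.rel (Relation.betaT_eps_tau (i := 0) rfl (add_zero _) rfl rfl rfl (add_zero _)) x
  simp only [word] at h
  rw [h, op_sc_comm, op_etaT]; abel

/-! Consequences of the defining relations. -/

theorem op_psiU_betaUinv (x : N.A .U) :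
    N.op .psiU (N.op .betaUinv x) = -N.op .betaUinv (N.op .psiU x) := by
  rw [← N.op_betaUinv_betaU (N.op .psiU _), ← neg_neg (N.op .betaU _), ← op_psiU_betaU,
    op_betaU_betaUinv, map_neg]

theorem op_eps_betaOinv (x : N.A .O) :
    N.op .eps (N.op (.sc .betaOinv) x) = N.op .betaTinv (N.op .betaTinv (N.op .eps x)) := by
  conv_rhs => rw [← N.op_betaO_betaOinv x, op_eps_betaO, op_betaTinv_betaT, op_betaTinv_betaT]

theorem op_zeta_betaTinv (x : N.A .T) :
    N.op .zeta (N.op .betaTinv x) = N.op .betaUinv (N.op .betaUinv (N.op .zeta x)) := by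
  conv_rhs => rw [← N.op_betaT_betaTinv x, op_zeta_betaT, op_betaUinv_betaU, op_betaUinv_betaU]

/-- Only even powers of `β_U` pass through `γ`, so an inverse is traded for a positive power and
`β_T⁻¹`. -/
theorem op_gamma_betaUinv (x : N.A .U) :
    N.op .gamma (N.op .betaUinv x) = N.op .betaTinv (N.op .gamma (N.op .betaU x)) := by
  conv_rhs => rw [← N.op_betaU_betaUinv x, op_gamma_betaU_betaU, op_betaTinv_betaT]

theorem op_tau_betaTinv (x : N.A .T) :
    N.op .tau (N.op .betaTinv x) = N.op (.sc .betaOinv) (N.op .tau (N.op .betaT x)) := by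
  conv_rhs => rw [← N.op_betaT_betaTinv x, op_tau_betaT_betaT, op_betaOinv_betaO]

/-- `τ ε τ = τ η_T`. -/
theorem op_tau_eps_tau (x : N.A .T) : N.op .tau (N.op .eps (N.op .tau x)) =
    N.op .tau (N.op .gamma (N.op .betaU (N.op .zeta x))) := by
  -- Since `τ β_T⁻¹ = β_O⁻¹ τ β_T` and `τ β_T ε = 0`, applying `τ β_T⁻¹` kills the left side of the
  -- formula for `ε τ β_T`.
  have h := congrArg (fun y => N.op .tau (N.op .betaTinv y)) (N.op_eps_tau_betaT x)
  simp only [op_tau_betaTinv, op_tau_betaT_eps, map_sub, op_tau_betaT_betaT,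
    op_betaOinv_betaO, map_zero] at h
  exact (sub_eq_zero.mp h.symm)

/-- The formula for `ε τ β_T` at `ε x` has left side zero, because `τ β_T ε = 0`. -/
theorem op_eps_tau_eps (x : N.A .O) : N.op .eps (N.op .tau (N.op .eps x)) =
    N.op .gamma (N.op .betaU (N.op .zeta (N.op .eps x))) := by
  have h := congrArg (fun y => N.op .betaTinv y) (N.op_eps_tau_betaT (N.op .eps x))
  simp only [op_tau_betaT_eps, map_sub, op_betaTinv_betaT, map_zero] at h
  exact (sub_eq_zero.mp h.symm)

/-- Both sides equal `ε τ ε τ x`; thus `η_T` commutes with `ε τ`. -/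
theorem op_gamma_betaU_zeta_eps_tau (x : N.A .T) :
    N.op .gamma (N.op .betaU (N.op .zeta (N.op .eps (N.op .tau x)))) =
      N.op .eps (N.op .tau (N.op .gamma (N.op .betaU (N.op .zeta x)))) := by
  rw [← op_eps_tau_eps, op_tau_eps_tau]

/-- `η_T` has order two, applied under further operations. -/
theorem neg_map_gamma_betaU_zeta {A : Type*} [AddCommGroup A] (f : N.A .T →+ A) (x : N.A .T) :
    -f (N.op .gamma (N.op .betaU (N.op .zeta x))) =
      f (N.op .gamma (N.op .betaU (N.op .zeta x))) := by
  rw [← map_neg, neg_gamma_betaU_zeta]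

theorem neg_betaT_gamma_betaU_zeta (x : N.A .T) :
    -N.op .betaT (N.op .gamma (N.op .betaU (N.op .zeta x))) =
      N.op .betaT (N.op .gamma (N.op .betaU (N.op .zeta x))) :=
  N.neg_map_gamma_betaU_zeta _ x

theorem neg_betaT_betaT_gamma_betaU_zeta (x : N.A .T) :
    -N.op .betaT (N.op .betaT (N.op .gamma (N.op .betaU (N.op .zeta x)))) =
      N.op .betaT (N.op .betaT (N.op .gamma (N.op .betaU (N.op .zeta x)))) :=
  N.neg_map_gamma_betaU_zeta ((N.op .betaT).comp (N.op .betaT)) x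

theorem tau_betaT_gamma_betaU_zeta_eps (x : N.A .O) :
    N.op .tau (N.op .betaT (N.op .gamma (N.op .betaU (N.op .zeta (N.op .eps x))))) = 0 := by
  rw [← op_eps_tau_eps, op_tau_betaT_eps]

/-- Because `η_T` has order two the sign can be dropped, which gives a rule without subtraction. -/
theorem op_eps_tau_betaT' (x : N.A .T) : N.op .eps (N.op .tau (N.op .betaT x)) =
    N.op .betaT (N.op .eps (N.op .tau x)) +
      N.op .betaT (N.op .gamma (N.op .betaU (N.op .zeta x))) := by
  rw [op_eps_tau_betaT, sub_eq_add_neg, neg_betaT_gamma_betaU_zeta]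

end Relations

-- The rules eliminate `r`, `c`, `η_O`, `η_T`, `ξ`, `ω` and `ψ_T`, leaving words in `ε`, `ζ`, `γ`,
-- `τ`, `ψ_U` and the Bott elements.
attribute [simp] gamma_betaU_zeta_two_zsmul op_betaO_betaOinv op_betaU_betaUinv op_betaT_betaTinv
  op_betaOinv_betaO op_betaUinv_betaU op_betaTinv_betaT op_r op_c op_etaO op_etaT op_xi op_omega
  op_psiT op_psiU_psiU op_zeta_gamma op_psiU_zeta op_gamma_psiU op_psiU_betaU op_eps_betaO
  op_zeta_betaT op_gamma_betaU_betaU op_tau_betaT_betaT op_tau_betaT_eps op_zeta_eps_tau_gamma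
  op_gamma_zeta_eps_tau op_two_etaT neg_gamma_betaU_zeta op_eps_tau_betaT' op_psiU_betaUinv
  op_eps_betaOinv op_zeta_betaTinv op_gamma_betaUinv op_tau_betaTinv op_tau_eps_tau op_eps_tau_eps
  op_gamma_betaU_zeta_eps_tau neg_betaT_gamma_betaU_zeta neg_betaT_betaT_gamma_betaU_zeta
  tau_betaT_gamma_betaU_zeta_eps

end UngradedModule

/-! ### Total modules: direct sums of the graded pieces -/

namespace CRTModule

/-- The inclusion of a graded piece in the direct sum. -/
abbrev ofDegree (N : CRTModule.{u}) {X : Part} (n : ℤ) :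
    N.carrier X n →+ DirectSum ℤ (N.carrier X) :=
  DirectSum.of (N.carrier X) n

/-- The direct sums of the graded pieces of a CRT-module, with the induced operations. -/
def totData (N : CRTModule.{u}) : UngradedData.{u} where
  A X := DirectSum ℤ (N.carrier X)
  op o := DirectSum.toAddMonoid fun i => (N.ofDegree (i + o.deg)).comp (N.op o rfl)

theorem ofDegree_op (N : CRTModule.{u}) {X Y : Part} (o : Op X Y) {i j : ℤ} (h : i + o.deg = j)
    (x : N.carrier X i) : N.ofDegree j (N.op o h x) = N.totData.op o (N.ofDegree i x) := by
  subst h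
  exact (DirectSum.toAddMonoid_of (fun i => (N.ofDegree (i + o.deg)).comp (N.op o rfl)) i x).symm

theorem ofDegree_eval (N : CRTModule.{u}) {X Y : Part} {i j : ℤ} (t : Word X i Y j)
    (x : N.carrier X i) :
    N.ofDegree j (N.eval (Single.pick N.toCRTData x) t) = N.totData.word (N.ofDegree i x) t := by
  induction t with
  | gen a => cases a; rfl
  | zero => exact map_zero _
  | add s t hs ht => simp only [CRTData.eval, map_add, hs, ht]; rfl
  | neg t ht => simp only [CRTData.eval, map_neg, ht]; rfl
  | op o h t ht => simp only [CRTData.eval, ofDegree_op, ht]; rfl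

/-- The ungraded CRT-module underlying a CRT-module. -/
def tot (N : CRTModule.{u}) : UngradedModule.{u} where
  toUngradedData := N.totData
  rel {X Y i j s t} hst x := by
    -- The relation is given in one degree, while `x` has components in many. By additivity one
    -- component suffices, and `Relation.shift` moves the relation to its degree.
    refine DFunLike.congr_fun (DirectSum.addHom_ext (f := N.totData.wordHom s)
      (g := N.totData.wordHom t) fun k y => ?_) x
    obtain ⟨l, s', t', h, hs, ht⟩ := hst.shift k
    exact (hs _ _).symm.trans ((N.ofDegree_eval s' y).symm.trans ((congrArg _ (N.rel h y)).trans
      ((N.ofDegree_eval t' y).trans (ht _ _))))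

/-- The inclusion of a graded piece in the ungraded module. -/
def ι (N : CRTModule.{u}) {X : Part} (n : ℤ) : N.carrier X n →+ N.tot.A X := N.ofDegree n

theorem ι_inj (N : CRTModule.{u}) {X : Part} {n : ℤ} {x y : N.carrier X n}
    (h : N.ι n x = N.ι n y) : x = y :=
  DirectSum.of_injective n h

theorem ι_op (N : CRTModule.{u}) {X Y : Part} (o : Op X Y) {i j : ℤ} (h : i + o.deg = j)
    (x : N.carrier X i) : N.ι j (N.op o h x) = N.tot.op o (N.ι i x) :=
  N.ofDegree_op o h x

theorem tot_hom_ext {N : CRTModule.{u}} {A : Type*} [AddCommGroup A] {X : Part}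
    {f g : N.tot.A X →+ A} (h : ∀ i x, f (N.ι i x) = g (N.ι i x)) : f = g :=
  DirectSum.addHom_ext h

/-- The additive map on the ungraded module with given restrictions to the graded pieces. -/
def totLift (N : CRTModule.{u}) {A : Type*} [AddCommGroup A] {X : Part}
    (f : ∀ i, N.carrier X i →+ A) : N.tot.A X →+ A :=
  DirectSum.toAddMonoid f

theorem totLift_ι (N : CRTModule.{u}) {A : Type*} [AddCommGroup A] {X : Part}
    (f : ∀ i, N.carrier X i →+ A) {i : ℤ} (x : N.carrier X i) : N.totLift f (N.ι i x) = f i x :=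
  DirectSum.toAddMonoid_of f i x

/-- The component of degree `n`. -/
def component (N : CRTModule.{u}) (X : Part) (n : ℤ) : N.tot.A X →+ N.carrier X n :=
  DFinsupp.evalAddMonoidHom n

theorem component_ι (N : CRTModule.{u}) {X : Part} {n : ℤ} (x : N.carrier X n) :
    N.component X n (N.ι n x) = x :=
  DirectSum.of_eq_same n x

/-- A CRT-module from graded groups with operations that embed compatibly in an ungraded
CRT-module. -/
@[reducible] def ofEmbedding (D : CRTData.{u}) (B : UngradedModule.{v})
    (e : ∀ {X : Part} (i : ℤ), D.carrier X i →+ B.A X)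
    (he : ∀ {X : Part} {i : ℤ} {x y : D.carrier X i}, e i x = e i y → x = y)
    (hop : ∀ {X Y : Part} (o : Op X Y) {i j : ℤ} (h : i + o.deg = j) (x : D.carrier X i),
      e j (D.op o h x) = B.op o (e i x)) : CRTModule.{u} where
  toCRTData := D
  rel {X Y i j s t} hst x := by
    have key : ∀ {Y : Part} {j : ℤ} (t : Word X i Y j),
        e j (D.eval (Single.pick D x) t) = B.word (e i x) t := by
      intro Y j t
      induction t with
      | gen a => cases a; rfl
      | zero => exact map_zero _
      | add s t hs ht => simp only [CRTData.eval, map_add, hs, ht]; rfl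
      | neg t ht => simp only [CRTData.eval, map_neg, ht]; rfl
      | op o h t ht => simp only [CRTData.eval, hop, ht]; rfl
    exact he ((key s).trans ((B.rel hst _).trans (key t).symm))

end CRTModule

namespace UngradedModule

/-! ### The ungraded modules of maps out of `F(U)` and `F(T)` -/

open AddMonoidHom in
/-- Ungraded version of `Hom(F(U), N)`. -/
@[reducible] def coUData (B : UngradedModule.{u}) : UngradedData.{u} where
  -- Coordinates of a pairing at a fixed `m` of part `U`: the value at `c l` for `l` of part `O`, at
  -- `l` and `ψ_U l` for part `U`, at `ζ l` and `c τ l` for part `T`. The matrices below record the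
  -- effect of operations on `l`.
  A
    | .O => B.A .U
    | .U => B.A .U × B.A .U
    | .T => B.A .U × B.A .U
  grp
    | .O => inferInstanceAs (AddCommGroup (B.A .U))
    | .U => inferInstanceAs (AddCommGroup (B.A .U × B.A .U))
    | .T => inferInstanceAs (AddCommGroup (B.A .U × B.A .U))
  op {X Y} o := match X, Y, o with
    | _, _, .c => (.prod (.id _) (.id _) : B.A .U →+ B.A .U × B.A .U)
    | _, _, .r => (fst _ _ + snd _ _ : B.A .U × B.A .U →+ B.A .U)
    | _, _, .eps => (.prod (.id _) 0 : B.A .U →+ B.A .U × B.A .U)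
    | _, _, .zeta => ((fst _ _).prod (fst _ _) : B.A .U × B.A .U →+ B.A .U × B.A .U)
    | _, _, .psiU => ((snd _ _).prod (fst _ _) : B.A .U × B.A .U →+ B.A .U × B.A .U)
    | _, _, .psiT => ((fst _ _).prod (-snd _ _) : B.A .U × B.A .U →+ B.A .U × B.A .U)
    | _, _, .gamma => (.prod 0 (fst _ _ + snd _ _) : B.A .U × B.A .U →+ B.A .U × B.A .U)
    | _, _, .tau => (snd _ _ : B.A .U × B.A .U →+ B.A .U)
    | _, _, .sc .etaO => (0 : B.A .U →+ B.A .U)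
    | _, _, .sc .xi => ((B.op .betaU).comp (B.op .betaU) + (B.op .betaU).comp (B.op .betaU) :
        B.A .U →+ B.A .U)
    | _, _, .sc .betaO => ((B.op .betaU).comp ((B.op .betaU).comp ((B.op .betaU).comp
        (B.op .betaU))) : B.A .U →+ B.A .U)
    | _, _, .sc .betaOinv => ((B.op .betaUinv).comp ((B.op .betaUinv).comp
        ((B.op .betaUinv).comp (B.op .betaUinv))) : B.A .U →+ B.A .U)
    | _, _, .sc .betaU => (((B.op .betaU).comp (fst _ _)).prod (-(B.op .betaU).comp (snd _ _)) :
        B.A .U × B.A .U →+ B.A .U × B.A .U)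
    | _, _, .sc .betaUinv => (((B.op .betaUinv).comp (fst _ _)).prod
        (-(B.op .betaUinv).comp (snd _ _)) : B.A .U × B.A .U →+ B.A .U × B.A .U)
    | _, _, .sc .etaT => (0 : B.A .U × B.A .U →+ B.A .U × B.A .U)
    | _, _, .sc .omega => (.prod 0 (((B.op .betaU).comp (B.op .betaU) +
        (B.op .betaU).comp (B.op .betaU)).comp (fst _ _)) : B.A .U × B.A .U →+ B.A .U × B.A .U)
    | _, _, .sc .betaT => ((((B.op .betaU).comp (B.op .betaU)).comp (fst _ _)).prod
        (((B.op .betaU).comp (B.op .betaU)).comp (snd _ _)) : B.A .U × B.A .U →+ B.A .U × B.A .U)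
    | _, _, .sc .betaTinv => ((((B.op .betaUinv).comp (B.op .betaUinv)).comp (fst _ _)).prod
        (((B.op .betaUinv).comp (B.op .betaUinv)).comp (snd _ _)) :
        B.A .U × B.A .U →+ B.A .U × B.A .U)

open UngradedData in
/-- The ungraded CRT-module `Hom(F(U), B)`. -/
@[reducible] def coU (B : UngradedModule.{u}) : UngradedModule.{u} where
  toUngradedData := B.coUData
  rel {X Y i j s t} hst := by
    cases hst with
    | scalar_comm a b =>
      cases a <;> cases b <;> intro x <;> (try apply Prod.ext) <;> simp [word]
    | _ => intro x; (try apply Prod.ext) <;> simp [word] <;> abel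

open AddMonoidHom in
/-- Ungraded version of `Hom(F(T), N)`. -/
@[reducible] def coTData (B : UngradedModule.{u}) : UngradedData.{u} where
  -- Now `m` has part `T`. The coordinates are the value at `ε l` for part `O`; those of `l` with `ζ
  -- m` and, up to the sign `(-1)^|l|`, with `c τ m` for part `U`; and those at `l` and `ε τ l` for
  -- part `T`.
  A
    | .O => B.A .T
    | .U => B.A .U × B.A .U
    | .T => B.A .T × B.A .T
  grp
    | .O => inferInstanceAs (AddCommGroup (B.A .T))
    | .U => inferInstanceAs (AddCommGroup (B.A .U × B.A .U))
    | .T => inferInstanceAs (AddCommGroup (B.A .T × B.A .T))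
  op {X Y} o := match X, Y, o with
    | _, _, .c => ((B.op .zeta).prod ((B.op .c).comp (B.op .tau)) : B.A .T →+ B.A .U × B.A .U)
    | _, _, .r => ((B.op .eps).comp ((B.op .r).comp (fst _ _)) + (B.op .gamma).comp (snd _ _) :
        B.A .U × B.A .U →+ B.A .T)
    | _, _, .eps => (.prod (.id _) (B.op .etaT) : B.A .T →+ B.A .T × B.A .T)
    | _, _, .zeta => (((B.op .zeta).comp (fst _ _)).prod
        ((B.op .c).comp ((B.op .tau).comp (fst _ _)) - (B.op .zeta).comp (snd _ _)) :
        B.A .T × B.A .T →+ B.A .U × B.A .U)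
    | _, _, .psiU => (((B.op .psiU).comp (fst _ _)).prod ((B.op .psiU).comp (snd _ _)) :
        B.A .U × B.A .U →+ B.A .U × B.A .U)
    | _, _, .psiT => ((fst _ _ - (B.op .gamma).comp ((B.op .zeta).comp (snd _ _))).prod
        (-snd _ _) : B.A .T × B.A .T →+ B.A .T × B.A .T)
    | _, _, .gamma => (((B.op .gamma).comp (fst _ _)).prod
        ((B.op .eps).comp ((B.op .r).comp (fst _ _)) + (B.op .gamma).comp (snd _ _)) :
        B.A .U × B.A .U →+ B.A .T × B.A .T)
    | _, _, .tau => (snd _ _ : B.A .T × B.A .T →+ B.A .T)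
    | _, _, .sc .etaO => (B.op .etaT : B.A .T →+ B.A .T)
    | _, _, .sc .xi => (B.op .betaT + B.op .betaT : B.A .T →+ B.A .T)
    | _, _, .sc .betaO => ((B.op .betaT).comp (B.op .betaT) : B.A .T →+ B.A .T)
    | _, _, .sc .betaOinv => ((B.op .betaTinv).comp (B.op .betaTinv) : B.A .T →+ B.A .T)
    | _, _, .sc .betaU => (((B.op .betaU).comp (fst _ _)).prod ((B.op .betaU).comp (snd _ _)) :
        B.A .U × B.A .U →+ B.A .U × B.A .U)
    | _, _, .sc .betaUinv => (((B.op .betaUinv).comp (fst _ _)).prod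
        ((B.op .betaUinv).comp (snd _ _)) : B.A .U × B.A .U →+ B.A .U × B.A .U)
    | _, _, .sc .etaT => (((B.op .etaT).comp (fst _ _)).prod ((B.op .etaT).comp (snd _ _)) :
        B.A .T × B.A .T →+ B.A .T × B.A .T)
    | _, _, .sc .omega => (((B.op .omega).comp (fst _ _)).prod
        ((B.op .betaT).comp (fst _ _ + fst _ _) - (B.op .omega).comp (snd _ _)) :
        B.A .T × B.A .T →+ B.A .T × B.A .T)
    | _, _, .sc .betaT => (((B.op .betaT).comp (fst _ _)).prod
        ((B.op .betaT).comp (snd _ _ + (B.op .etaT).comp (fst _ _))) :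
        B.A .T × B.A .T →+ B.A .T × B.A .T)
    | _, _, .sc .betaTinv => (((B.op .betaTinv).comp (fst _ _)).prod
        ((B.op .betaTinv).comp (snd _ _ + (B.op .etaT).comp (fst _ _))) :
        B.A .T × B.A .T →+ B.A .T × B.A .T)

open UngradedData in
/-- The ungraded CRT-module `Hom(F(T), B)`. -/
@[reducible] def coT (B : UngradedModule.{u}) : UngradedModule.{u} where
  toUngradedData := B.coTData
  rel {X Y i j s t} hst := by
    cases hst with
    | scalar_comm a b =>
      cases a <;> cases b <;> intro x <;> (try apply Prod.ext) <;> simp [word] <;> abel_nf <;>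
        simp [← map_zsmul]
    | _ => intro x; (try apply Prod.ext) <;> simp [word] <;> abel_nf <;>
        simp [← map_zsmul]

end UngradedModule

/-! ### Signs, and the commuting actions on the two factors -/

/-- The sign `(-1)^k`. -/
def sg (k : ℤ) : ℤ := if Even k then 1 else -1

theorem sg_even {k : ℤ} (h : Even k) : sg k = 1 := if_pos h

theorem sg_odd {k : ℤ} (h : ¬Even k) : sg k = -1 := if_neg h

/-- Operations generating all others. -/
inductive CRT.Op.IsGenerator : ∀ {X Y : Part}, Op X Y → Prop
  | eps : IsGenerator .eps
  | zeta : IsGenerator .zeta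
  | gamma : IsGenerator .gamma
  | tau : IsGenerator .tau
  | psiU : IsGenerator .psiU
  | betaO : IsGenerator .betaO
  | betaU : IsGenerator .betaU
  | betaT : IsGenerator .betaT

theorem CRT.Op.even_deg_betaO : Even Op.betaO.deg := by decide

theorem CRT.Op.even_deg_betaT : Even Op.betaT.deg := by decide

namespace UngradedModule

theorem eq_op_of_op_eq (B : UngradedModule.{u}) {X : Part} {a b : Op X X}
    (hab : ∀ x, B.op a (B.op b x) = x) {x y : B.A X} (h : B.op b x = y) : x = B.op a y := by
  rw [← h, hab]

/-- Additive maps commuting up to sign with the generating operations commute up to sign with all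
operations. -/
theorem map_op_of_generators {B : UngradedModule.{u}} {C : UngradedModule.{v}} (k : ℤ)
    (f : ∀ X, B.A X →+ C.A X)
    (h : ∀ {X Y : Part} {o : Op X Y}, o.IsGenerator → ∀ x,
      f Y (B.op o x) = sg (k * o.deg) • C.op o (f X x))
    {X Y : Part} (o : Op X Y) (x : B.A X) : f Y (B.op o x) = sg (k * o.deg) • C.op o (f X x) := by
  have he := h .eps
  have hz := h .zeta
  have hg := h .gamma
  have ht := h .tau
  have hp := h .psiU
  have hO := h .betaO
  have hU := h .betaU
  have hT := h .betaT
  have hO' (x) : f .O (B.op (.sc .betaOinv) x) = C.op (.sc .betaOinv) (f .O x) := by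
    refine C.eq_op_of_op_eq C.op_betaOinv_betaO ?_
    have := hO (B.op (.sc .betaOinv) x)
    rw [op_betaO_betaOinv, sg_even (Op.even_deg_betaO.mul_left k), one_smul] at this
    exact this.symm
  have hU' (x) : f .U (B.op .betaUinv x) = C.op .betaUinv (f .U x) := by
    refine C.eq_op_of_op_eq C.op_betaUinv_betaU ?_
    have := hU (B.op .betaUinv x)
    rw [op_betaU_betaUinv, sg_even (even_two.mul_left k), one_smul] at this
    exact this.symm
  have hT' (x) : f .T (B.op .betaTinv x) = C.op .betaTinv (f .T x) := by
    refine C.eq_op_of_op_eq C.op_betaTinv_betaT ?_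
    have := hT (B.op .betaTinv x)
    rw [op_betaT_betaTinv, sg_even (Op.even_deg_betaT.mul_left k), one_smul] at this
    exact this.symm
  -- For even `k` every sign is `1`. For odd `k` the sign is the parity of the degree, which is
  -- multiplicative along the words expressing an operation by generators.
  by_cases hk : Even k
  · simp only [sg, Int.even_mul, hk, true_or, if_true, one_smul] at *
    cases o with
    | sc a => cases a <;> simp [*]
    | _ => simp [*]
  · have e4 : Even (4 : ℤ) := by decide
    have e8 : Even (8 : ℤ) := by decide
    have e3 : ¬ Even (3 : ℤ) := by decide
    simp only [sg, Int.even_mul, hk, false_or] at *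
    cases o with
    | sc a => cases a <;> simp_all
    | _ => simp_all

/-- The ungraded modules of maps out of `F(O)`, `F(U)`, `F(T)`. -/
@[reducible] def co (B : UngradedModule.{u}) : Part → UngradedModule.{u}
  | .O => B
  | .U => B.coU
  | .T => B.coT

open AddMonoidHom in
/-- The interchange of the two factors. -/
@[reducible] def swap (B : UngradedModule.{u}) : ∀ Y X : Part, (B.co Y).A X →+ (B.co X).A Y
  | .O, .O => .id (B.A .O)
  | .O, .U => .id (B.A .U)
  | .O, .T => .id (B.A .T)
  | .U, .O => .id (B.A .U)
  -- As `ψ_U` is multiplicative, this replaces the value at `ψ_U l ⊗ m` by that at `l ⊗ ψ_U m`.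
  | .U, .U => ((fst _ _).prod ((B.op .psiU).comp (snd _ _)) :
      B.A .U × B.A .U →+ B.A .U × B.A .U)
  | .U, .T => .id (B.A .U × B.A .U)
  | .T, .O => .id (B.A .T)
  | .T, .U => .id (B.A .U × B.A .U)
  -- The Leibniz formula for `ε τ (l ⊗ m)`, solved for the term in which `ε τ` acts on `m`, the sign
  -- `(-1)^|l|` being absorbed in the coordinate.
  | .T, .T => ((fst _ _).prod ((B.op .eps).comp ((B.op .tau).comp (fst _ _)) - snd _ _ -
      (B.op .etaT).comp (fst _ _)) : B.A .T × B.A .T →+ B.A .T × B.A .T)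

variable (B : UngradedModule.{u})

/-- On the diagonal this says that `ψ_U` is an involution and that `y ↦ ε τ x - y - η_T x` is a
reflection for fixed `x`; elsewhere the interchange is the identity. -/
theorem swap_swap {Y X : Part} (z : (B.co Y).A X) : B.swap X Y (B.swap Y X z) = z := by
  cases X <;> cases Y <;> (try apply Prod.ext) <;> first | (simp; done) | (simp; abel)

/-- The Koszul rule for generating operations on the two factors, each pair being an identity of
explicit matrices over the operations of `B`. -/
theorem swap_op_comm_of_generators {X X' Y Y' : Part} {θ : Op X X'} {φ : Op Y Y'}
    (hθ : θ.IsGenerator) (hφ : φ.IsGenerator) (z : (B.co Y).A X) :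
    (B.co Y').op θ (B.swap X Y' ((B.co X).op φ (B.swap Y X z))) =
      sg (φ.deg * θ.deg) • B.swap X' Y' ((B.co X').op φ (B.swap Y X' ((B.co Y).op θ z))) := by
  cases hθ <;> cases hφ <;>
    -- The sign is `-1` exactly when both operations are among `γ` and `τ`.
    first | change _ = (1 : ℤ) • _ | change _ = (-1 : ℤ) • _
  all_goals (try apply Prod.ext) <;> simp [co] <;> abel_nf <;> simp [← map_zsmul]

theorem sg_mul_self (k : ℤ) : sg k * sg k = 1 := by
  unfold sg; split_ifs <;> rfl

/-- The action of an operation on the second factor. -/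
def right {Y Y' : Part} (φ : Op Y Y') (X : Part) : (B.co Y).A X →+ (B.co Y').A X :=
  (B.swap X Y').comp (((B.co X).op φ).comp (B.swap Y X))

/-- Conjugation by `swap` exchanges the two variables, so the commutation rule can be extended from
generators one variable at a time. -/
theorem right_op_symm {X X' Y Y' : Part} {θ : Op X X'} {φ : Op Y Y'}
    (h : ∀ z : (B.co Y).A X, B.right φ X' ((B.co Y).op θ z) =
      sg (φ.deg * θ.deg) • (B.co Y').op θ (B.right φ X z)) (z : (B.co X).A Y) :
    B.right θ Y' ((B.co X).op φ z) = sg (θ.deg * φ.deg) • (B.co X').op φ (B.right θ Y z) := by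
  have h := congrArg (fun y => sg (φ.deg * θ.deg) • B.swap Y' X' y) (h (B.swap X Y z))
  simp only [right, AddMonoidHom.comp_apply, swap_swap, map_zsmul, smul_smul, sg_mul_self,
    one_smul] at h ⊢
  rw [← h, mul_comm]

/-- The operations on the two factors commute up to sign. -/
theorem right_op {X X' Y Y' : Part} (θ : Op X X') (φ : Op Y Y') (z : (B.co Y).A X) :
    B.right φ X' ((B.co Y).op θ z) = sg (φ.deg * θ.deg) • (B.co Y').op θ (B.right φ X z) := by
  -- First `θ` is reduced to a generator with `φ` arbitrary; after exchanging the variables `φ` is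
  -- reduced as well.
  refine map_op_of_generators φ.deg (B.right φ) (fun hθ z => ?_) θ z
  refine B.right_op_symm (fun z => ?_) z
  refine map_op_of_generators _ (B.right _) (fun hφ z => ?_) φ z
  have h := B.swap_op_comm_of_generators hφ hθ z
  simp only [right, AddMonoidHom.comp_apply]
  rw [h, smul_smul, sg_mul_self, one_smul]

end UngradedModule

/-! ### Sign twists, homogeneous elements and the graded coordinate modules -/

theorem sg_add (k l : ℤ) : sg (k + l) = sg k * sg l := by
  unfold sg
  by_cases hk : Even k <;> by_cases hl : Even l <;> simp [Int.even_add, hk, hl]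

theorem sg_zero : sg 0 = 1 := rfl

namespace UngradedModule

/-- The module with the operations of odd degree multiplied by `(-1)^k`. -/
@[reducible] def twistData (C : UngradedModule.{u}) (k : ℤ) : UngradedData.{u} where
  A := C.A
  op o := sg (k * o.deg) • C.op o

/-- Signs multiply along a word, so the total sign depends only on the change of degree. Both sides
of a relation therefore acquire the same sign, and the relations survive the twist. -/
theorem twistData_word (C : UngradedModule.{u}) (k : ℤ) {X Y : Part} {i j : ℤ} (t : Word X i Y j)
    (x : C.A X) : (C.twistData k).word x t = sg (k * (j - i)) • C.word x t := by
  induction t with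
  | gen a =>
    cases a
    rw [sub_self, mul_zero, sg_zero, one_smul]
    rfl
  | zero => exact (smul_zero _).symm
  | add s t hs ht => simp only [UngradedData.word, hs, ht, smul_add]
  | neg t ht => simp only [UngradedData.word, ht, smul_neg]
  | @op _ _ i' j' o h t ht =>
    subst h
    simp only [UngradedData.word, ht, AddMonoidHom.smul_apply, map_zsmul, smul_smul]
    rw [← sg_add, ← mul_add]
    congr 3
    ring

/-- The CRT-module with the operations of odd degree multiplied by `(-1)^k`. -/
@[reducible] def twist (C : UngradedModule.{u}) (k : ℤ) : UngradedModule.{u} where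
  toUngradedData := C.twistData k
  rel hst x := by rw [twistData_word, twistData_word, C.rel hst]

/-- The graded CRT-module formed by subgroups of an ungraded CRT-module. -/
@[reducible] def ofSubgroups (C : UngradedModule.{u}) (H : ∀ X, ℤ → AddSubgroup (C.A X))
    (hop : ∀ {X Y : Part} (o : Op X Y) {i j : ℤ}, i + o.deg = j → ∀ z ∈ H X i,
      C.op o z ∈ H Y j) : CRTModule.{u} :=
  CRTModule.ofEmbedding
    { carrier := fun X i => H X i
      op := fun {X Y} o {i j} h => ((C.op o).comp (H X i).subtype).codRestrict (H Y j)
        fun z => hop o h z z.2 }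
    C (fun {X} i => (H X i).subtype) (fun h => Subtype.ext h) (fun _ _ _ _ _ => rfl)

open AddMonoidHom in
/-- The value of a pairing read off from its coordinates. -/
@[reducible] def value (B : UngradedModule.{u}) : ∀ Z : Part, (B.co Z).A Z →+ B.A Z
  | .O => .id (B.A .O)
  | .U => (fst _ _ : B.A .U × B.A .U →+ B.A .U)
  | .T => (fst _ _ : B.A .T × B.A .T →+ B.A .T)

end UngradedModule

namespace CRTModule

variable (N : CRTModule.{u})

/-- Homogeneous elements of degree `n`. -/
def homog (X : Part) (n : ℤ) : AddSubgroup (N.tot.A X) := (N.ι n).range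

theorem op_mem_homog {X Y : Part} {o : Op X Y} {i j : ℤ} (h : i + o.deg = j) {x : N.tot.A X}
    (hx : x ∈ N.homog X i) : N.tot.op o x ∈ N.homog Y j := by
  obtain ⟨x, rfl⟩ := hx
  exact ⟨N.op o h x, N.ι_op o h x⟩

theorem op_mem_homog' {X Y : Part} {o : Op X Y} {j : ℤ} {x : N.tot.A X}
    (hx : x ∈ N.homog X (j - o.deg)) : N.tot.op o x ∈ N.homog Y j :=
  N.op_mem_homog (sub_add_cancel _ _) hx

theorem mem_homog_of_eq {X : Part} {i j : ℤ} {x : N.tot.A X} (hx : x ∈ N.homog X i)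
    (h : i = j) : x ∈ N.homog X j :=
  h ▸ hx

/-- Homogeneous elements of `N.tot.co Y`. -/
@[reducible] def coHomog : ∀ Y X : Part, ℤ → AddSubgroup ((N.tot.co Y).A X)
  | .O, X, n => N.homog X n
  | .U, .O, n => N.homog .U n
  | .U, .U, n => (N.homog .U n).prod (N.homog .U n)
  | .U, .T, n => (N.homog .U n).prod (N.homog .U (n + 1))
  | .T, .O, n => N.homog .T n
  | .T, .U, n => (N.homog .U n).prod (N.homog .U (n + 1))
  | .T, .T, n => (N.homog .T n).prod (N.homog .T (n + 1))

/-- Degree bookkeeping for the matrices: second coordinates involving `τ` live one degree higher. -/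
theorem op_mem_coHomog (Y : Part) {X X' : Part} (o : Op X X') {i j : ℤ} (h : i + o.deg = j)
    (z : (N.tot.co Y).A X) (hz : z ∈ N.coHomog Y X i) :
    (N.tot.co Y).op o z ∈ N.coHomog Y X' j := by
  subst h
  cases Y
  · exact N.op_mem_homog rfl hz
  all_goals
    rcases o with ⟨⟨⟩⟩ | _ | _ | _ | _ | _ | _ | _ | _
  all_goals
    (try refine AddSubgroup.mem_prod.2 ⟨?_, ?_⟩)
    all_goals
      try simp only [AddMonoidHom.prod_apply, AddMonoidHom.comp_apply, AddMonoidHom.add_apply,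
        AddMonoidHom.sub_apply, AddMonoidHom.neg_apply]
      repeat' first
        | exact zero_mem _
        | refine add_mem ?_ ?_
        | refine sub_mem ?_ ?_
        | refine neg_mem ?_
        | refine N.op_mem_homog' ?_
    all_goals first
      | exact N.mem_homog_of_eq hz (by ring)
      | exact N.mem_homog_of_eq hz.1 (by ring)
      | exact N.mem_homog_of_eq hz.2 (by ring)

theorem swap_mem_coHomog {Y X : Part} {n : ℤ} {z : (N.tot.co Y).A X}
    (hz : z ∈ N.coHomog Y X n) : N.tot.swap Y X z ∈ N.coHomog X Y n := by
  cases Y <;> cases X <;> try exact hz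
  · exact AddSubgroup.mem_prod.2 ⟨hz.1, N.op_mem_homog (add_zero _) hz.2⟩
  · have h₀ : z.1 ∈ N.homog .T n := hz.1
    have h₁ : N.tot.op .eps (N.tot.op .tau z.1) ∈ N.homog .T (n + 1) :=
      N.op_mem_homog (add_zero (n + 1)) (N.op_mem_homog (o := .tau) (Eq.refl (n + 1)) h₀)
    have h₂ : N.tot.op .etaT z.1 ∈ N.homog .T (n + 1) := N.op_mem_homog (Eq.refl (n + 1)) h₀
    have h₃ : z.2 ∈ N.homog .T (n + 1) := hz.2
    exact AddSubgroup.mem_prod.2 ⟨hz.1, sub_mem (sub_mem h₁ h₃) h₂⟩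

theorem value_mem_homog {Z : Part} {n : ℤ} {z : (N.tot.co Z).A Z} (hz : z ∈ N.coHomog Z Z n) :
    N.tot.value Z z ∈ N.homog Z n := by
  cases Z
  exacts [hz, hz.1, hz.1]

theorem ι_component {X : Part} {n : ℤ} {x : N.tot.A X} (hx : x ∈ N.homog X n) :
    N.ι n (N.component X n x) = x := by
  obtain ⟨x, rfl⟩ := hx
  rw [component_ι]

/-- The part `Y` generator in degree `j` dualized: `Hom(F(Y, j), N)`. -/
@[reducible] def coShift (Y : Part) (j : ℤ) : CRTModule.{u} :=
  (N.tot.co Y).ofSubgroups (fun X i => N.coHomog Y X (i + j)) fun o _ _ h z hz =>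
    N.op_mem_coHomog Y o (by rw [← h]; ring) z hz

/-- The CRT-module of values of pairings with a fixed first variable of part `Z`, degree `k`. -/
@[reducible] def coTwist (Z : Part) (k : ℤ) : CRTModule.{u} :=
  ((N.tot.co Z).twist k).ofSubgroups (fun X i => N.coHomog Z X (k + i)) fun o _ _ h z hz =>
    zsmul_mem (N.op_mem_coHomog Z o (by rw [← h]; ring) z hz) _

end CRTModule

namespace UngradedModule

/-- Graded version of `map_op_of_generators`. -/
theorem map_graded_op_of_generators {Q : CRTModule.{u}} {C : UngradedModule.{v}} (k : ℤ)
    (f : ∀ X i, Q.carrier X i →+ C.A X)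
    (h : ∀ {X Y : Part} {o : Op X Y}, o.IsGenerator → ∀ {i j : ℤ} (hij : i + o.deg = j) x,
      f Y j (Q.op o hij x) = sg (k * o.deg) • C.op o (f X i x))
    {X Y : Part} (o : Op X Y) {i j : ℤ} (hij : i + o.deg = j) (x : Q.carrier X i) :
    f Y j (Q.op o hij x) = sg (k * o.deg) • C.op o (f X i x) := by
  have key := map_op_of_generators (B := Q.tot) (C := C) k (fun X => Q.totLift (f X))
    (fun {X Y o} ho x => by
      refine DFunLike.congr_fun (CRTModule.tot_hom_ext
        (f := (Q.totLift (f Y)).comp (Q.tot.op o))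
        (g := sg (k * o.deg) • (C.op o).comp (Q.totLift (f X))) fun i x => ?_) x
      simp only [AddMonoidHom.comp_apply, AddMonoidHom.smul_apply]
      rw [← Q.ι_op o rfl, Q.totLift_ι, Q.totLift_ι]
      exact h ho rfl x) o (Q.ι i x)
  rwa [← Q.ι_op o hij, Q.totLift_ι, Q.totLift_ι] at key

end UngradedModule

/-! ### CRT-pairings with ungraded values -/

/-- The value of a formal expression in an ungraded module. -/
def UngradedData.termEval (B : UngradedData.{w}) {G : Part → ℤ → Type v}
    (f : ∀ {X : Part} {i : ℤ}, G X i → B.A X) : ∀ {X : Part} {i : ℤ}, Term G X i → B.A X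
  | _, _, .gen g => f g
  | _, _, .zero => 0
  | _, _, .add s t => B.termEval f s + B.termEval f t
  | _, _, .neg t => -B.termEval f t
  | _, _, .op o _ t => B.op o (B.termEval f t)

theorem CRTModule.ι_termEval (N : CRTModule.{w}) {G : Part → ℤ → Type v}
    (f : ∀ {X : Part} {i : ℤ}, G X i → N.carrier X i) {X : Part} {i : ℤ} (t : Term G X i) :
    N.ι i (N.eval f t) = N.tot.termEval (fun {_ i} g => N.ι i (f g)) t := by
  induction t with
  | gen a => rfl
  | zero => exact map_zero _
  | add s t hs ht => simp only [CRTData.eval, map_add, hs, ht]; rfl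
  | neg t ht => simp only [CRTData.eval, map_neg, ht]; rfl
  | op o h t ht => simp only [CRTData.eval, CRTModule.ι_op, ht]; rfl

namespace CRTModule

/-- The values on pure tensors of a map of two variables. -/
def pureValue {L : CRTModule.{u}} {M : CRTModule.{v}} {B : UngradedModule.{w}}
    (pair : ∀ {X : Part} {i j : ℤ}, L.carrier X i → M.carrier X j → B.A X) :
    ∀ {X : Part} {n : ℤ}, PureTensor L M X n → B.A X
  | _, _, .mk _ l m => pair l m

/-- A CRT-pairing with values in an ungraded CRT-module. -/
structure Pairing (L : CRTModule.{u}) (M : CRTModule.{v}) (B : UngradedModule.{w}) where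
  pair : ∀ {X : Part} {i j : ℤ}, L.carrier X i → M.carrier X j → B.A X
  rel : ∀ {X : Part} {n : ℤ} {s t : Term (PureTensor L M) X n}, TensorRel L M s t →
    B.termEval (pureValue pair) s = B.termEval (pureValue pair) t

/-- The pairing of a homomorphism out of a tensor product. -/
def Hom.pairing {L : CRTModule.{u}} {M : CRTModule.{v}} {N : CRTModule.{w}}
    (α : Hom (tensor L M) N) : Pairing L M N.tot where
  pair {X i j} l m := N.ι (i + j) (α.toFun X (i + j) (tmul rfl l m))
  rel {X n s t} h := by
    have key (q : Term (PureTensor L M) X n) :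
        N.ι n (α.toFun X n ((tensor L M).eval (fun {X n} (g : PureTensor L M X n) =>
          (presented.of g : (tensor L M).carrier X n)) q)) =
        N.tot.termEval (pureValue fun {X i j} l m =>
          N.ι (i + j) (α.toFun X (i + j) (tmul rfl l m))) q := by
      clear h s t
      induction q with
      | gen a => obtain ⟨rfl, l, m⟩ := a; rfl
      | zero => exact (congrArg (N.ι _) (map_zero _)).trans (map_zero _)
      | add s t hs ht => simp only [CRTData.eval, map_add, hs, ht]; rfl
      | neg t ht => simp only [CRTData.eval, map_neg, ht]; rfl
      | op o h t ht => simp only [CRTData.eval, α.map_op, CRTModule.ι_op, ht]; rfl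
    rw [← key, ← key, tensor_rel h]

namespace Pairing

variable {L : CRTModule.{u}} {M : CRTModule.{v}} {B : UngradedModule.{w}} (p : Pairing L M B)
  {X : Part} {i j i' j' : ℤ}

theorem termEval_koszul {G : Part → ℤ → Type v} (f : ∀ {X : Part} {i : ℤ}, G X i → B.A X)
    (k : ℤ) (t : Term G X i) : B.termEval f (t.koszul k) = sg k • B.termEval f t := by
  by_cases hk : Even k
  · rw [Term.koszul, if_pos hk, sg_even hk, one_smul]
  · rw [Term.koszul, if_neg hk, sg_odd hk, neg_smul, one_smul]; rfl

theorem add_left (l l' : L.carrier X i) (m : M.carrier X j) :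
    p.pair (l + l') m = p.pair l m + p.pair l' m :=
  p.rel (.add_left rfl l l' m)

theorem add_right (l : L.carrier X i) (m m' : M.carrier X j) :
    p.pair l (m + m') = p.pair l m + p.pair l m' :=
  p.rel (.add_right rfl l m m')

theorem scalar_left (a : Scalar X) (h : i + a.deg = i') (l : L.carrier X i)
    (m : M.carrier X j) : p.pair (L.op (.sc a) h l) m = B.op (.sc a) (p.pair l m) := by
  have h := p.rel (.scalar_left a rfl h (n' := i' + j) (by rw [← h]; ring) rfl l m)
  exact h.symm

theorem scalar_right (a : Scalar X) (h : j + a.deg = j') (l : L.carrier X i)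
    (m : M.carrier X j) :
    p.pair l (M.op (.sc a) h m) = sg (a.deg * i) • B.op (.sc a) (p.pair l m) := by
  have h := p.rel (.scalar_right a rfl h (n' := i + j') (by rw [← h]; ring) rfl l m)
  rw [termEval_koszul] at h
  change B.op (.sc a) (p.pair l m) = sg (a.deg * i) • p.pair l (M.op (.sc a) _ m) at h
  rw [h, smul_smul, UngradedModule.sg_mul_self, one_smul]

theorem eps (hi : i + 0 = i') (hj : j + 0 = j') (l : L.carrier .O i) (m : M.carrier .O j) :
    p.pair (L.op .eps hi l) (M.op .eps hj m) = B.op .eps (p.pair l m) := by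
  obtain rfl : i = i' := by omega
  obtain rfl : j = j' := by omega
  exact (p.rel (.eps rfl hi hj (add_zero _) l m)).symm

theorem zeta (hi : i + 0 = i') (hj : j + 0 = j') (l : L.carrier .T i) (m : M.carrier .T j) :
    p.pair (L.op .zeta hi l) (M.op .zeta hj m) = B.op .zeta (p.pair l m) := by
  obtain rfl : i = i' := by omega
  obtain rfl : j = j' := by omega
  exact (p.rel (.zeta rfl hi hj (add_zero _) l m)).symm

theorem psiU (hi : i + 0 = i') (hj : j + 0 = j') (l : L.carrier .U i) (m : M.carrier .U j) :
    p.pair (L.op .psiU hi l) (M.op .psiU hj m) = B.op .psiU (p.pair l m) := by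
  obtain rfl : i = i' := by omega
  obtain rfl : j = j' := by omega
  exact (p.rel (.psiU rfl hi hj (add_zero _) l m)).symm

theorem gamma_left (hi : i + -1 = i') (hj : j + 0 = j') (l : L.carrier .U i)
    (m : M.carrier .T j) :
    p.pair (L.op .gamma hi l) m = B.op .gamma (p.pair l (M.op .zeta hj m)) := by
  obtain rfl : j = j' := by omega
  exact (p.rel (.gamma_left rfl hj hi (n' := i' + j) (by rw [← hi]; ring) rfl l m)).symm

theorem gamma_right (hi : i + 0 = i') (hj : j + -1 = j') (l : L.carrier .T i)
    (m : M.carrier .U j) :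
    p.pair l (M.op .gamma hj m) = sg i • B.op .gamma (p.pair (L.op .zeta hi l) m) := by
  obtain rfl : i = i' := by omega
  have h := p.rel (.gamma_right rfl hi hj (n' := i + j') (by rw [← hj]; ring) rfl l m)
  rw [termEval_koszul] at h
  change B.op .gamma (p.pair (L.op .zeta hi l) m) = sg i • p.pair l (M.op .gamma hj m) at h
  rw [h, smul_smul, UngradedModule.sg_mul_self, one_smul]

theorem tau_left (hi : i + 1 = i') (hj : j + 0 = j') (l : L.carrier .T i)
    (m : M.carrier .O j) :
    p.pair (L.op .tau hi l) m = B.op .tau (p.pair l (M.op .eps hj m)) := by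
  obtain rfl : j = j' := by omega
  exact (p.rel (.tau_left rfl hj hi (n' := i' + j) (by rw [← hi]; ring) rfl l m)).symm

theorem tau_right (hi : i + 0 = i') (hj : j + 1 = j') (l : L.carrier .O i)
    (m : M.carrier .T j) :
    p.pair l (M.op .tau hj m) = sg i • B.op .tau (p.pair (L.op .eps hi l) m) := by
  obtain rfl : i = i' := by omega
  have h := p.rel (.tau_right rfl hi hj (n' := i + j') (by rw [← hj]; ring) rfl l m)
  rw [termEval_koszul] at h
  change B.op .tau (p.pair (L.op .eps hi l) m) = sg i • p.pair l (M.op .tau hj m) at h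
  rw [h, smul_smul, UngradedModule.sg_mul_self, one_smul]

/-- The Leibniz formula is solved for the term with `ε τ` on the second factor, the shape that
matches `swap`. -/
theorem eps_tau {i'' j'' : ℤ} (hi : i + 1 = i') (hi' : i' + 0 = i'') (hj : j + 1 = j')
    (hj' : j' + 0 = j'') (l : L.carrier .T i) (m : M.carrier .T j) :
    sg i • p.pair l (M.op .eps hj' (M.op .tau hj m)) =
      B.op .eps (B.op .tau (p.pair l m)) - p.pair (L.op .eps hi' (L.op .tau hi l)) m -
        B.op .etaT (p.pair l m) := by
  obtain rfl : i' = i'' := by omega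
  obtain rfl : j' = j'' := by omega
  have h := p.rel (.eps_tau rfl hi hi' hj hj' (n' := i + j') (by rw [← hj]; ring) (add_zero _)
    (by omega) rfl l m)
  change B.op .eps (B.op .tau (p.pair l m)) =
    p.pair (L.op .eps hi' (L.op .tau hi l)) m + B.termEval _ (Term.koszul _ _) +
      B.op .etaT (p.pair l m) at h
  rw [termEval_koszul] at h
  change _ = _ + sg i • p.pair l (M.op .eps hj' (M.op .tau hj m)) + _ at h
  rw [h]
  abel

end Pairing
end CRTModule

/-! ### Coordinates of a pairing and operations on the first variable -/

namespace CRTModule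

namespace Pairing

variable {L : CRTModule.{u}} {M : CRTModule.{v}} {B : UngradedModule.{w}} (p : Pairing L M B)

/-- The coordinates of a pairing at a pair of elements of parts `Z` and `Y`. -/
@[reducible] def coord : ∀ (Y Z : Part) {k j : ℤ}, L.carrier Z k → M.carrier Y j → (B.co Y).A Z
  | .O, .O, _, _, l, m => (p.pair l m : B.A .O)
  | .O, .U, _, _, l, m => (p.pair l (M.op .c (add_zero _) m) : B.A .U)
  | .O, .T, _, _, l, m => (p.pair l (M.op .eps (add_zero _) m) : B.A .T)
  | .U, .O, _, _, l, m => (p.pair (L.op .c (add_zero _) l) m : B.A .U)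
  | .U, .U, _, _, l, m => ((p.pair l m, p.pair (L.op .psiU (add_zero _) l) m) :
      B.A .U × B.A .U)
  | .U, .T, _, _, l, m => ((p.pair (L.op .zeta (add_zero _) l) m,
      p.pair (L.op .c (add_zero _) (L.op .tau rfl l)) m) : B.A .U × B.A .U)
  | .T, .O, _, _, l, m => (p.pair (L.op .eps (add_zero _) l) m : B.A .T)
  | .T, .U, k, _, l, m => ((p.pair l (M.op .zeta (add_zero _) m),
      sg k • p.pair l (M.op .c (add_zero _) (M.op .tau rfl m))) : B.A .U × B.A .U)
  | .T, .T, _, _, l, m => ((p.pair l m, p.pair (L.op .eps (add_zero _) (L.op .tau rfl l)) m) :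
      B.A .T × B.A .T)

theorem coord_add_left {Y Z : Part} {k j : ℤ} (l l' : L.carrier Z k) (m : M.carrier Y j) :
    p.coord Y Z (l + l') m = p.coord Y Z l m + p.coord Y Z l' m := by
  cases Y <;> cases Z <;> simp only [coord, map_add, add_left, smul_add] <;> rfl

theorem coord_add_right {Y Z : Part} {k j : ℤ} (l : L.carrier Z k) (m m' : M.carrier Y j) :
    p.coord Y Z l (m + m') = p.coord Y Z l m + p.coord Y Z l m' := by
  cases Y <;> cases Z <;> simp only [coord, map_add, add_right, smul_add] <;> rfl

/-- The additive extension of `l ↦ l ⊗ m` to the ungraded module. -/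
def left {X : Part} {j : ℤ} (m : M.carrier X j) : L.tot.A X →+ B.A X :=
  L.totLift fun _ => AddMonoidHom.mk' (fun l => p.pair l m) fun l l' => p.add_left l l' m

/-- The additive extension of `m ↦ l ⊗ m` to the ungraded module. -/
def right {X : Part} {i : ℤ} (l : L.carrier X i) : M.tot.A X →+ B.A X :=
  M.totLift fun _ => AddMonoidHom.mk' (fun m => p.pair l m) fun m m' => p.add_right l m m'

theorem pair_eq_left {X : Part} {i j : ℤ} (l : L.carrier X i) (m : M.carrier X j) :
    p.pair l m = p.left m (L.ι i l) :=
  (L.totLift_ι (fun _ => AddMonoidHom.mk' (fun l => p.pair l m) fun l l' => p.add_left l l' m)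
    l).symm

theorem pair_eq_right {X : Part} {i j : ℤ} (l : L.carrier X i) (m : M.carrier X j) :
    p.pair l m = p.right l (M.ι j m) :=
  (M.totLift_ι (fun _ => AddMonoidHom.mk' (fun m => p.pair l m) fun m m' => p.add_right l m m')
    m).symm

theorem left_scalar {X : Part} {j : ℤ} (a : Scalar X) (m : M.carrier X j) (x : L.tot.A X) :
    p.left m (L.tot.op (.sc a) x) = B.op (.sc a) (p.left m x) := by
  refine DFunLike.congr_fun (tot_hom_ext (f := (p.left m).comp (L.tot.op (.sc a)))
    (g := (B.op (.sc a)).comp (p.left m)) fun i l => ?_) x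
  simp only [AddMonoidHom.comp_apply]
  rw [← L.ι_op _ rfl, ← pair_eq_left, ← pair_eq_left, scalar_left]

theorem right_scalar {X : Part} {i : ℤ} (a : Scalar X) (l : L.carrier X i) (x : M.tot.A X) :
    p.right l (M.tot.op (.sc a) x) = sg (a.deg * i) • B.op (.sc a) (p.right l x) := by
  refine DFunLike.congr_fun (tot_hom_ext (f := (p.right l).comp (M.tot.op (.sc a)))
    (g := sg (a.deg * i) • (B.op (.sc a)).comp (p.right l)) fun j m => ?_) x
  simp only [AddMonoidHom.comp_apply, AddMonoidHom.smul_apply]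
  rw [← M.ι_op _ rfl, ← pair_eq_right, ← pair_eq_right, scalar_right]

/-- The matrices of `co Y` were chosen to make this true. For `Y = O` it restates the pairing
relations; for `Y = U` relations in `L` and bilinearity suffice; for `Y = T` the cases `ζ` and `γ`
need the Leibniz formula. -/
theorem coord_op_left_of_isGenerator {Y Z Z' : Part} {o : Op Z Z'} (ho : o.IsGenerator)
    {k k' j : ℤ} (h : k + o.deg = k') (l : L.carrier Z k) (m : M.carrier Y j) :
    p.coord Y Z' (L.op o h l) m = (B.co Y).op o (p.coord Y Z l m) := by
  cases Y
  · cases ho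
    · exact p.eps h _ l m
    · have e : M.op .c (add_zero j) m = M.op .zeta (add_zero j) (M.op .eps (add_zero j) m) :=
        M.ι_inj (by simp [ι_op])
      simp only [coord, e]
      exact p.zeta h _ l _
    · have e : M.op .c (add_zero j) m = M.op .zeta (add_zero j) (M.op .eps (add_zero j) m) :=
        M.ι_inj (by simp [ι_op])
      simp only [coord, e]
      exact p.gamma_left h _ l _
    · exact p.tau_left h _ l m
    -- As `c m` is fixed by `ψ_U`, a factor `ψ_U` can be inserted there so that multiplicativity
    -- applies.
    · have e : M.op .c (add_zero j) m = M.op .psiU (add_zero j) (M.op .c (add_zero j) m) :=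
        M.ι_inj (by simp [ι_op])
      simp only [coord]
      conv_lhs => rw [e]
      exact p.psiU h _ l _
    all_goals exact p.scalar_left _ h l _
  · cases ho <;> (try apply Prod.ext) <;>
      simp [coord, pair_eq_left, ι_op, left_scalar]
  · cases ho
    · have e : L.op .eps (add_zero _) (L.op .tau rfl (L.op .eps h l)) =
          L.op .etaT rfl (L.op .eps h l) := L.ι_inj (by simp [ι_op])
      obtain rfl : k = k' := (add_zero k).symm.trans h
      exact Prod.ext rfl ((congrArg (p.pair · m) e).trans (p.scalar_left _ _ _ _))
    · have e : M.op .c (add_zero _) (M.op .tau rfl m) =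
          M.op .zeta (add_zero _) (M.op .eps (add_zero _) (M.op .tau rfl m)) :=
        M.ι_inj (by simp [ι_op])
      obtain rfl : k = k' := (add_zero k).symm.trans h
      refine Prod.ext (p.zeta _ _ _ _) ?_
      simp only [coord, e, p.zeta, ← map_zsmul, p.eps_tau rfl (add_zero _)]
      simp
    · obtain rfl : k = k' + 1 := eq_add_of_add_neg_eq h
      have e : M.op .c (add_zero _) (M.op .tau rfl m) =
          M.op .zeta (add_zero _) (M.op .eps (add_zero _) (M.op .tau rfl m)) :=
        M.ι_inj (by simp [ι_op])
      -- The Leibniz formula at `γ l ⊗ m` computes the second coordinate; since `γ` lowers the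
      -- degree by one, its sign is opposite to that attached to `l`.
      have h₁ := p.eps_tau rfl (add_zero _) rfl (add_zero _) (L.op .gamma h l) m
      have h₂ := p.gamma_left h (add_zero _) l m
      rw [p.gamma_left h (add_zero _), ← e, h₂] at h₁
      refine Prod.ext h₂ ?_
      simp only [coord, sg_add]
      rw [show sg 1 = -1 from rfl, mul_neg_one, neg_smul]
      simp at h₁ ⊢
      rw [h₁]
      abel
    · subst h
      rfl
    · have e₁ : M.op .zeta (add_zero _) m = M.op .psiU (add_zero _) (M.op .zeta (add_zero _) m) :=
        M.ι_inj (by simp [ι_op])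
      have e₂ : M.op .c (add_zero _) (M.op .tau rfl m) =
          M.op .psiU (add_zero _) (M.op .c (add_zero _) (M.op .tau rfl m)) :=
        M.ι_inj (by simp [ι_op])
      obtain rfl : k = k' := (add_zero k).symm.trans h
      refine Prod.ext ?_ ?_
      · exact (congrArg (p.pair _) e₁).trans (p.psiU _ _ _ _)
      · exact (congrArg (fun x => sg k • p.pair _ x) e₂).trans
          ((congrArg (sg k • ·) (p.psiU _ _ _ _)).trans (map_zsmul _ _ _).symm)
    · simp [coord, pair_eq_left, ι_op, left_scalar]
    · have hs : sg k' = sg k := by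
        rw [← h, sg_add, show sg Op.betaU.deg = 1 from rfl, mul_one]
      apply Prod.ext <;> simp [coord, pair_eq_left, ι_op, left_scalar, hs]
    · have e : L.op .eps (add_zero _) (L.op .tau rfl (L.op .betaT h l)) =
          L.op .betaT (by omega) (L.op .eps (add_zero _) (L.op .tau rfl l) + L.op .etaT rfl l) :=
        L.ι_inj (by simp [ι_op])
      exact Prod.ext (p.scalar_left _ _ _ _) ((congrArg (p.pair · m) e).trans
        ((p.scalar_left _ _ _ _).trans (congrArg _ ((p.add_left _ _ _).trans
          (congrArg _ (p.scalar_left _ _ _ _))))))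

/-- The coordinates of a pairing, up to the interchange of the factors. -/
@[reducible] def coordSwap : ∀ (Z Y : Part) {k j : ℤ}, L.carrier Z k → M.carrier Y j →
    (B.co Z).A Y
  | .O, .O, _, _, l, m => (p.pair l m : B.A .O)
  | .O, .U, _, _, l, m => (p.pair (L.op .c (add_zero _) l) m : B.A .U)
  | .O, .T, _, _, l, m => (p.pair (L.op .eps (add_zero _) l) m : B.A .T)
  | .U, .O, _, _, l, m => (p.pair l (M.op .c (add_zero _) m) : B.A .U)
  | .U, .U, _, _, l, m => ((p.pair l m, p.pair l (M.op .psiU (add_zero _) m)) :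
      B.A .U × B.A .U)
  | .U, .T, k, _, l, m => ((p.pair l (M.op .zeta (add_zero _) m),
      sg k • p.pair l (M.op .c (add_zero _) (M.op .tau rfl m))) : B.A .U × B.A .U)
  | .T, .O, _, _, l, m => (p.pair l (M.op .eps (add_zero _) m) : B.A .T)
  | .T, .U, _, _, l, m => ((p.pair (L.op .zeta (add_zero _) l) m,
      p.pair (L.op .c (add_zero _) (L.op .tau rfl l)) m) : B.A .U × B.A .U)
  | .T, .T, k, _, l, m => ((p.pair l m,
      sg k • p.pair l (M.op .eps (add_zero _) (M.op .tau rfl m))) : B.A .T × B.A .T)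

/-- Off the diagonal the two sets of coordinates agree by definition. On it the reasons are
multiplicativity of `ψ_U` and the Leibniz formula for `ε τ`. -/
theorem swap_coord {Y Z : Part} {k j : ℤ} (l : L.carrier Z k) (m : M.carrier Y j) :
    B.swap Y Z (p.coord Y Z l m) = p.coordSwap Z Y l m := by
  cases Y <;> cases Z <;> try rfl
  · refine Prod.ext rfl ?_
    change B.op .psiU (p.pair (L.op .psiU _ l) m) = p.pair l (M.op .psiU _ m)
    rw [← p.psiU (add_zero _) (add_zero _)]
    have e : L.op .psiU (add_zero k) (L.op .psiU (add_zero k) l) = l := L.ι_inj (by simp [ι_op])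
    rw [e]
  · exact Prod.ext rfl (p.eps_tau _ _ _ _ l m).symm

end Pairing
end CRTModule

/-! ### Operations on the second variable -/

theorem sg_neg (k : ℤ) : sg (-k) = sg k := by
  unfold sg; simp only [even_neg]

theorem sg_mul_zero (k : ℤ) : sg (k * 0) = 1 := by rw [mul_zero]; rfl

theorem sg_mul_neg_one (k : ℤ) : sg (k * -1) = sg k := by rw [mul_neg_one, sg_neg]

theorem sg_mul_one (k : ℤ) : sg (k * 1) = sg k := by rw [mul_one]

theorem sg_mul_even {n : ℤ} (k : ℤ) (h : Even n) : sg (k * n) = 1 := sg_even (h.mul_left k)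

theorem sg_even_mul {n : ℤ} (k : ℤ) (h : Even n) : sg (n * k) = 1 := sg_even (h.mul_right k)

theorem sg_add_one (k : ℤ) : sg (k + 1) = -sg k := by
  rw [sg_add, show sg 1 = -1 from rfl, mul_neg_one]

namespace CRTModule

namespace Pairing

variable {L : CRTModule.{u}} {M : CRTModule.{v}} {B : UngradedModule.{w}} (p : Pairing L M B)

theorem even_smul {A : Type*} [AddCommGroup A] {n : ℤ} (k : ℤ) (h : Even n) (x : A) :
    sg (k * n) • x = x := by rw [sg_mul_even k h, one_smul]

/-- The mirror image of `coord_op_left_of_isGenerator`; the sign comes from moving the operation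
past `l`, of degree `k`. -/
theorem coordSwap_op_right_of_isGenerator {Y Y' Z : Part} {o : Op Y Y'} (ho : o.IsGenerator)
    {k j j' : ℤ} (h : j + o.deg = j') (l : L.carrier Z k) (m : M.carrier Y j) :
    p.coordSwap Z Y' l (M.op o h m) = sg (k * o.deg) • (B.co Z).op o (p.coordSwap Z Y l m) := by
  cases Z
  · have e₁ : L.op .c (add_zero k) l = L.op .zeta (add_zero k) (L.op .eps (add_zero k) l) :=
      L.ι_inj (by simp [ι_op])
    cases ho
    · rw [even_smul k (by decide)]
      exact p.eps _ h l m
    · rw [even_smul k (by decide)]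
      simp only [coordSwap, e₁]
      exact p.zeta _ h _ m
    · rw [sg_mul_neg_one]
      simp only [coordSwap, e₁]
      exact p.gamma_right _ h _ m
    · rw [sg_mul_one]
      exact p.tau_right _ h l m
    · have e : L.op .c (add_zero k) l = L.op .psiU (add_zero k) (L.op .c (add_zero k) l) :=
        L.ι_inj (by simp [ι_op])
      rw [even_smul k (by decide)]
      simp only [coordSwap]
      conv_lhs => rw [e]
      exact p.psiU _ h _ m
    all_goals
      rw [mul_comm]
      exact p.scalar_right _ h _ _
  · have h2 : sg (2 * k) = 1 := sg_even_mul k (by decide)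
    have h4 : sg (4 * k) = 1 := sg_even_mul k (by decide)
    have h8 : sg (8 * k) = 1 := sg_even_mul k (by decide)
    have h0 : sg 0 = 1 := rfl
    by_cases hk : Even k
    all_goals
      cases ho <;> simp only [mul_comm k, h2, h4, h8] <;> (try apply Prod.ext) <;>
        simp [coordSwap, pair_eq_right, ι_op, right_scalar, sg_neg, sg_even, sg_odd, hk, h2, h0,
          add_comm]
  · have ec : L.op .c (add_zero _) (L.op .tau rfl l) =
        L.op .zeta (add_zero _) (L.op .eps (add_zero _) (L.op .tau rfl l)) :=
      L.ι_inj (by simp [ι_op])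
    cases ho
    · rw [even_smul k (by decide)]
      have e : M.op .eps (add_zero _) (M.op .tau rfl (M.op .eps h m)) =
        M.op .etaT rfl (M.op .eps h m) := M.ι_inj (by simp [ι_op])
      obtain rfl : j = j' := (add_zero j).symm.trans h
      refine Prod.ext rfl ?_
      simp only [coordSwap, e, p.scalar_right]
      rw [show Scalar.etaT.deg * k = k from one_mul k, smul_smul, UngradedModule.sg_mul_self,
        one_smul]
      rfl
    · rw [even_smul k (by decide)]
      obtain rfl : j = j' := (add_zero j).symm.trans h
      refine Prod.ext (p.zeta _ _ _ _) ?_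
      -- The coordinates of `ζ m` involve `ε τ l`, those of `m` involve `ε τ m`; the Leibniz formula
      -- converts one into the other.
      have h₁ := p.eps_tau rfl (add_zero _) rfl (add_zero _) l m
      simp only [coordSwap, ec, p.zeta]
      rw [h₁]
      simp
    · rw [sg_mul_neg_one]
      obtain rfl : j = j' + 1 := eq_add_of_add_neg_eq h
      have h₁ := p.eps_tau rfl (add_zero _) rfl (add_zero _) l (M.op .gamma h m)
      have h₂ := p.gamma_right (add_zero _) h (L.op .eps (add_zero _) (L.op .tau rfl l)) m
      refine Prod.ext (p.gamma_right _ h l m) ?_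
      simp only [coordSwap, ec]
      rw [h₁, h₂, p.gamma_right (add_zero _) h l m, sg_add_one]
      simp
    · rw [sg_mul_one]
      simp only [coordSwap]
      -- One sign comes from `τ` passing `l`, the other is built into the coordinate; they cancel.
      change _ = sg k • (sg k • p.pair l (M.op .eps _ (M.op .tau rfl m)))
      rw [smul_smul, UngradedModule.sg_mul_self, one_smul]
      subst h
      rfl
    · rw [even_smul k (by decide)]
      have e₁ : L.op .zeta (add_zero _) l = L.op .psiU (add_zero _) (L.op .zeta (add_zero _) l) :=
        L.ι_inj (by simp [ι_op])
      have e₂ : L.op .c (add_zero _) (L.op .tau rfl l) =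
          L.op .psiU (add_zero _) (L.op .c (add_zero _) (L.op .tau rfl l)) :=
        L.ι_inj (by simp [ι_op])
      refine Prod.ext ?_ ?_
      · exact (congrArg (p.pair · _) e₁).trans (p.psiU _ _ _ _)
      · exact (congrArg (p.pair · _) e₂).trans (p.psiU _ _ _ _)
    · have h4 : sg (4 * k) = 1 := sg_even_mul k (by decide)
      rw [even_smul k (by decide)]
      simp [coordSwap, pair_eq_right, ι_op, right_scalar, h4]
    · rw [mul_comm]
      refine Prod.ext (p.scalar_right _ h _ _) ((p.scalar_right _ h _ _).trans ?_)
      rw [sg_even_mul _ (by decide), sg_even_mul _ (by decide)]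
      rfl
    · rw [mul_comm]
      have e : M.op .eps (add_zero _) (M.op .tau rfl (M.op .betaT h m)) =
          M.op .betaT (by rw [← h]; ring) (M.op .eps (add_zero _) (M.op .tau rfl m) +
            M.op .etaT rfl m) :=
        M.ι_inj (by simp [ι_op])
      refine Prod.ext (p.scalar_right _ h _ _) ?_
      simp only [coordSwap, e]
      rw [sg_even_mul _ (by decide), one_smul, p.scalar_right, sg_even_mul _ (by decide), one_smul,
        p.add_right, p.scalar_right, show Scalar.etaT.deg * k = k from one_mul k, map_add,
        smul_add, map_zsmul, smul_smul, UngradedModule.sg_mul_self, one_smul]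
      simp

end Pairing
end CRTModule

/-! ### Coordinates as homomorphisms, and uniqueness from a basis -/

namespace CRTModule

variable {L : CRTModule.{u}} {M : CRTModule.{v}}

namespace Pairing

variable {B : UngradedModule.{w}} (p : Pairing L M B)

theorem coord_op_left {Y Z Z' : Part} (o : Op Z Z') {k k' j : ℤ} (h : k + o.deg = k')
    (l : L.carrier Z k) (m : M.carrier Y j) :
    p.coord Y Z' (L.op o h l) m = (B.co Y).op o (p.coord Y Z l m) := by
  have key := UngradedModule.map_graded_op_of_generators (Q := L) (C := B.co Y) 0
    (fun Z k => AddMonoidHom.mk' (fun l : L.carrier Z k => p.coord Y Z l m)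
      fun l l' => p.coord_add_left l l' m)
    (fun ho _ _ h l => (p.coord_op_left_of_isGenerator ho h l m).trans
      (by rw [zero_mul, sg_zero, one_smul]; rfl)) o h l
  rw [zero_mul, sg_zero, one_smul] at key
  exact key

theorem coordSwap_op_right {Y Y' Z : Part} (o : Op Y Y') {k j j' : ℤ} (h : j + o.deg = j')
    (l : L.carrier Z k) (m : M.carrier Y j) :
    p.coordSwap Z Y' l (M.op o h m) = sg (k * o.deg) • (B.co Z).op o (p.coordSwap Z Y l m) :=
  UngradedModule.map_graded_op_of_generators (Q := M) (C := B.co Z) k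
    (fun Y j => AddMonoidHom.mk' (fun m : M.carrier Y j => p.coordSwap Z Y l m)
      fun m m' => by simp only [← swap_coord, coord_add_right, map_add])
    (fun ho _ _ h m => p.coordSwap_op_right_of_isGenerator ho h l m) o h m

theorem value_coordSwap {Z : Part} {k j : ℤ} (l : L.carrier Z k) (m : M.carrier Z j) :
    B.value Z (p.coordSwap Z Z l m) = p.pair l m := by
  cases Z <;> rfl

end Pairing

namespace Hom

variable {N : CRTModule.{w}} (α : Hom (tensor L M) N)

theorem pairing_mem {X : Part} {i j n : ℤ} (h : i + j = n) (l : L.carrier X i)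
    (m : M.carrier X j) : α.pairing.pair l m ∈ N.homog X n := by
  subst h
  exact ⟨_, rfl⟩

theorem coord_pairing_mem {Y Z : Part} {k j : ℤ} (l : L.carrier Z k) (m : M.carrier Y j) :
    α.pairing.coord Y Z l m ∈ N.coHomog Y Z (k + j) := by
  cases Y <;> cases Z
  all_goals first
    | exact α.pairing_mem rfl _ _
    | refine AddSubgroup.mem_prod.2 ⟨α.pairing_mem rfl _ _, ?_⟩
  · exact α.pairing_mem rfl _ _
  · exact α.pairing_mem (by ring) _ _
  · exact zsmul_mem (α.pairing_mem (by ring) _ _) _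
  · exact α.pairing_mem (by ring) _ _

/-- The homomorphism `l ↦ coord l m`. -/
def leftCoord {Y : Part} {j : ℤ} (m : M.carrier Y j) : Hom L (N.coShift Y j) where
  toFun Z k := AddMonoidHom.mk' (fun l => ⟨α.pairing.coord Y Z l m, α.coord_pairing_mem l m⟩)
    fun l l' => Subtype.ext (α.pairing.coord_add_left l l' m)
  map_op o _ _ h l := Subtype.ext (α.pairing.coord_op_left o h l m)

/-- The homomorphism `m ↦ coordSwap l m`. -/
def rightCoord {Z : Part} {k : ℤ} (l : L.carrier Z k) : Hom M (N.coTwist Z k) where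
  toFun Y j := AddMonoidHom.mk'
    (fun m => ⟨α.pairing.coordSwap Z Y l m, by
      rw [← Pairing.swap_coord]; exact N.swap_mem_coHomog (α.coord_pairing_mem l m)⟩)
    fun m m' => Subtype.ext (by
      change α.pairing.coordSwap Z Y l (m + m') =
        α.pairing.coordSwap Z Y l m + α.pairing.coordSwap Z Y l m'
      simp only [← Pairing.swap_coord, Pairing.coord_add_right, map_add])
  map_op o _ _ h m := Subtype.ext (α.pairing.coordSwap_op_right o h l m)

end Hom

/-- A free basis of a CRT-module. -/
structure Basis (M : CRTModule.{u}) (G : Part → ℤ → Type v) where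
  repr : Hom M (free G)
  symm : Hom (free G) M
  symm_comp_repr : symm.comp repr = Hom.id M
  repr_comp_symm : repr.comp symm = Hom.id (free G)

namespace Basis

variable {G : Part → ℤ → Type u} (b : Basis M G) {Q : CRTModule.{w}}

/-- The elements of the basis. -/
def elem {X : Part} {i : ℤ} (g : G X i) : M.carrier X i :=
  b.symm.toFun X i (presented.of g)

/-- The homomorphism with given values on the basis. -/
def lift (f : ∀ {X : Part} {i : ℤ}, G X i → Q.carrier X i) : Hom M Q :=
  (presented.lift f fun h => h.elim : Hom (free G) Q).comp b.repr

theorem lift_elem (f : ∀ {X : Part} {i : ℤ}, G X i → Q.carrier X i) {X : Part} {i : ℤ}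
    (g : G X i) : (b.lift f).toFun X i (b.elem g) = f g := by
  have h := DFunLike.congr_fun (congrFun (congrFun (congrArg Hom.toFun b.repr_comp_symm) X) i)
    (presented.of g)
  exact congrArg ((presented.lift f fun h => h.elim : Hom (free G) Q).toFun X i) h

theorem hom_ext {f f' : Hom M Q}
    (h : ∀ {X : Part} {i : ℤ} (g : G X i), f.toFun X i (b.elem g) = f'.toFun X i (b.elem g)) :
    f = f' := by
  have key : f.comp b.symm = f'.comp b.symm := presented.hom_ext h
  have h₁ (f : Hom M Q) : (f.comp b.symm).comp b.repr = f := by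
    change f.comp (b.symm.comp b.repr) = f
    rw [b.symm_comp_repr]
    rfl
  rw [← h₁ f, key, h₁]

variable {N : CRTModule.{w}}

/-- A homomorphism out of `F(b, i, X) ⊗ M` is determined by its coordinates at `b` and the
elements of a basis of `M`. -/
theorem tensor_hom_ext {X : Part} {i : ℤ} {α β : Hom (tensor (F X i) M) N}
    (h : ∀ {Y : Part} {j : ℤ} (g : G Y j),
      α.pairing.coord Y X F.b (b.elem g) = β.pairing.coord Y X F.b (b.elem g)) : α = β := by
  -- Both sides are homomorphisms out of the free module on `b`, so agreement at `b` spreads to all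
  -- `l`.
  have h₁ {Y : Part} {j : ℤ} (g : G Y j) : α.leftCoord (b.elem g) = β.leftCoord (b.elem g) :=
    F.hom_ext (Subtype.ext (h g))
  -- With `l` fixed and the factors interchanged, both sides are homomorphisms out of `M`, so
  -- agreement on the basis spreads to all `m`.
  have h₂ {Z : Part} {k : ℤ} (l : (F X i).carrier Z k) : α.rightCoord l = β.rightCoord l := by
    refine b.hom_ext fun {Y j} g => Subtype.ext ?_
    change α.pairing.coordSwap Z Y l (b.elem g) = β.pairing.coordSwap Z Y l (b.elem g)
    rw [← Pairing.swap_coord, ← Pairing.swap_coord]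
    exact congrArg (fun f : Hom (F X i) (N.coShift Y j) => N.tot.swap Y Z (f.toFun Z k l)) (h₁ g)
  refine CRTModule.tensor_hom_ext fun {Z _ j _} hn l m => ?_
  subst hn
  refine N.ι_inj ?_
  have h₃ := congrArg (fun f : Hom M (N.coTwist Z _) => N.tot.value Z (f.toFun Z j m)) (h₂ l)
  exact (α.pairing.value_coordSwap l m).symm.trans (h₃.trans (β.pairing.value_coordSwap l m))

end Basis
end CRTModule

/-! ### Maps of two variables and the pairings they define -/

namespace CRTModule

/-- Maps of two variables `l, m`, additive and compatible with all operations on both sides, with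
values in `Hom(F(Z), B)` for `l` of part `Z`. -/
structure Bihom (L : CRTModule.{u}) (M : CRTModule.{v}) (B : UngradedModule.{w}) where
  map : ∀ {Z Y : Part} {k j : ℤ}, L.carrier Z k → M.carrier Y j → (B.co Z).A Y
  add_left : ∀ {Z Y : Part} {k j : ℤ} (l l' : L.carrier Z k) (m : M.carrier Y j),
    map (l + l') m = map l m + map l' m
  add_right : ∀ {Z Y : Part} {k j : ℤ} (l : L.carrier Z k) (m m' : M.carrier Y j),
    map l (m + m') = map l m + map l m'
  op_left : ∀ {Z Z' Y : Part} (o : Op Z Z') {k k' j : ℤ} (h : k + o.deg = k')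
    (l : L.carrier Z k) (m : M.carrier Y j), map (L.op o h l) m = B.right o Y (map l m)
  op_right : ∀ {Z Y Y' : Part} (o : Op Y Y') {k j j' : ℤ} (h : j + o.deg = j')
    (l : L.carrier Z k) (m : M.carrier Y j),
    map l (M.op o h m) = sg (k * o.deg) • (B.co Z).op o (map l m)

end CRTModule

namespace UngradedModule

variable (B : UngradedModule.{u})

theorem value_right_scalar {X : Part} (a : Scalar X) (u : (B.co X).A X) :
    B.value X (B.right (.sc a) X u) = B.op (.sc a) (B.value X u) := by
  cases a <;> simp [right, co]

theorem value_op_scalar {X : Part} (a : Scalar X) (u : (B.co X).A X) :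
    B.value X ((B.co X).op (.sc a) u) = B.op (.sc a) (B.value X u) := by
  cases a <;> simp [co]

end UngradedModule

namespace CRTModule.Bihom

variable {L : CRTModule.{u}} {M : CRTModule.{v}} {B : UngradedModule.{w}} (p : Bihom L M B)

/-- The underlying pairing. -/
def pairing : Pairing L M B where
  pair {X _ _} l m := B.value X (p.map l m)
  rel h := by
    cases h with
    | add_left h l l' m =>
      exact (congrArg (B.value _) (p.add_left l l' m)).trans (map_add (B.value _) _ _)
    | add_right h l m m' =>
      exact (congrArg (B.value _) (p.add_right l m m')).trans (map_add (B.value _) _ _)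
    | scalar_left a h hi hn h' l m =>
      exact ((congrArg _ (p.op_left _ hi l m)).trans (B.value_right_scalar a _)).symm
    | @scalar_right _ a i _ _ _ _ h hj hn h' l m =>
      rw [Pairing.termEval_koszul]
      change _ = _ • B.value _ (p.map l (M.op (.sc a) hj m))
      rw [p.op_right, map_zsmul, smul_smul, mul_comm i, UngradedModule.sg_mul_self, one_smul,
        B.value_op_scalar]
      rfl
    -- In this and the following cases compatibility in both variables turns the relation into an
    -- identity between coordinates of the single element `p.map l m`.
    | c h hi hj hn l m =>
      change B.op .c (B.value _ (p.map l m)) = B.value _ (p.map (L.op .c hi l) (M.op .c hj m))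
      rw [p.op_left, p.op_right, sg_mul_zero, one_smul]
      simp [UngradedModule.right]
    | r_right h hi hj hn l m =>
      change B.op .r (B.value _ (p.map (L.op .c hi l) m)) = B.value _ (p.map l (M.op .r hj m))
      rw [p.op_left, p.op_right, sg_mul_zero, one_smul]
      simp [UngradedModule.right]
    | r_left h hi hj hn l m =>
      change B.op .r (B.value _ (p.map l (M.op .c hj m))) = B.value _ (p.map (L.op .r hi l) m)
      rw [p.op_left, p.op_right, sg_mul_zero, one_smul]
      simp [UngradedModule.right]
    | eps h hi hj hn l m =>
      change B.op .eps (B.value _ (p.map l m)) =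
        B.value _ (p.map (L.op .eps hi l) (M.op .eps hj m))
      rw [p.op_left, p.op_right, sg_mul_zero, one_smul]
      simp [UngradedModule.right]
    | zeta h hi hj hn l m =>
      change B.op .zeta (B.value _ (p.map l m)) =
        B.value _ (p.map (L.op .zeta hi l) (M.op .zeta hj m))
      rw [p.op_left, p.op_right, sg_mul_zero, one_smul]
      simp [UngradedModule.right]
    | psiU h hi hj hn l m =>
      change B.op .psiU (B.value _ (p.map l m)) =
        B.value _ (p.map (L.op .psiU hi l) (M.op .psiU hj m))
      rw [p.op_left, p.op_right, sg_mul_zero, one_smul]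
      simp [UngradedModule.right]
    | psiT h hi hj hn l m =>
      change B.op .psiT (B.value _ (p.map l m)) =
        B.value _ (p.map (L.op .psiT hi l) (M.op .psiT hj m))
      rw [p.op_left, p.op_right, sg_mul_zero, one_smul]
      simp [UngradedModule.right]
      abel
    | gamma_left h hj hi hn h' l m =>
      change B.op .gamma (B.value _ (p.map l (M.op .zeta hj m))) =
        B.value _ (p.map (L.op .gamma hi l) m)
      rw [p.op_left, p.op_right, sg_mul_zero, one_smul]
      simp [UngradedModule.right]
    | @gamma_right i _ _ _ _ h hi hj hn h' l m =>
      rw [Pairing.termEval_koszul]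
      change B.op .gamma (B.value _ (p.map (L.op .zeta hi l) m)) =
        sg i • B.value _ (p.map l (M.op .gamma hj m))
      rw [p.op_left, p.op_right, sg_mul_neg_one, map_zsmul, smul_smul,
        UngradedModule.sg_mul_self, one_smul]
      simp [UngradedModule.right]
    | tau_left h hj hi hn h' l m =>
      change B.op .tau (B.value _ (p.map l (M.op .eps hj m))) =
        B.value _ (p.map (L.op .tau hi l) m)
      rw [p.op_left, p.op_right, sg_mul_zero, one_smul]
      simp [UngradedModule.right]
    | @tau_right i _ _ _ _ h hi hj hn h' l m =>
      rw [Pairing.termEval_koszul]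
      change B.op .tau (B.value _ (p.map (L.op .eps hi l) m)) =
        sg i • B.value _ (p.map l (M.op .tau hj m))
      rw [p.op_left, p.op_right, sg_mul_one, map_zsmul, smul_smul,
        UngradedModule.sg_mul_self, one_smul]
      simp [UngradedModule.right]
    | @eps_tau i j n i' j' n' h hi hi' hj hj' hn hn' h₁ h₂ l m =>
      change B.op .eps (B.op .tau (B.value _ (p.map l m))) =
        B.value _ (p.map (L.op .eps hi' (L.op .tau hi l)) m) +
          B.termEval _ (Term.koszul _ _) + B.op .etaT (B.value _ (p.map l m))
      rw [Pairing.termEval_koszul]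
      change _ = _ + sg i • B.value _ (p.map l (M.op .eps hj' (M.op .tau hj m))) + _
      rw [p.op_left, p.op_left, p.op_right, p.op_right, sg_mul_zero, one_smul, sg_mul_one,
        map_zsmul, map_zsmul, smul_smul, UngradedModule.sg_mul_self, one_smul]
      simp [UngradedModule.right]
      abel

/-- Each coordinate is a diagonal value taken after an operation on `l` or `m`, so compatibility
with operations recovers the whole map from its pairing. -/
theorem coordSwap_pairing {Y Z : Part} {k j : ℤ} (l : L.carrier Z k) (m : M.carrier Y j) :
    p.pairing.coordSwap Z Y l m = p.map l m := by
  cases Z <;> cases Y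
  all_goals
    try refine Prod.ext ?_ ?_
    all_goals
      simp only [Pairing.coordSwap, pairing, p.op_left, p.op_right, sg_mul_zero, sg_mul_one,
        one_smul, map_zsmul, smul_smul]
      simp [UngradedModule.right, UngradedModule.sg_mul_self]

end CRTModule.Bihom

/-! ### Existence of homomorphisms with prescribed coordinates -/

namespace CRTModule

variable {L : CRTModule.{u}} {M : CRTModule.{v}} {N : CRTModule.{w}}

/-- The homomorphism out of the tensor product given by a pairing with homogeneous values. -/
def Pairing.lift (p : Pairing L M N.tot)
    (hp : ∀ {X : Part} {i j : ℤ} (l : L.carrier X i) (m : M.carrier X j),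
      p.pair l m ∈ N.homog X (i + j)) : Hom (tensor L M) N :=
  presented.lift (fun {X n} (a : PureTensor L M X n) => N.component X n (pureValue p.pair a))
    fun {X n s t} h => N.ι_inj (by
      -- Homogeneity makes the projection to degree `n` lossless, so the relations may be tested in
      -- the total module.
      have e : (fun {X : Part} {n : ℤ} (a : PureTensor L M X n) =>
          N.ι n (N.component X n (pureValue p.pair a))) = fun {X n} a => pureValue p.pair a := by
        funext X n a
        obtain ⟨rfl, l, m⟩ := a
        exact N.ι_component (hp l m)
      rw [ι_termEval, ι_termEval, e]
      exact p.rel h)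

theorem Pairing.pairing_lift (p : Pairing L M N.tot)
    (hp : ∀ {X : Part} {i j : ℤ} (l : L.carrier X i) (m : M.carrier X j),
      p.pair l m ∈ N.homog X (i + j)) {X : Part} {i j : ℤ} (l : L.carrier X i)
    (m : M.carrier X j) : (p.lift hp).pairing.pair l m = p.pair l m :=
  N.ι_component (hp l m)

theorem right_mem_coHomog {Z Z' Y : Part} (o : Op Z Z') {n n' : ℤ} (h : n + o.deg = n')
    {z : (N.tot.co Z).A Y} (hz : z ∈ N.coHomog Z Y n) :
    N.tot.right o Y z ∈ N.coHomog Z' Y n' :=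
  N.swap_mem_coHomog (N.op_mem_coHomog Y o h _ (N.swap_mem_coHomog hz))

/-- The action of an operation on the first variable. -/
def coTwistOp (N : CRTModule.{w}) {Z Z' : Part} (o : Op Z Z') {k k' : ℤ} (h : k + o.deg = k') :
    Hom (N.coTwist Z k) (N.coTwist Z' k') where
  toFun Y j := AddMonoidHom.mk'
    (fun z => ⟨N.tot.right o Y z.1, right_mem_coHomog o (by rw [← h]; ring) z.2⟩)
    fun z z' => Subtype.ext (map_add (N.tot.right o Y) z.1 z'.1)
  map_op φ _ _ _ z := Subtype.ext (by
    change N.tot.right o _ (sg (k * φ.deg) • (N.tot.co Z).op φ z.1) =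
      sg (k' * φ.deg) • (N.tot.co Z').op φ (N.tot.right o _ z.1)
    -- The sign from commuting `o` past `φ` changes the twist by `k` into the twist by `k' = k +
    -- |o|`.
    rw [map_zsmul, N.tot.right_op, smul_smul, ← sg_add, ← h, add_mul])

namespace Basis

variable {G : Part → ℤ → Type v} (b : Basis M G)

/-- The map of the second variable with given coordinates at the elements of the basis. -/
def slice (f : ∀ {Y : Part} {j : ℤ}, G Y j → Hom L (N.coShift Y j)) {Z : Part} {k : ℤ}
    (l : L.carrier Z k) : Hom M (N.coTwist Z k) :=
  b.lift (Q := N.coTwist Z k) fun {Y _} g =>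
    ⟨N.tot.swap Y Z ((f g).toFun Z k l).1, N.swap_mem_coHomog ((f g).toFun Z k l).2⟩

theorem slice_elem (f : ∀ {Y : Part} {j : ℤ}, G Y j → Hom L (N.coShift Y j)) {Y Z : Part}
    {j k : ℤ} (l : L.carrier Z k) (g : G Y j) :
    ((b.slice f l).toFun Y j (b.elem g)).1 = N.tot.swap Y Z ((f g).toFun Z k l).1 :=
  congrArg Subtype.val (b.lift_elem (Q := N.coTwist Z k) _ g)

theorem slice_add (f : ∀ {Y : Part} {j : ℤ}, G Y j → Hom L (N.coShift Y j)) {Z : Part} {k : ℤ}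
    (l l' : L.carrier Z k) : b.slice f (l + l') = b.slice f l + b.slice f l' := by
  refine b.hom_ext fun {Y j} g => Subtype.ext ?_
  change _ = ((b.slice f l).toFun Y j (b.elem g)).1 + ((b.slice f l').toFun Y j (b.elem g)).1
  rw [slice_elem, slice_elem, slice_elem, map_add]
  exact map_add (N.tot.swap Y Z) _ _

/-- Both sides are homomorphisms out of `M`, so the basis decides; there the claim is that `f g`
commutes with `o`, seen through the involution `swap`. -/
theorem slice_op (f : ∀ {Y : Part} {j : ℤ}, G Y j → Hom L (N.coShift Y j)) {Z Z' : Part}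
    (o : Op Z Z') {k k' : ℤ} (h : k + o.deg = k') (l : L.carrier Z k) :
    b.slice f (L.op o h l) = (N.coTwistOp o h).comp (b.slice f l) := by
  refine b.hom_ext fun {Y j} g => Subtype.ext ?_
  change _ = N.tot.right o Y ((b.slice f l).toFun Y j (b.elem g)).1
  rw [slice_elem, slice_elem, (f g).map_op, UngradedModule.right]
  simp only [AddMonoidHom.comp_apply]
  rw [UngradedModule.swap_swap]
  rfl

/-- The map of two variables with given coordinates at the elements of the basis. -/
def bihom (f : ∀ {Y : Part} {j : ℤ}, G Y j → Hom L (N.coShift Y j)) : Bihom L M N.tot where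
  map {_ Y _ j} l m := ((b.slice f l).toFun Y j m).1
  add_left l l' m := by rw [slice_add]; rfl
  add_right l m m' := by rw [map_add]; rfl
  op_left o _ _ _ h l m := by rw [b.slice_op f o h]; rfl
  op_right o _ _ _ h l m := by rw [Hom.map_op]; rfl

theorem bihom_pairing_mem (f : ∀ {Y : Part} {j : ℤ}, G Y j → Hom L (N.coShift Y j)) {X : Part}
    {i j : ℤ} (l : L.carrier X i) (m : M.carrier X j) :
    (b.bihom f).pairing.pair l m ∈ N.homog X (i + j) :=
  N.value_mem_homog ((b.slice f l).toFun X j m).2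

/-- The homomorphism out of the tensor product with given coordinates at the elements of the
basis. -/
def tensorLift (f : ∀ {Y : Part} {j : ℤ}, G Y j → Hom L (N.coShift Y j)) : Hom (tensor L M) N :=
  (b.bihom f).pairing.lift (b.bihom_pairing_mem f)

/-- The interchanged coordinates are the slices by construction, and a second `swap` returns to the
prescribed ones. -/
theorem coord_tensorLift (f : ∀ {Y : Part} {j : ℤ}, G Y j → Hom L (N.coShift Y j)) {Y Z : Part}
    {j k : ℤ} (l : L.carrier Z k) (g : G Y j) :
    (b.tensorLift f).pairing.coord Y Z l (b.elem g) = ((f g).toFun Z k l).1 := by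
  have h : (b.tensorLift f).pairing.coordSwap Z Y l (b.elem g) =
      (b.bihom f).pairing.coordSwap Z Y l (b.elem g) := by
    have hp {X : Part} {i j : ℤ} (l : L.carrier X i) (m : M.carrier X j) :
      (b.tensorLift f).pairing.pair l m = (b.bihom f).pairing.pair l m :=
      Pairing.pairing_lift _ (b.bihom_pairing_mem f) l m
    cases Z <;> cases Y <;> simp only [Pairing.coordSwap, hp]
  rw [Bihom.coordSwap_pairing, ← Pairing.swap_coord] at h
  have h₁ := h.trans (b.slice_elem f l g)
  have h₂ := congrArg (N.tot.swap Z Y) h₁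
  rwa [UngradedModule.swap_swap, UngradedModule.swap_swap] at h₂

variable (N) in
/-- The coordinate of an element of `Hom(M, N)` at an element of the basis. -/
def coordHom {Y : Part} {j : ℤ} (g : G Y j) : Hom (HomCRT M N) (N.coShift Y j) where
  toFun X i := AddMonoidHom.mk'
    (fun α : Hom (tensor (F X i) M) N => (α.leftCoord (b.elem g)).toFun X i F.b)
    fun α β => Subtype.ext (by
      change (α + β).pairing.coord Y X F.b (b.elem g) =
        α.pairing.coord Y X F.b (b.elem g) + β.pairing.coord Y X F.b (b.elem g)
      have h {X : Part} {i j : ℤ} (l : (F _ _).carrier X i) (m : M.carrier X j) :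
        (α + β).pairing.pair l m = α.pairing.pair l m + β.pairing.pair l m :=
          map_add (N.ι _) _ _
      cases Y <;> cases X <;> simp only [Pairing.coord, h, smul_add] <;> rfl)
  map_op {X Y'} o {i i'} h α := by
    change ((Hom.comp α (tensorMap (mu o h) M)).leftCoord (b.elem g)).toFun Y' i' F.b = _
    -- Precomposition with `μ_o ⊗ 1` replaces `l` by `μ_o(l)`; at the generator this is evaluation
    -- at `o(b)`.
    have e : (Hom.comp α (tensorMap (mu o h) M)).leftCoord (b.elem g) =
        (Hom.leftCoord α (b.elem g)).comp (mu o h) := by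
      apply Hom.ext
      funext Z k
      ext l : 1
      refine Subtype.ext ?_
      change (Hom.comp α (tensorMap (mu o h) M)).pairing.coord Y Z l (b.elem g) =
        (Hom.pairing α).coord Y Z ((mu o h).toFun Z k l) (b.elem g)
      cases Y <;> cases Z <;> simp only [Pairing.coord, ← (mu o h).map_op] <;> rfl
    rw [e]
    exact (Hom.leftCoord α (b.elem g)).map_op o h F.b

theorem coordHom_injective {X : Part} {i : ℤ} {α β : (HomCRT M N).carrier X i}
    (h : ∀ {Y : Part} {j : ℤ} (g : G Y j),
      (b.coordHom N g).toFun X i α = (b.coordHom N g).toFun X i β) : α = β :=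
  b.tensor_hom_ext fun g => congrArg Subtype.val (h g)

/-- Freeness of `F(X, i)` turns each prescribed `w g` into a homomorphism to `coShift`; these are
the data needed by `tensorLift`. -/
theorem exists_coordHom_eq {X : Part} {i : ℤ}
    (w : ∀ {Y : Part} {j : ℤ}, G Y j → (N.coShift Y j).carrier X i) :
    ∃ α : (HomCRT M N).carrier X i, ∀ {Y : Part} {j : ℤ} (g : G Y j),
      (b.coordHom N g).toFun X i α = w g :=
  ⟨b.tensorLift fun g => F.lift (w g), fun g => Subtype.ext (b.coord_tensorLift _ _ g)⟩

end Basis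
end CRTModule

/-! ### Exactness for the coordinate modules -/

namespace UngradedModule

/-- Exactness of the three sequences on homogeneous elements: kernels are contained in images. -/
structure IsAcyclicOn (C : UngradedModule.{u}) (H : ∀ X : Part, ℤ → AddSubgroup (C.A X)) :
    Prop where
  etaO_c {n : ℤ} {x : C.A .O} : x ∈ H .O n → C.op .c x = 0 → ∃ y ∈ H .O (n - 1), C.op .etaO y = x
  c_rbeta {n : ℤ} {x : C.A .U} : x ∈ H .U n → C.op .r (C.op .betaUinv x) = 0 →
    ∃ y ∈ H .O n, C.op .c y = x
  rbeta_etaO {n : ℤ} {x : C.A .O} : x ∈ H .O n → C.op .etaO x = 0 →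
    ∃ y ∈ H .U (n + 2), C.op .r (C.op .betaUinv y) = x
  etaOsq_eps {n : ℤ} {x : C.A .O} : x ∈ H .O n → C.op .eps x = 0 →
    ∃ y ∈ H .O (n - 2), C.op .etaO (C.op .etaO y) = x
  eps_taubeta {n : ℤ} {x : C.A .T} : x ∈ H .T n → C.op .tau (C.op .betaTinv x) = 0 →
    ∃ y ∈ H .O n, C.op .eps y = x
  taubeta_etaOsq {n : ℤ} {x : C.A .O} : x ∈ H .O n → C.op .etaO (C.op .etaO x) = 0 →
    ∃ y ∈ H .T (n + 3), C.op .tau (C.op .betaTinv y) = x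
  gamma_zeta {n : ℤ} {x : C.A .T} : x ∈ H .T n → C.op .zeta x = 0 →
    ∃ y ∈ H .U (n + 1), C.op .gamma y = x
  zeta_psi {n : ℤ} {x : C.A .U} : x ∈ H .U n → C.op .psiU x = x → ∃ y ∈ H .T n, C.op .zeta y = x
  psi_gamma {n : ℤ} {x : C.A .U} : x ∈ H .U n → C.op .gamma x = 0 →
    ∃ y ∈ H .U n, y - C.op .psiU y = x

variable (C : UngradedModule.{u})

/-- Here and below, successive maps compose to zero by the relations alone; acyclicity of `N` is
needed only for the inclusion of kernels in images. -/
theorem op_c_etaO (x : C.A .O) : C.op .c (C.op .etaO x) = 0 := by simp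

theorem op_r_betaUinv_c (x : C.A .O) : C.op .r (C.op .betaUinv (C.op .c x)) = 0 := by
  simp

theorem op_etaO_r_betaUinv (x : C.A .U) : C.op .etaO (C.op .r (C.op .betaUinv x)) = 0 := by
  simp

theorem op_eps_etaO_etaO (x : C.A .O) : C.op .eps (C.op .etaO (C.op .etaO x)) = 0 := by
  -- Moving `ε` inwards turns `η_O²` into `η_T² = 0`.
  have h (x : C.A .O) : C.op .eps (C.op .etaO x) = C.op .etaT (C.op .eps x) := by simp
  rw [h, h]
  simp

theorem op_tau_betaTinv_eps (x : C.A .O) : C.op .tau (C.op .betaTinv (C.op .eps x)) = 0 := by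
  simp

theorem op_etaO_etaO_tau_betaTinv (x : C.A .T) :
    C.op .etaO (C.op .etaO (C.op .tau (C.op .betaTinv x))) = 0 := by
  simp

end UngradedModule

namespace CRTModule

variable {N : CRTModule.{u}}

theorem IsAcyclic.isAcyclicOn (hN : N.IsAcyclic) : N.tot.IsAcyclicOn N.homog where
  etaO_c {n} := by
    obtain ⟨n, rfl⟩ : ∃ m, n = m + 1 := ⟨n - 1, by ring⟩
    rintro _ ⟨x, rfl⟩ h
    rw [← N.ι_op _ (add_zero _), ← map_zero (N.ι _)] at h
    obtain ⟨y, rfl⟩ := (hN.exact_etaO_c n x).1 (N.ι_inj h)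
    exact ⟨_, N.mem_homog_of_eq ⟨y, rfl⟩ (by ring), (N.ι_op _ _ y).symm⟩
  c_rbeta {n} := by
    obtain ⟨n, rfl⟩ : ∃ m, n = m + 1 := ⟨n - 1, by ring⟩
    rintro _ ⟨x, rfl⟩ h
    rw [← N.ι_op _ (by change n + 1 + -2 = n - 1; ring), ← N.ι_op _ (add_zero _),
      ← map_zero (N.ι _)] at h
    obtain ⟨y, rfl⟩ := (hN.exact_c_rbeta n x).1 (N.ι_inj h)
    exact ⟨_, ⟨y, rfl⟩, (N.ι_op _ _ y).symm⟩
  rbeta_etaO {n} := by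
    obtain ⟨n, rfl⟩ : ∃ m, n = m - 1 := ⟨n + 1, by ring⟩
    rintro _ ⟨x, rfl⟩ h
    rw [← N.ι_op _ (by change n - 1 + 1 = n; ring), ← map_zero (N.ι _)] at h
    obtain ⟨y, rfl⟩ := (hN.exact_rbeta_etaO n x).1 (N.ι_inj h)
    refine ⟨_, N.mem_homog_of_eq ⟨y, rfl⟩ (by ring), ?_⟩
    rw [AddMonoidHom.comp_apply, N.ι_op, N.ι_op]
  etaOsq_eps {n} := by
    obtain ⟨n, rfl⟩ : ∃ m, n = m + 2 := ⟨n - 2, by ring⟩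
    rintro _ ⟨x, rfl⟩ h
    rw [← N.ι_op _ (add_zero _), ← map_zero (N.ι _)] at h
    obtain ⟨y, rfl⟩ := (hN.exact_etaOsq_eps n x).1 (N.ι_inj h)
    refine ⟨_, N.mem_homog_of_eq ⟨y, rfl⟩ (by ring), ?_⟩
    rw [AddMonoidHom.comp_apply, N.ι_op, N.ι_op]
  eps_taubeta {n} := by
    obtain ⟨n, rfl⟩ : ∃ m, n = m + 2 := ⟨n - 2, by ring⟩
    rintro _ ⟨x, rfl⟩ h
    rw [← N.ι_op _ (by change n + 2 + -4 = n - 2; ring),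
      ← N.ι_op _ (by change n - 2 + 1 = n - 1; ring), ← map_zero (N.ι _)] at h
    obtain ⟨y, rfl⟩ := (hN.exact_eps_taubeta n x).1 (N.ι_inj h)
    exact ⟨_, ⟨y, rfl⟩, (N.ι_op _ _ y).symm⟩
  taubeta_etaOsq {n} := by
    obtain ⟨n, rfl⟩ : ∃ m, n = m - 1 := ⟨n + 1, by ring⟩
    rintro _ ⟨x, rfl⟩ h
    rw [← N.ι_op _ (by change n - 1 + 1 = n; ring), ← N.ι_op _ (Eq.refl (n + 1)),
      ← map_zero (N.ι _)] at h
    obtain ⟨y, rfl⟩ := (hN.exact_taubeta_etaOsq n x).1 (N.ι_inj h)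
    refine ⟨_, N.mem_homog_of_eq ⟨y, rfl⟩ (by ring), ?_⟩
    rw [AddMonoidHom.comp_apply, N.ι_op, N.ι_op]
  gamma_zeta {n} := by
    rintro _ ⟨x, rfl⟩ h
    rw [← N.ι_op _ (add_zero _), ← map_zero (N.ι _)] at h
    obtain ⟨y, rfl⟩ := (hN.exact_gamma_zeta n x).1 (N.ι_inj h)
    exact ⟨_, ⟨y, rfl⟩, (N.ι_op _ _ y).symm⟩
  zeta_psi {n} := by
    rintro _ ⟨x, rfl⟩ h
    rw [← N.ι_op _ (add_zero _)] at h
    obtain ⟨y, rfl⟩ := (hN.exact_zeta_psi n x).1 (sub_eq_zero.2 (N.ι_inj h).symm)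
    exact ⟨_, ⟨y, rfl⟩, (N.ι_op _ _ y).symm⟩
  psi_gamma {n} := by
    rintro _ ⟨x, rfl⟩ h
    rw [← N.ι_op _ (by change n + -1 = n - 1; ring), ← map_zero (N.ι _)] at h
    obtain ⟨y, rfl⟩ := (hN.exact_psi_gamma n x).1 (N.ι_inj h)
    refine ⟨_, ⟨y, rfl⟩, ?_⟩
    rw [← N.ι_op _ (add_zero _), ← map_sub]
    rfl

end CRTModule

namespace CRTModule

variable (N : CRTModule.{u})

theorem betaU_mem_homog {n m : ℤ} {x : N.tot.A .U} (hx : x ∈ N.homog .U n) (h : n + 2 = m) :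
    N.tot.op .betaU x ∈ N.homog .U m :=
  N.op_mem_homog h hx

theorem betaUinv_mem_homog {n m : ℤ} {x : N.tot.A .U} (hx : x ∈ N.homog .U n) (h : n + -2 = m) :
    N.tot.op .betaUinv x ∈ N.homog .U m :=
  N.op_mem_homog h hx

theorem betaT_mem_homog {n m : ℤ} {x : N.tot.A .T} (hx : x ∈ N.homog .T n) (h : n + 4 = m) :
    N.tot.op .betaT x ∈ N.homog .T m :=
  N.op_mem_homog h hx

theorem gamma_mem_homog {n m : ℤ} {x : N.tot.A .U} (hx : x ∈ N.homog .U n) (h : n + -1 = m) :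
    N.tot.op .gamma x ∈ N.homog .T m :=
  N.op_mem_homog h hx

theorem tau_mem_homog {n : ℤ} {x : N.tot.A .T} (hx : x ∈ N.homog .T n) :
    N.tot.op .tau x ∈ N.homog .O (n + 1) :=
  N.op_mem_homog (o := .tau) (Eq.refl (n + 1)) hx

theorem mem_homog_of_deg_eq_zero {X Y : Part} {n : ℤ} {o : Op X Y} (h : o.deg = 0) {x : N.tot.A X}
    (hx : x ∈ N.homog X n) : N.tot.op o x ∈ N.homog Y n :=
  N.op_mem_homog (by rw [h, add_zero]) hx

/-- Nothing is needed from `N`: here `c` is the diagonal, `r β_U⁻¹` a difference, `ε` and `τ` the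
inclusion and projection of a product, `ψ_U` the exchange of factors, and `η_O` is zero. -/
theorem isAcyclicOn_coU : (N.tot.co .U).IsAcyclicOn (N.coHomog .U) where
  etaO_c {n x} hx h := by
    have h : (x, x) = (0 : N.tot.A .U × N.tot.A .U) := h
    obtain rfl : x = 0 := congrArg Prod.fst h
    exact ⟨0, zero_mem _, rfl⟩
  c_rbeta := by
    rintro n ⟨a, b⟩ hx h
    have h : N.tot.op .betaUinv a + -N.tot.op .betaUinv b = 0 := h
    have h := congrArg (N.tot.op .betaU) h
    rw [map_add, map_neg, UngradedModule.op_betaU_betaUinv, UngradedModule.op_betaU_betaUinv,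
      map_zero, ← sub_eq_add_neg, sub_eq_zero] at h
    exact ⟨a, hx.1, Prod.ext rfl h⟩
  rbeta_etaO {n x} hx _ := by
    refine ⟨(N.tot.op .betaU x, 0),
      AddSubgroup.mem_prod.2 ⟨N.betaU_mem_homog hx rfl, zero_mem _⟩, ?_⟩
    simp
  etaOsq_eps {n x} hx h := by
    obtain rfl : x = 0 := congrArg Prod.fst h
    exact ⟨0, zero_mem _, rfl⟩
  eps_taubeta := by
    rintro n ⟨a, b⟩ hx h
    have h : N.tot.op .betaUinv (N.tot.op .betaUinv b) = 0 := h
    have h := congrArg (fun x => N.tot.op .betaU (N.tot.op .betaU x)) h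
    simp only [UngradedModule.op_betaU_betaUinv, map_zero] at h
    exact ⟨a, hx.1, Prod.ext rfl h.symm⟩
  taubeta_etaOsq {n x} hx _ := by
    refine ⟨(0, N.tot.op .betaU (N.tot.op .betaU x)), AddSubgroup.mem_prod.2 ⟨zero_mem _, ?_⟩, ?_⟩
    · exact N.betaU_mem_homog (N.betaU_mem_homog hx rfl) (by ring)
    · simp
  gamma_zeta := by
    rintro n ⟨a, b⟩ hx h
    obtain rfl : a = 0 := congrArg Prod.fst h
    exact ⟨(b, 0), AddSubgroup.mem_prod.2 ⟨hx.2, zero_mem _⟩, Prod.ext rfl (add_zero b)⟩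
  zeta_psi := by
    rintro n ⟨a, b⟩ hx h
    obtain rfl : b = a := congrArg Prod.fst h
    exact ⟨(b, 0), AddSubgroup.mem_prod.2 ⟨hx.1, zero_mem _⟩, rfl⟩
  psi_gamma := by
    rintro n ⟨a, b⟩ hx h
    have h : a + b = 0 := congrArg Prod.snd h
    refine ⟨(a, 0), AddSubgroup.mem_prod.2 ⟨hx.1, zero_mem _⟩, Prod.ext (sub_zero a) ?_⟩
    change 0 - a = b
    rw [zero_sub, neg_eq_of_add_eq_zero_right h]

variable {N}

/-- Only the `γ, ζ, 1 - ψ_U` sequence of `N` enters, applied coordinate by coordinate. The second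
sequence is formal, as `ε` is injective and `τ β_T⁻¹` is onto. -/
theorem isAcyclicOn_coT (hN : N.tot.IsAcyclicOn N.homog) :
    (N.tot.co .T).IsAcyclicOn (N.coHomog .T) where
  etaO_c {n x} hx h := by
    have h₁ : N.tot.op .zeta x = 0 := congrArg Prod.fst h
    have h₂ : N.tot.op .c (N.tot.op .tau x) = 0 := congrArg Prod.snd h
    obtain ⟨u, hu, rfl⟩ := hN.gamma_zeta hx h₁
    -- Here `c τ γ u = u + ψ_U u`. Since `β_U` anticommutes with `ψ_U`, the element `β_U⁻¹ u` is
    -- then fixed and has the form `ζ z`, whence `η_T z = γ u`.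
    have h₃ : N.tot.op .psiU u = -u := eq_neg_of_add_eq_zero_right (by simpa using h₂)
    obtain ⟨z, hz, h₄⟩ := hN.zeta_psi (N.betaUinv_mem_homog hu rfl) (by simp [h₃])
    refine ⟨z, N.mem_homog_of_eq hz (by ring), ?_⟩
    change N.tot.op .etaT z = _
    simp [h₄]
  c_rbeta := by
    rintro n ⟨u, u'⟩ ⟨hu, hu'⟩ h
    have h : N.tot.op .eps (N.tot.op .r (N.tot.op .betaUinv u)) +
      N.tot.op .gamma (N.tot.op .betaUinv u') = 0 := h
    -- Applying `ζ` kills the `γ` term and turns `ε r` into `c r = 1 + ψ_U`.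
    have h₁ : N.tot.op .betaUinv u + N.tot.op .psiU (N.tot.op .betaUinv u) = 0 := by
      simpa using congrArg (N.tot.op .zeta) h
    have h₂ : N.tot.op .psiU u = u := by
      have := congrArg (N.tot.op .betaU) h₁
      simp [← sub_eq_add_neg] at this
      exact (sub_eq_zero.1 this).symm
    obtain ⟨x, hx, rfl⟩ := hN.zeta_psi hu h₂
    have hcx : N.tot.op .c (N.tot.op .tau x) ∈ N.homog .U (n + 1) :=
      N.mem_homog_of_deg_eq_zero rfl (N.tau_mem_homog hx)
    have h₃ : N.tot.op .gamma (N.tot.op .betaUinv (u' - N.tot.op .c (N.tot.op .tau x))) = 0 := by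
      have e : N.tot.op .eps (N.tot.op .r (N.tot.op .betaUinv (N.tot.op .zeta x))) +
          N.tot.op .gamma (N.tot.op .betaUinv (N.tot.op .c (N.tot.op .tau x))) = 0 :=
        N.tot.coT.op_r_betaUinv_c x
      rw [map_sub, map_sub, eq_neg_of_add_eq_zero_right h, eq_neg_of_add_eq_zero_right e, sub_self]
    obtain ⟨z, hz, h₄⟩ := hN.psi_gamma (N.betaUinv_mem_homog (sub_mem hu' hcx) rfl) h₃
    have hz' : N.tot.op .gamma (N.tot.op .betaU z) ∈ N.homog .T n :=
      N.gamma_mem_homog (N.betaU_mem_homog hz rfl) (by ring)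
    -- The correction is invisible to `ζ`, while `c τ γ β_U z = β_U (z - ψ_U z)` is exactly the
    -- defect in the second coordinate.
    refine ⟨x + N.tot.op .gamma (N.tot.op .betaU z), add_mem hx hz', Prod.ext ?_ ?_⟩
    · simp
    · have := congrArg (N.tot.op .betaU) h₄
      rw [UngradedModule.op_betaU_betaUinv, eq_comm, sub_eq_iff_eq_add] at this
      rw [this]
      simp
      abel
  rbeta_etaO {n x} hx h := by
    have h : N.tot.op .etaT x = 0 := h
    have hb : N.tot.op .betaU (N.tot.op .zeta x) ∈ N.homog .U (n + 2) :=
      N.betaU_mem_homog (N.mem_homog_of_deg_eq_zero rfl hx) rfl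
    obtain ⟨z, hz, h₁⟩ := hN.psi_gamma hb (by simpa using h)
    have hz' : N.tot.op .eps (N.tot.op .r (N.tot.op .betaUinv z)) ∈ N.homog .T n :=
      N.mem_homog_of_deg_eq_zero rfl (N.mem_homog_of_deg_eq_zero rfl
        (N.betaUinv_mem_homog hz (by ring)))
    -- By anticommutation `ζ ε r β_U⁻¹ z = (1 + ψ_U) β_U⁻¹ z = β_U⁻¹ (z - ψ_U z)`, which is `ζ x`.
    have h₂ : N.tot.op .zeta (x - N.tot.op .eps (N.tot.op .r (N.tot.op .betaUinv z))) = 0 := by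
      have := congrArg (N.tot.op .betaUinv) h₁
      rw [UngradedModule.op_betaUinv_betaU] at this
      rw [map_sub, ← this]
      simp [sub_eq_add_neg]
    obtain ⟨v, hv, h₃⟩ := hN.gamma_zeta (sub_mem hx hz') h₂
    refine ⟨(z, N.tot.op .betaU v),
      AddSubgroup.mem_prod.2 ⟨hz, N.betaU_mem_homog hv (by ring)⟩, ?_⟩
    change N.tot.op .eps (N.tot.op .r (N.tot.op .betaUinv z)) +
      N.tot.op .gamma (N.tot.op .betaUinv (N.tot.op .betaU v)) = x
    rw [UngradedModule.op_betaUinv_betaU, h₃]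
    abel
  etaOsq_eps {n x} hx h := by
    obtain rfl : x = 0 := congrArg Prod.fst h
    exact ⟨0, zero_mem _, by simp only [map_zero]⟩
  eps_taubeta := by
    rintro n ⟨x, y⟩ hx h
    have h : N.tot.op .betaTinv (y + N.tot.op .etaT x) = 0 := h
    have h := congrArg (N.tot.op .betaT) h
    rw [UngradedModule.op_betaT_betaTinv, map_zero, ← eq_neg_iff_add_eq_zero] at h
    refine ⟨x, hx.1, Prod.ext rfl ?_⟩
    rw [h]
    simp
  taubeta_etaOsq {n x} hx _ := by
    refine ⟨(0, N.tot.op .betaT x),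
      AddSubgroup.mem_prod.2 ⟨zero_mem _, N.betaT_mem_homog hx (by ring)⟩, ?_⟩
    simp
  gamma_zeta := by
    rintro n ⟨x, y⟩ ⟨hx, hy⟩ h
    have h₁ : N.tot.op .zeta x = 0 := congrArg Prod.fst h
    obtain ⟨u, hu, rfl⟩ := hN.gamma_zeta hx h₁
    have h₂ : N.tot.op .c (N.tot.op .tau (N.tot.op .gamma u)) - N.tot.op .zeta y = 0 :=
      congrArg Prod.snd h
    have hu' : N.tot.op .eps (N.tot.op .r u) ∈ N.homog .T (n + 1) :=
      N.mem_homog_of_deg_eq_zero rfl (N.mem_homog_of_deg_eq_zero rfl hu)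
    -- Both `ζ y = c τ γ u` and `ζ ε r u` equal `u + ψ_U u`, so the difference lies in the image of
    -- `γ`.
    obtain ⟨v, hv, h₃⟩ := hN.gamma_zeta (sub_mem hy hu') (by
      rw [map_sub, ← sub_eq_zero.1 h₂]
      simp)
    refine ⟨(u, v), AddSubgroup.mem_prod.2 ⟨hu, hv⟩, Prod.ext rfl ?_⟩
    change N.tot.op .eps (N.tot.op .r u) + N.tot.op .gamma v = y
    rw [h₃]
    abel
  zeta_psi := by
    rintro n ⟨u, v⟩ ⟨hu, hv⟩ h
    obtain ⟨x, hx, rfl⟩ := hN.zeta_psi hu (congrArg Prod.fst h)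
    obtain ⟨z, hz, rfl⟩ := hN.zeta_psi hv (congrArg Prod.snd h)
    have hx' : N.tot.op .eps (N.tot.op .tau x) ∈ N.homog .T (n + 1) :=
      N.mem_homog_of_deg_eq_zero rfl (N.tau_mem_homog hx)
    -- The second coordinate of `ζ (x, y)` is `c τ x - ζ y`, which forces this choice up to the
    -- kernel of `ζ`.
    refine ⟨(x, N.tot.op .eps (N.tot.op .tau x) - z), AddSubgroup.mem_prod.2 ⟨hx, sub_mem hx' hz⟩,
      Prod.ext rfl ?_⟩
    simp
  psi_gamma := by
    rintro n ⟨u, v⟩ ⟨hu, hv⟩ h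
    have h₂ : N.tot.op .eps (N.tot.op .r u) + N.tot.op .gamma v = 0 := congrArg Prod.snd h
    obtain ⟨u, hu', rfl⟩ := hN.psi_gamma hu (congrArg Prod.fst h)
    -- Since `r ψ_U = r`, the term `ε r` vanishes on `u - ψ_U u`, leaving `γ v = 0`.
    obtain ⟨v, hv', rfl⟩ := hN.psi_gamma hv (by simpa using h₂)
    exact ⟨(u, v), AddSubgroup.mem_prod.2 ⟨hu', hv'⟩, rfl⟩

theorem isAcyclicOn_co (hN : N.IsAcyclic) (Y : Part) :
    (N.tot.co Y).IsAcyclicOn (N.coHomog Y) := by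
  cases Y
  exacts [hN.isAcyclicOn, N.isAcyclicOn_coU, isAcyclicOn_coT hN.isAcyclicOn]

end CRTModule

/-! ### Passage to products and conclusion -/

namespace CRTModule

theorem isAcyclic_coShift {N : CRTModule.{u}} (hN : N.IsAcyclic) (Y : Part) (j : ℤ) :
    (N.coShift Y j).IsAcyclic := by
  have h := isAcyclicOn_co hN Y
  have cast {X : Part} {m n : ℤ} {x : (N.tot.co Y).A X} (hx : x ∈ N.coHomog Y X m)
    (e : m = n) : x ∈ N.coHomog Y X n := e ▸ hx
  constructor
  · refine fun n x => ⟨fun hx => ?_, ?_⟩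
    · obtain ⟨y, hy, e⟩ := h.etaO_c x.2 (congrArg Subtype.val hx)
      exact ⟨⟨y, cast hy (by ring)⟩, Subtype.ext e⟩
    · rintro ⟨y, rfl⟩
      exact Subtype.ext ((N.tot.co Y).op_c_etaO y.1)
  · refine fun n x => ⟨fun hx => ?_, ?_⟩
    · obtain ⟨y, hy, e⟩ := h.c_rbeta x.2 (congrArg Subtype.val hx)
      exact ⟨⟨y, hy⟩, Subtype.ext e⟩
    · rintro ⟨y, rfl⟩
      exact Subtype.ext ((N.tot.co Y).op_r_betaUinv_c y.1)
  · refine fun n x => ⟨fun hx => ?_, ?_⟩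
    · obtain ⟨y, hy, e⟩ := h.rbeta_etaO x.2 (congrArg Subtype.val hx)
      exact ⟨⟨y, cast hy (by ring)⟩, Subtype.ext e⟩
    · rintro ⟨y, rfl⟩
      exact Subtype.ext ((N.tot.co Y).op_etaO_r_betaUinv y.1)
  · refine fun n x => ⟨fun hx => ?_, ?_⟩
    · obtain ⟨y, hy, e⟩ := h.etaOsq_eps x.2 (congrArg Subtype.val hx)
      exact ⟨⟨y, cast hy (by ring)⟩, Subtype.ext e⟩
    · rintro ⟨y, rfl⟩
      exact Subtype.ext ((N.tot.co Y).op_eps_etaO_etaO y.1)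
  · refine fun n x => ⟨fun hx => ?_, ?_⟩
    · obtain ⟨y, hy, e⟩ := h.eps_taubeta x.2 (congrArg Subtype.val hx)
      exact ⟨⟨y, hy⟩, Subtype.ext e⟩
    · rintro ⟨y, rfl⟩
      exact Subtype.ext ((N.tot.co Y).op_tau_betaTinv_eps y.1)
  · refine fun n x => ⟨fun hx => ?_, ?_⟩
    · obtain ⟨y, hy, e⟩ := h.taubeta_etaOsq x.2 (congrArg Subtype.val hx)
      exact ⟨⟨y, cast hy (by ring)⟩, Subtype.ext e⟩
    · rintro ⟨y, rfl⟩
      exact Subtype.ext ((N.tot.co Y).op_etaO_etaO_tau_betaTinv y.1)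
  · refine fun n x => ⟨fun hx => ?_, ?_⟩
    · obtain ⟨y, hy, e⟩ := h.gamma_zeta x.2 (congrArg Subtype.val hx)
      exact ⟨⟨y, cast hy (by ring)⟩, Subtype.ext e⟩
    · rintro ⟨y, rfl⟩
      exact Subtype.ext ((N.tot.co Y).op_zeta_gamma y.1)
  · refine fun n x => ⟨fun hx => ?_, ?_⟩
    · obtain ⟨y, hy, e⟩ := h.zeta_psi x.2 (sub_eq_zero.1 (congrArg Subtype.val hx)).symm
      exact ⟨⟨y, hy⟩, Subtype.ext e⟩
    · rintro ⟨y, rfl⟩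
      exact Subtype.ext (sub_eq_zero.2 ((N.tot.co Y).op_psiU_zeta y.1).symm)
  · refine fun n x => ⟨fun hx => ?_, ?_⟩
    · obtain ⟨y, hy, e⟩ := h.psi_gamma x.2 (congrArg Subtype.val hx)
      exact ⟨⟨y, hy⟩, Subtype.ext e⟩
    · rintro ⟨y, rfl⟩
      refine Subtype.ext ((map_sub ((N.tot.co Y).op .gamma) _ _).trans (sub_eq_zero.2 ?_))
      exact ((N.tot.co Y).op_gamma_psiU y.1).symm

/-- Exactness is detected by jointly bijective families of maps. -/
theorem exact_of_jointly_bijective {A B C : Type*} [AddCommGroup A] [AddCommGroup B]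
    [AddCommGroup C] {I : Type*} {A' B' C' : I → Type*} [∀ i, AddCommGroup (A' i)]
    [∀ i, AddCommGroup (B' i)] [∀ i, AddCommGroup (C' i)] {f : A →+ B} {g : B →+ C}
    {f' : ∀ i, A' i →+ B' i} {g' : ∀ i, B' i →+ C' i} (a : ∀ i, A →+ A' i) (b : ∀ i, B →+ B' i)
    (c : ∀ i, C →+ C' i) (hf : ∀ i x, b i (f x) = f' i (a i x))
    (hg : ∀ i x, c i (g x) = g' i (b i x)) (ha : ∀ w : ∀ i, A' i, ∃ x, ∀ i, a i x = w i)
    (hb : ∀ x y, (∀ i, b i x = b i y) → x = y) (hc : ∀ x y, (∀ i, c i x = c i y) → x = y)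
    (h : ∀ i, Function.Exact (f' i) (g' i)) : Function.Exact f g := by
  refine fun y => ⟨fun hy => ?_, ?_⟩
  -- Preimages are chosen independently in each coordinate and assembled by joint surjectivity.
  · choose w hw using fun i => (h i (b i y)).1 (by rw [← hg, hy, map_zero])
    obtain ⟨x, hx⟩ := ha w
    exact ⟨x, hb _ _ fun i => by rw [hf, hx, hw]⟩
  · rintro ⟨x, rfl⟩
    exact hc _ _ fun i => by rw [hg, hf, (h i).apply_apply_eq_zero, map_zero]

/-- Acyclicity is detected by jointly bijective families of homomorphisms. -/
theorem isAcyclic_of_jointly_bijective {P : CRTModule.{u}} {I : Type w} {Q : I → CRTModule.{v}}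
    (f : ∀ i, Hom P (Q i)) (hQ : ∀ i, (Q i).IsAcyclic)
    (hinj : ∀ {X n} (x y : P.carrier X n), (∀ i, (f i).toFun X n x = (f i).toFun X n y) → x = y)
    (hsurj : ∀ {X n} (w : ∀ i, (Q i).carrier X n), ∃ x, ∀ i, (f i).toFun X n x = w i) :
    P.IsAcyclic := by
  have h {X X' X'' n n' n''} (a : P.carrier X n →+ P.carrier X' n')
      (b : P.carrier X' n' →+ P.carrier X'' n'')
      (a' : ∀ i, (Q i).carrier X n →+ (Q i).carrier X' n')
      (b' : ∀ i, (Q i).carrier X' n' →+ (Q i).carrier X'' n'')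
      (ha : ∀ i x, (f i).toFun X' n' (a x) = a' i ((f i).toFun X n x))
      (hb : ∀ i x, (f i).toFun X'' n'' (b x) = b' i ((f i).toFun X' n' x))
      (h : ∀ i, Function.Exact (a' i) (b' i)) : Function.Exact a b :=
    exact_of_jointly_bijective (fun i => (f i).toFun X n) (fun i => (f i).toFun X' n')
      (fun i => (f i).toFun X'' n'') ha hb hsurj hinj hinj h
  constructor <;> intro n
  · refine h _ _ _ _ ?_ ?_ (fun i => (hQ i).exact_etaO_c n) <;> simp [Hom.map_op]
  · refine h _ _ _ _ ?_ ?_ (fun i => (hQ i).exact_c_rbeta n) <;> simp [Hom.map_op]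
  · refine h _ _ _ _ ?_ ?_ (fun i => (hQ i).exact_rbeta_etaO n) <;> simp [Hom.map_op]
  · refine h _ _ _ _ ?_ ?_ (fun i => (hQ i).exact_etaOsq_eps n) <;> simp [Hom.map_op]
  · refine h _ _ _ _ ?_ ?_ (fun i => (hQ i).exact_eps_taubeta n) <;> simp [Hom.map_op]
  · refine h _ _ _ _ ?_ ?_ (fun i => (hQ i).exact_taubeta_etaOsq n) <;> simp [Hom.map_op]
  · refine h _ _ _ _ ?_ ?_ (fun i => (hQ i).exact_gamma_zeta n) <;> simp [Hom.map_op]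
  · refine h _ _ _ _ ?_ ?_ (fun i => (hQ i).exact_zeta_psi n) <;> simp [Hom.map_op]
  · refine h _ _ _ _ ?_ ?_ (fun i => (hQ i).exact_psi_gamma n) <;> simp [Hom.map_op]

end CRTModule

theorem mainTheorem10 (M : CRTModule.{u}) (N : CRTModule.{v})
    (hM : M.IsFree) (hN : N.IsAcyclic) : (CRTModule.HomCRT M N).IsAcyclic := by
  obtain ⟨G, f, g, hgf, hfg⟩ := hM
  let b : M.Basis G := ⟨f, g, hgf, hfg⟩
  exact CRTModule.isAcyclic_of_jointly_bijective
    (I := Σ (Y : Part) (j : ℤ), G Y j) (fun i => b.coordHom N i.2.2)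
    (fun i => CRTModule.isAcyclic_coShift hN i.1 i.2.1)
    (fun _ _ h => b.coordHom_injective fun {Y j} g => h ⟨Y, j, g⟩)
    (fun w => (b.exists_coordHom_eq fun {Y j} g => w ⟨Y, j, g⟩).imp fun _ h i => h i.2.2)
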